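/- **Modulated quivers.** Paths are composed from right to left. View the quaternions $\mathbb H=\mathbb R1\oplus\mathbb R\mathbf j\oplus\mathbb R\mathbf k\oplus\mathbb R\mathbf l$ as the ring of matrices $\begin{bmatrix}a&b\\-\bar b&\bar a\end{bmatrix}$ with $a,b\in\mathbb C$, where $\mathbf j=\begin{bmatrix}\mathbf i&0\\0&-\mathbf i\end{bmatrix}$, $\mathbf k=\begin{bmatrix}0&1\\-1&0\end{bmatrix}$, $\mathbf l=\begin{bmatrix}0&\mathbf i\\\mathbf i&0\end{bmatrix}$. Let $Q=(Q_0,Q_1,s,t)$ be a finite quiver with a modulation $\mathcal M$: for each vertex $i$, $\mathcal M(i)\in\{\mathbb R,\mathbb C,\mathbb H\}$, and for each arrow $\alpha$, $\mathcal M(\alpha)$ is one of the following simple $\mathcal M(t(\alpha))$-$\mathcal M(s(\alpha))$-bimodules: ${}_{\mathbb R}\mathbb R_{\mathbb R}$, ${}_{\mathbb H}\mathbb H_{\mathbb H}$, ${}_{\mathbb R}\mathbb C_{\mathbb C}$, ${}_{\mathbb C}\mathbb C_{\mathbb R}$, ${}_{\mathbb R}\mathbb H_{\mathbb H}$, ${}_{\mathbb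 H}\mathbb H_{\mathbb R}$, the columns $\mathbb C^2={}_{\mathbb H}\begin{bmatrix}\mathbb C\\\mathbb C\end{bmatrix}_{\mathbb C}$, the rows $\mathbb C^2={}_{\mathbb C}\begin{bmatrix}\mathbb C&\mathbb C\end{bmatrix}_{\mathbb H}$, ${}_{\mathbb C}\mathbb C_{\mathbb C}$, and ${}_{\mathbb C}\overline{\mathbb C}_{\mathbb C}$ (right action twisted by conjugation). Let $T=T(Q,\mathcal M)$ be the tensor algebra of $\bigoplus_\alpha\mathcal M(\alpha)$ over $\prod_i\mathcal M(i)$, write $\mathcal M(\alpha\beta)=\mathcal M(\alpha)\otimes\mathcal M(\beta)\subseteq T$, and let $I$ be an ideal of $T$. For a vertex $v$, let $v^+$ (resp. $v^-$) be the set of arrows starting (resp. ending) at $v$, and $N_v=t(v^+)\cup s(v^-)$. **Complexified quiver presentation.** The complexified quiver $\Gamma$ has a vertex $i$ for each $i\in Q_0$ and a further vertex $\bar i$ if $\mathcal M(i)=\mathbb C$. An arrow $\alpha:i\to j$ of $Q$ gives in $\Gamma$: only $\alpha:i\to j$ for ${}_{\mathbb R}\mathbb R_{\mathbb R}$ and ${}_{\mathbb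 H}\mathbb H_{\mathbb H}$; otherwise two arrows $\alpha$, $\bar\alpha$, namely $\alpha,\bar\alpha:i\to j$ for ${}_{\mathbb R}\mathbb H_{\mathbb H}$, ${}_{\mathbb H}\mathbb H_{\mathbb R}$; $\alpha:i\to j$, $\bar\alpha:\bar i\to j$ for ${}_{\mathbb R}\mathbb C_{\mathbb C}$, ${}_{\mathbb H}\mathbb C^2_{\mathbb C}$; $\alpha:i\to j$, $\bar\alpha:i\to\bar j$ for ${}_{\mathbb C}\mathbb C_{\mathbb R}$, ${}_{\mathbb C}\mathbb C^2_{\mathbb H}$; $\alpha:i\to j$, $\bar\alpha:\bar i\to\bar j$ for ${}_{\mathbb C}\mathbb C_{\mathbb C}$; $\alpha:\bar i\to j$, $\bar\alpha:i\to\bar j$ for ${}_{\mathbb C}\overline{\mathbb C}_{\mathbb C}$. Let $\mathbf e=(\mathbf e_i)_i\in\prod_i\mathcal M(i)\otimes_{\mathbb R}\mathbb C$ with $\mathbf e_i=1\otimes1$ if $\mathcal M(i)\neq\mathbb H$ and $\mathbf e_i=(1\otimes1-\mathbf j\otimes\mathbf i)/2$ if $\mathcal M(i)=\mathbb H$. Let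 $\Psi:\mathbf e(T\otimes_{\mathbb R}\mathbb C)\mathbf e\to\mathbb C\Gamma$ be the isomorphism of $\mathbb C$-algebras given on vertices by $\mathbf e(a\otimes c)\mathbf e\mapsto ac\,e_i$ for $\mathbb R$, $ac\,e_i+\bar ac\,e_{\bar i}$ for $\mathbb C$, and $\mathbf e\bigl(\begin{bmatrix}a&b\\-\bar b&\bar a\end{bmatrix}\otimes c\bigr)\mathbf e\mapsto ac\,e_i$ for $\mathbb H$; and on arrows by $\mathbf e(a\otimes c)\mathbf e\mapsto ac\,\alpha$ for ${}_{\mathbb R}\mathbb R_{\mathbb R}$; $ac\,\alpha+\bar ac\,\bar\alpha$ for the bimodules with underlying set $\mathbb C$; for $\begin{bmatrix}a&b\\-\bar b&\bar a\end{bmatrix}\otimes c$: $ac\,\alpha$ for ${}_{\mathbb H}\mathbb H_{\mathbb H}$, $ac\,\alpha-\bar bc\,\bar\alpha$ for ${}_{\mathbb R}\mathbb H_{\mathbb H}$, $ac\,\alpha+bc\,\bar\alpha$ for ${}_{\mathbb H}\mathbb H_{\mathbb R}$; and $(a,b)\otimes c\mapsto ac\,\alpha-\bar bc\,\bar\alpha$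 for the columns and the rows $\mathbb C^2$. Put $J=\Psi(\mathbf e(I\otimes_{\mathbb R}\mathbb C)\mathbf e)$, an ideal of $\mathbb C\Gamma$. **Gentle vertices.** A vertex $x$ of $\Gamma$ is a gentle vertex of $\mathbb C\Gamma/J'$, for an ideal $J'$, if (G1) $|x^+|\le2$, $|x^-|\le 2$; (G2) for $\alpha\in x^+$ and $\beta\ne\gamma$ in $x^-$, exactly one of $\alpha\beta,\alpha\gamma$ is in $J'$, and for $\alpha\in x^-$ and $\beta\neq\gamma$ in $x^+$, exactly one of $\beta\alpha,\gamma\alpha$ is in $J'$. A vertex $v$ of $T/I$ is *ordinarily gentle* if $|v^+|\le2$, $|v^-|\le2$; for $\alpha\in v^+$ and $\beta\neq\gamma$ in $v^-$, $I$ includes exactly one of $\mathcal M(\alpha\beta)$, $\mathcal M(\alpha\gamma)$; for $\alpha\in v^-$ and $\beta\ne\gamma$ in $v^+$, $I$ includes exactly one of $\mathcal M(\beta\alpha)$, $\mathcal M(\gamma\alpha)$; and either $\mathcal M(v)\in\{\mathbb R,\mathbb H\}$ and $\mathcal M(u)=\mathcal M(v)$ for all $u\in N_v$, or $\mathcal M(v)=\mathbb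 C$ and $I\cap\mathcal M(\alpha\beta)\in\{0,\mathcal M(\alpha\beta)\}$ whenever $\alpha\in v^+$, $\beta\in v^-$, $\mathcal M(t(\alpha))\ne\mathbb C\neq\mathcal M(s(\beta))$. Let $\mathcal M(v)\in\{\mathbb R,\mathbb H\}$. Say that $v^+$ is *of special form* if all arrows of $v^+$ end at one vertex $w$, and $v^+$ consists of exactly two arrows $\alpha,\alpha^{\mathbf i}$ if $\mathcal M(w)=\mathcal M(v)$ and of exactly one arrow $\alpha$ otherwise; likewise for $v^-$, with starting vertex $u$ and arrows $\beta$ (and $\beta^{\mathbf i}$ if $\mathcal M(u)=\mathcal M(v)$). The vertices $u,v,w$ need not be distinct; if $N_v=\{v\}$, take $\alpha=\beta$ and $\alpha^{\mathbf i}=\beta^{\mathbf i}$. If both are of special form, there are 18 cases for $(\mathcal M(u),\mathcal M(v),\mathcal M(w))$. Write $a_\gamma$ for $a\in\mathcal M(\gamma)$, $a_\alpha b_\beta$ for $a_\alpha\otimes b_\beta$, and $\epsilon_1,\epsilon_2$ for the standard vectors of $\mathbb C^2$. Let $I_v^0$, $I_v^1$ be the $\mathcal M(w)$-$\mathcal M(u)$-subbimodules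 of $\bigoplus\mathcal M(\alpha\beta)$ (sum over $v^+\times v^-$) generated by the following elements. - $\mathbb{RRR}$: $I_v^0$: $1_\alpha1_\beta-1_{\alpha^{\mathbf i}}1_{\beta^{\mathbf i}}$ and $-1_\alpha1_{\beta^{\mathbf i}}-1_{\alpha^{\mathbf i}}1_\beta$; $I_v^1$: $1_\alpha1_\beta+1_{\alpha^{\mathbf i}}1_{\beta^{\mathbf i}}$ and $1_\alpha1_{\beta^{\mathbf i}}-1_{\alpha^{\mathbf i}}1_\beta$. - $\mathbb{RRH}$: $1_\alpha1_\beta+\mathbf j_\alpha1_{\beta^{\mathbf i}}$; $1_\alpha1_\beta-\mathbf j_\alpha1_{\beta^{\mathbf i}}$. - $\mathbb{RRC}$: $1_\alpha1_\beta+\mathbf i_\alpha1_{\beta^{\mathbf i}}$; $1_\alpha1_\beta-\mathbf i_\alpha1_{\beta^{\mathbf i}}$. - $\mathbb{HHR}$: $1_\alpha1_\beta+1_\alpha\mathbf j_{\beta^{\mathbf i}}$; $1_\alpha\mathbf k_\beta-1_\alpha\mathbf l_{\beta^{\mathbf i}}$. - $\mathbb{HHH}$: $1_\alpha1_\beta-1_{\alpha^{\mathbf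 i}}1_{\beta^{\mathbf i}}+1_\alpha\mathbf j_{\beta^{\mathbf i}}+1_{\alpha^{\mathbf i}}\mathbf j_\beta$; $1_\alpha\mathbf k_\beta+1_{\alpha^{\mathbf i}}\mathbf k_{\beta^{\mathbf i}}-1_\alpha\mathbf l_{\beta^{\mathbf i}}+1_{\alpha^{\mathbf i}}\mathbf l_\beta$. - $\mathbb{HHC}$: $(\epsilon_1)_\alpha1_\beta+(\epsilon_1)_\alpha\mathbf j_{\beta^{\mathbf i}}$; $(\epsilon_1)_\alpha\mathbf k_\beta-(\epsilon_1)_\alpha\mathbf l_{\beta^{\mathbf i}}$. - $\mathbb{HRR}$: $1_\alpha1_\beta+1_{\alpha^{\mathbf i}}\mathbf j_\beta$; $1_\alpha1_\beta-1_{\alpha^{\mathbf i}}\mathbf j_\beta$. - $\mathbb{CRR}$: $1_\alpha1_\beta+1_{\alpha^{\mathbf i}}\mathbf i_\beta$; $1_\alpha1_\beta-1_{\alpha^{\mathbf i}}\mathbf i_\beta$. - $\mathbb{RHH}$: $1_\alpha1_\beta+1_{\alpha^{\mathbf i}}\mathbf j_\beta$; $1_\alpha\mathbf k_\beta+1_{\alpha^{\mathbf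 i}}\mathbf l_\beta$. - $\mathbb{CHH}$: $1_\alpha(\epsilon_1)_\beta+\mathbf j_{\alpha^{\mathbf i}}(\epsilon_1)_\beta$; $\mathbf k_\alpha(\epsilon_1)_\beta+\mathbf l_{\alpha^{\mathbf i}}(\epsilon_1)_\beta$. - $\mathbb{HRH}$: $1_\alpha1_\beta-\mathbf j_\alpha\mathbf j_\beta$; $1_\alpha1_\beta+\mathbf j_\alpha\mathbf j_\beta$. - $\mathbb{HRC}$: $1_\alpha1_\beta-\mathbf i_\alpha\mathbf j_\beta$; $1_\alpha1_\beta+\mathbf i_\alpha\mathbf j_\beta$. - $\mathbb{CRH}$: $1_\alpha1_\beta-\mathbf j_\alpha\mathbf i_\beta$; $1_\alpha1_\beta+\mathbf j_\alpha\mathbf i_\beta$. - $\mathbb{CRC}$: $1_\alpha1_\beta-\mathbf i_\alpha\mathbf i_\beta$; $1_\alpha1_\beta+\mathbf i_\alpha\mathbf i_\beta$. - $\mathbb{RHC}$: $(\epsilon_1)_\alpha1_\beta$; $(\epsilon_1)_\alpha\mathbf k_\beta$. - $\mathbb{CHR}$: $1_\alpha(\epsilon_1)_\beta$; $-\mathbf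 k_\alpha(\epsilon_1)_\beta$. - $\mathbb{CHC}$: $(\epsilon_1)_\alpha(\epsilon_1)_\beta$; $(\epsilon_1)_\alpha(\epsilon_2)_\beta$. - $\mathbb{RHR}$: $I_v^0$: $1_\alpha1_\beta$ and $1_\alpha\mathbf j_\beta$; $I_v^1$: $1_\alpha\mathbf k_\beta$ and $1_\alpha\mathbf l_\beta$. The vertex $v$ is *specially gentle* if $\mathcal M(v)\neq\mathbb C$ and either (1) $v^+$ and $v^-$ are of special form and, for some choice of the names of the arrows, $I$ includes exactly one of $I_v^0$, $I_v^1$; or (2) each of $v^+$, $v^-$ is empty or of special form, and at least one of them is empty. The vertex $v$ is *gentle* in $T/I$ if it is ordinarily or specially gentle. **The automorphism $d_v$.** For a gentle vertex $v$, let $d_v=\mathrm{id}_{\mathbb C\Gamma}$ if $v$ is ordinarily gentle or specially gentle by (2). If $v$ is specially gentle by (1), let $d_v$ be the automorphism of the $\mathbb C$-algebra $\mathbb C\Gamma$ with $d_v(\gamma)=(\gamma+\gamma^{\mathbf i})/2$ and $d_v(\gamma^{\mathbf i})=(\gamma-\gamma^{\mathbf i})/2\mathbf i$ for each pair of parallel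 arrows with $v^+=\{\gamma,\gamma^{\mathbf i}\}$ or $v^-=\{\gamma,\gamma^{\mathbf i}\}$, named as in (1), which fixes all trivial paths and all other arrows of $\Gamma$. Put $J_v=d_v(J)$. **Proposition.** Let $v$ be a gentle vertex in $T(Q,\mathcal M)/I$. Then such a $d_v$ exists, and for every such $d_v$ there is an isomorphism of $\mathbb C$-algebras $\mathbb C\Gamma/J\simeq\mathbb C\Gamma/J_v$ induced by $d_v$, and $v$ and $\bar v$ (if it exists) are gentle vertices in $\mathbb C\Gamma/J_v$. -/

import Mathlib

open scoped TensorProduct Quaternion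

set_option linter.unnecessarySeqFocus false
set_option linter.unusedSimpArgs false
set_option linter.unusedSectionVars false
set_option linter.unusedTactic false
set_option linter.unreachableTactic false

namespace ComplexifiedGentle

/-! ## Tensor algebras of bimodules -/

section TensorAlgebra

variable (k A V : Type*) [CommRing k] [Ring A] [Algebra k A] [AddCommGroup V] [Module A V]
  [Module Aᵐᵒᵖ V]

/-- The relations which turn the free `k`-algebra on the set `A ⊔ V` into the tensor algebra of the
`A`-bimodule `V`: the map from `A` is a homomorphism of `k`-algebras, and the map from `V` is a
homomorphism of `A`-bimodules. -/
inductive BimodTensorRel : FreeAlgebra k (A ⊕ V) → FreeAlgebra k (A ⊕ V) → Prop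
  | coef_algebraMap (r : k) :
      BimodTensorRel (FreeAlgebra.ι k (Sum.inl (algebraMap k A r))) (algebraMap k _ r)
  | coef_add (a b : A) :
      BimodTensorRel (FreeAlgebra.ι k (Sum.inl (a + b)))
        (FreeAlgebra.ι k (Sum.inl a) + FreeAlgebra.ι k (Sum.inl b))
  | coef_mul (a b : A) :
      BimodTensorRel (FreeAlgebra.ι k (Sum.inl (a * b)))
        (FreeAlgebra.ι k (Sum.inl a) * FreeAlgebra.ι k (Sum.inl b))
  | vec_add (x y : V) :
      BimodTensorRel (FreeAlgebra.ι k (Sum.inr (x + y)))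
        (FreeAlgebra.ι k (Sum.inr x) + FreeAlgebra.ι k (Sum.inr y))
  | vec_left (a : A) (x : V) :
      BimodTensorRel (FreeAlgebra.ι k (Sum.inr (a • x)))
        (FreeAlgebra.ι k (Sum.inl a) * FreeAlgebra.ι k (Sum.inr x))
  | vec_right (x : V) (a : A) :
      BimodTensorRel (FreeAlgebra.ι k (Sum.inr (MulOpposite.op a • x)))
        (FreeAlgebra.ι k (Sum.inr x) * FreeAlgebra.ι k (Sum.inl a))

/-- The tensor algebra `T(A, V) = A ⊕ V ⊕ (V ⊗_A V) ⊕ ⋯` of an `A`-bimodule `V`, where `A` is a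
(not necessarily commutative) `k`-algebra, presented by its universal property. -/
abbrev BimodTensor : Type _ := RingQuot (BimodTensorRel k A V)

/-- The inclusion of the degree zero part `A`. -/
noncomputable def BimodTensor.coef : A →ₐ[k] BimodTensor k A V where
  toFun a := RingQuot.mkAlgHom k (BimodTensorRel k A V) (FreeAlgebra.ι k (Sum.inl a))
  map_one' := by
    rw [← map_one (algebraMap k A),
      RingQuot.mkAlgHom_rel k (BimodTensorRel.coef_algebraMap (A := A) (V := V) (1 : k)), map_one,
      map_one]
  map_mul' a b := by rw [RingQuot.mkAlgHom_rel k (BimodTensorRel.coef_mul a b), map_mul]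
  map_zero' := by
    rw [← map_zero (algebraMap k A),
      RingQuot.mkAlgHom_rel k (BimodTensorRel.coef_algebraMap (A := A) (V := V) (0 : k)), map_zero,
      map_zero]
  map_add' a b := by rw [RingQuot.mkAlgHom_rel k (BimodTensorRel.coef_add a b), map_add]
  commutes' r := by
    rw [RingQuot.mkAlgHom_rel k (BimodTensorRel.coef_algebraMap r)]
    exact AlgHom.commutes _ r

/-- The inclusion of the degree one part `V`. -/
noncomputable def BimodTensor.vec : V →+ BimodTensor k A V where
  toFun x := RingQuot.mkAlgHom k (BimodTensorRel k A V) (FreeAlgebra.ι k (Sum.inr x))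
  map_zero' := by
    have h := RingQuot.mkAlgHom_rel k (BimodTensorRel.vec_add (k := k) (A := A) (0 : V) 0)
    rw [add_zero, map_add] at h
    simpa using h
  map_add' x y := by rw [RingQuot.mkAlgHom_rel k (BimodTensorRel.vec_add x y), map_add]

variable {k A V}

theorem BimodTensor.vec_left (a : A) (x : V) :
    vec k A V (a • x) = coef k A V a * vec k A V x :=
  (RingQuot.mkAlgHom_rel k (BimodTensorRel.vec_left a x)).trans (map_mul _ _ _)

theorem BimodTensor.vec_right (x : V) (a : A) :
    vec k A V (MulOpposite.op a • x) = vec k A V x * coef k A V a :=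
  (RingQuot.mkAlgHom_rel k (BimodTensorRel.vec_right x a)).trans (map_mul _ _ _)

/-- The universal property of the tensor algebra. -/
noncomputable def BimodTensor.lift {B : Type*} [Ring B] [Algebra k B] (f : A →ₐ[k] B) (g : V →+ B)
    (hl : ∀ a x, g (a • x) = f a * g x) (hr : ∀ x a, g (MulOpposite.op a • x) = g x * f a) :
    BimodTensor k A V →ₐ[k] B :=
  RingQuot.liftAlgHom k ⟨FreeAlgebra.lift k (Sum.elim f g), by
    intro x y h
    induction h <;> simp [hl, hr]⟩

@[simp] theorem BimodTensor.lift_coef {B : Type*} [Ring B] [Algebra k B] (f : A →ₐ[k] B)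
    (g : V →+ B) (hl : ∀ a x, g (a • x) = f a * g x)
    (hr : ∀ x a, g (MulOpposite.op a • x) = g x * f a) (a : A) :
    lift f g hl hr (coef k A V a) = f a := by
  change RingQuot.liftAlgHom k _ (RingQuot.mkAlgHom k _ _) = _
  rw [RingQuot.liftAlgHom_mkAlgHom_apply]
  simp

@[simp] theorem BimodTensor.lift_vec {B : Type*} [Ring B] [Algebra k B] (f : A →ₐ[k] B)
    (g : V →+ B) (hl : ∀ a x, g (a • x) = f a * g x)
    (hr : ∀ x a, g (MulOpposite.op a • x) = g x * f a) (x : V) :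
    lift f g hl hr (vec k A V x) = g x := by
  change RingQuot.liftAlgHom k _ (RingQuot.mkAlgHom k _ _) = _
  rw [RingQuot.liftAlgHom_mkAlgHom_apply]
  simp

end TensorAlgebra

/-! ## Quivers, path algebras, gentle vertices -/

/-- A quiver `(Q₀, Q₁, s, t)` with set of vertices `V` and set of arrows `E`. -/
structure ArrowQuiver (V E : Type*) where
  /-- starting vertex of an arrow -/
  s : E → V
  /-- terminal vertex of an arrow -/
  t : E → V

namespace ArrowQuiver

section

variable {V E : Type*} (Γ : ArrowQuiver V E)

section

variable [Fintype E] [DecidableEq V]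

/-- `v⁺`, the set of arrows starting at `v`. -/
def outArrows (v : V) : Finset E := {α | Γ.s α = v}

/-- `v⁻`, the set of arrows ending at `v`. -/
def inArrows (v : V) : Finset E := {α | Γ.t α = v}

/-- `N_v`, the set of vertices adjacent to `v`. -/
def neighbors (v : V) : Finset V := (Γ.outArrows v).image Γ.t ∪ (Γ.inArrows v).image Γ.s

end

/-- The vector space with basis the arrows of `Γ`, as a bimodule over `k^V`. -/
@[nolint unusedArguments]
def ArrowSpan (k : Type*) (_ : ArrowQuiver V E) : Type _ := E → k

variable (k : Type*) [Field k]

instance : AddCommGroup (Γ.ArrowSpan k) := inferInstanceAs (AddCommGroup (E → k))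

/-- `e_i α = α` if `i` is the terminal vertex of `α`, and `0` otherwise. -/
instance : Module (V → k) (Γ.ArrowSpan k) where
  smul a x := fun e => a (Γ.t e) * x e
  one_smul x := funext fun e => one_mul (x e)
  mul_smul a b x := funext fun e => mul_assoc (a (Γ.t e)) (b (Γ.t e)) (x e)
  smul_zero a := funext fun e => mul_zero (a (Γ.t e))
  smul_add a x y := funext fun e => mul_add (a (Γ.t e)) (x e) (y e)
  add_smul a b x := funext fun e => add_mul (a (Γ.t e)) (b (Γ.t e)) (x e)
  zero_smul x := funext fun e => zero_mul (x e)

/-- `α e_i = α` if `i` is the starting vertex of `α`, and `0` otherwise. -/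
instance : Module (V → k)ᵐᵒᵖ (Γ.ArrowSpan k) where
  smul a x := fun e => x e * a.unop (Γ.s e)
  one_smul x := funext fun e => mul_one (x e)
  mul_smul a b x := funext fun e => (mul_assoc (x e) (b.unop (Γ.s e)) (a.unop (Γ.s e))).symm
  smul_zero a := funext fun e => zero_mul (a.unop (Γ.s e))
  smul_add a x y := funext fun e => add_mul (x e) (y e) (a.unop (Γ.s e))
  add_smul a b x := funext fun e => mul_add (x e) (a.unop (Γ.s e)) (b.unop (Γ.s e))
  zero_smul x := funext fun e => mul_zero (x e)

/-- The path algebra `kΓ` of a finite quiver, as the tensor algebra of the `k^V`-bimodule `k^E`.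
Paths are composed from right to left. -/
abbrev PathAlgebra : Type _ := BimodTensor k (V → k) (Γ.ArrowSpan k)

variable [DecidableEq V] [DecidableEq E]

/-- The trivial path at `x`. -/
noncomputable def triv (x : V) : Γ.PathAlgebra k :=
  BimodTensor.coef k (V → k) (Γ.ArrowSpan k) (Pi.single x 1)

/-- An arrow, as an element of the path algebra. -/
noncomputable def arrow (α : E) : Γ.PathAlgebra k :=
  BimodTensor.vec k (V → k) (Γ.ArrowSpan k) (Pi.single α 1 : E → k)

variable {k}

/-- `v` is a gentle vertex in `kΓ/J`. -/
structure IsGentleVertex [Fintype E] (J : TwoSidedIdeal (Γ.PathAlgebra k)) (v : V) : Prop where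
  card_out : (Γ.outArrows v).card ≤ 2
  card_in : (Γ.inArrows v).card ≤ 2
  xor_in : ∀ α ∈ Γ.outArrows v, ∀ β ∈ Γ.inArrows v, ∀ γ ∈ Γ.inArrows v, β ≠ γ →
    Xor (Γ.arrow k α * Γ.arrow k β ∈ J) (Γ.arrow k α * Γ.arrow k γ ∈ J)
  xor_out : ∀ α ∈ Γ.inArrows v, ∀ β ∈ Γ.outArrows v, ∀ γ ∈ Γ.outArrows v, β ≠ γ →
    Xor (Γ.arrow k β * Γ.arrow k α ∈ J) (Γ.arrow k γ * Γ.arrow k α ∈ J)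

end

end ArrowQuiver

/-! ## Division rings over `ℝ` and their simple bimodules -/

/-- The finite-dimensional real division rings `ℝ`, `ℂ`, `ℍ`. -/
inductive DivRing
  | R
  | C
  | H
  deriving DecidableEq

/-- The underlying ring. -/
def DivRing.carrier : DivRing → Type
  | .R => ℝ
  | .C => ℂ
  | .H => ℍ[ℝ]

noncomputable instance : (D : DivRing) → DivisionRing D.carrier
  | .R => inferInstanceAs (DivisionRing ℝ)
  | .C => inferInstanceAs (DivisionRing ℂ)
  | .H => inferInstanceAs (DivisionRing ℍ[ℝ])

noncomputable instance : (D : DivRing) → Algebra ℝ D.carrier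
  | .R => inferInstanceAs (Algebra ℝ ℝ)
  | .C => inferInstanceAs (Algebra ℝ ℂ)
  | .H => inferInstanceAs (Algebra ℝ ℍ[ℝ])

/-- `ℍ` as an algebra of matrices `[a, b; -b̄, ā]`. The units `𝐣, 𝐤, 𝐥` of `ℍ` given by the matrices
`[i, 0; 0, -i]`, `[0, 1; -1, 0]`, `[0, i; i, 0]` are the second, third and fourth basis vectors of
`ℍ[ℝ]`. -/
def quatMatrix (q : ℍ[ℝ]) : Matrix (Fin 2) (Fin 2) ℂ :=
  !![⟨q.re, q.imI⟩, ⟨q.imJ, q.imK⟩; ⟨-q.imJ, q.imK⟩, ⟨q.re, -q.imI⟩]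

/-- The unit `𝐣` of `ℍ`. -/
def qj : ℍ[ℝ] := ⟨0, 1, 0, 0⟩
/-- The unit `𝐤` of `ℍ`. -/
def qk : ℍ[ℝ] := ⟨0, 0, 1, 0⟩
/-- The unit `𝐥` of `ℍ`. -/
def ql : ℍ[ℝ] := ⟨0, 0, 0, 1⟩

theorem quatMatrix_units :
    quatMatrix 1 = 1 ∧ quatMatrix qj = !![Complex.I, 0; 0, -Complex.I] ∧
      quatMatrix qk = !![0, 1; -1, 0] ∧ quatMatrix ql = !![0, Complex.I; Complex.I, 0] := by
  refine ⟨?_, ?_, ?_, ?_⟩ <;> ext i j <;> fin_cases i <;> fin_cases j <;>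
    simp [quatMatrix, qj, qk, ql, Complex.ext_iff]

/-- The embedding of rings of `ℍ` into `M₂(ℂ)`. -/
def quatMatrixHom : ℍ[ℝ] →+* Matrix (Fin 2) (Fin 2) ℂ where
  toFun := quatMatrix
  map_one' := quatMatrix_units.1
  map_mul' p q := by
    ext i j <;> fin_cases i <;> fin_cases j <;>
      simp [quatMatrix, Matrix.mul_apply, Complex.ext_iff] <;> (constructor <;> ring)
  map_zero' := by
    ext i j <;> fin_cases i <;> fin_cases j <;> simp [quatMatrix, Complex.ext_iff]
  map_add' p q := by
    ext i j <;> fin_cases i <;> fin_cases j <;> simp [quatMatrix, Complex.ext_iff, add_comm]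

/-- `ℍ` acts from the left on the columns of length two over `ℂ`. -/
@[reducible]
noncomputable def quatColumnModule : Module ℍ[ℝ] (Fin 2 → ℂ) where
  smul q x := (quatMatrixHom q).mulVec x
  one_smul x := by change (quatMatrixHom 1).mulVec x = x; simp
  mul_smul p q x := by
    change (quatMatrixHom (p * q)).mulVec x =
      (quatMatrixHom p).mulVec ((quatMatrixHom q).mulVec x)
    rw [map_mul, Matrix.mulVec_mulVec]
  smul_zero q := Matrix.mulVec_zero _
  smul_add q := Matrix.mulVec_add _
  add_smul p q x := by
    change (quatMatrixHom (p + q)).mulVec x =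
      (quatMatrixHom p).mulVec x + (quatMatrixHom q).mulVec x
    rw [map_add, Matrix.add_mulVec]
  zero_smul x := by change (quatMatrixHom 0).mulVec x = 0; simp

/-- `ℍ` acts from the right on the rows of length two over `ℂ`. -/
@[reducible]
noncomputable def quatRowModule : Module ℍ[ℝ]ᵐᵒᵖ (Fin 2 → ℂ) where
  smul q x := Matrix.vecMul x (quatMatrixHom q.unop)
  one_smul x := by change Matrix.vecMul x (quatMatrixHom 1) = x; simp
  mul_smul p q x := by
    change Matrix.vecMul x (quatMatrixHom (q.unop * p.unop)) =
      Matrix.vecMul (Matrix.vecMul x (quatMatrixHom q.unop)) (quatMatrixHom p.unop)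
    rw [map_mul, Matrix.vecMul_vecMul]
  smul_zero q := Matrix.zero_vecMul _
  smul_add q := fun x y => Matrix.add_vecMul _ x y
  add_smul p q x := by
    change Matrix.vecMul x (quatMatrixHom (p.unop + q.unop)) =
      Matrix.vecMul x (quatMatrixHom p.unop) + Matrix.vecMul x (quatMatrixHom q.unop)
    rw [map_add, Matrix.vecMul_add]
  zero_smul x := by change Matrix.vecMul x (quatMatrixHom 0) = 0; simp

/-- The simple bimodules over the division rings `ℝ`, `ℂ`, `ℍ` up to isomorphism; an element of
`SimpleBimod D D'` is a `D`-`D'`-bimodule.  The constructors `HC` and `CH` stand for the columns and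
the rows of length two over `ℂ`; `CCbar` stands for `ℂ` with the right action twisted by complex
conjugation; all the others stand for the larger of the two division rings. -/
inductive SimpleBimod : DivRing → DivRing → Type
  | RR : SimpleBimod .R .R
  | HH : SimpleBimod .H .H
  | RC : SimpleBimod .R .C
  | CR : SimpleBimod .C .R
  | RH : SimpleBimod .R .H
  | HR : SimpleBimod .H .R
  | HC : SimpleBimod .H .C
  | CH : SimpleBimod .C .H
  | CC : SimpleBimod .C .C
  | CCbar : SimpleBimod .C .C

namespace SimpleBimod

/-- The underlying set. -/
def carrier : {D D' : DivRing} → SimpleBimod D D' → Type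
  | _, _, .RR => ℝ
  | _, _, .HH => ℍ[ℝ]
  | _, _, .RC => ℂ
  | _, _, .CR => ℂ
  | _, _, .RH => ℍ[ℝ]
  | _, _, .HR => ℍ[ℝ]
  | _, _, .HC => Fin 2 → ℂ
  | _, _, .CH => Fin 2 → ℂ
  | _, _, .CC => ℂ
  | _, _, .CCbar => ℂ

noncomputable instance : {D D' : DivRing} → (S : SimpleBimod D D') → AddCommGroup S.carrier
  | _, _, .RR => inferInstanceAs (AddCommGroup ℝ)
  | _, _, .HH => inferInstanceAs (AddCommGroup ℍ[ℝ])
  | _, _, .RC => inferInstanceAs (AddCommGroup ℂ)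
  | _, _, .CR => inferInstanceAs (AddCommGroup ℂ)
  | _, _, .RH => inferInstanceAs (AddCommGroup ℍ[ℝ])
  | _, _, .HR => inferInstanceAs (AddCommGroup ℍ[ℝ])
  | _, _, .HC => inferInstanceAs (AddCommGroup (Fin 2 → ℂ))
  | _, _, .CH => inferInstanceAs (AddCommGroup (Fin 2 → ℂ))
  | _, _, .CC => inferInstanceAs (AddCommGroup ℂ)
  | _, _, .CCbar => inferInstanceAs (AddCommGroup ℂ)

/-- The left action. -/
noncomputable instance : {D D' : DivRing} → (S : SimpleBimod D D') → Module D.carrier S.carrier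
  | _, _, .RR => (inferInstance : Module ℝ ℝ)
  | _, _, .HH => (inferInstance : Module ℍ[ℝ] ℍ[ℝ])
  | _, _, .RC => (inferInstance : Module ℝ ℂ)
  | _, _, .CR => (inferInstance : Module ℂ ℂ)
  | _, _, .RH => (inferInstance : Module ℝ ℍ[ℝ])
  | _, _, .HR => (inferInstance : Module ℍ[ℝ] ℍ[ℝ])
  | _, _, .HC => quatColumnModule
  | _, _, .CH => (inferInstance : Module ℂ (Fin 2 → ℂ))
  | _, _, .CC => (inferInstance : Module ℂ ℂ)
  | _, _, .CCbar => (inferInstance : Module ℂ ℂ)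

/-- The right action. -/
noncomputable instance : {D D' : DivRing} → (S : SimpleBimod D D') → Module D'.carrierᵐᵒᵖ S.carrier
  | _, _, .RR => (inferInstance : Module ℝᵐᵒᵖ ℝ)
  | _, _, .HH => (inferInstance : Module ℍ[ℝ]ᵐᵒᵖ ℍ[ℝ])
  | _, _, .RC => (inferInstance : Module ℂᵐᵒᵖ ℂ)
  | _, _, .CR => (Module.compHom ℂ (algebraMap ℝ ℂ).op : Module ℝᵐᵒᵖ ℂ)
  | _, _, .RH => (inferInstance : Module ℍ[ℝ]ᵐᵒᵖ ℍ[ℝ])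
  | _, _, .HR => (Module.compHom ℍ[ℝ] (algebraMap ℝ ℍ[ℝ]).op : Module ℝᵐᵒᵖ ℍ[ℝ])
  | _, _, .HC => (inferInstance : Module ℂᵐᵒᵖ (Fin 2 → ℂ))
  | _, _, .CH => quatRowModule
  | _, _, .CC => (inferInstance : Module ℂᵐᵒᵖ ℂ)
  | _, _, .CCbar => (Module.compHom ℂ (starRingEnd ℂ).op : Module ℂᵐᵒᵖ ℂ)

instance {D D' : DivRing} (S : SimpleBimod D D') :
    SMulCommClass D.carrier D'.carrierᵐᵒᵖ S.carrier where
  smul_comm a b x := by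
    cases S
    · have h : ∀ a b x : ℝ, a * (x * b) = (a * x) * b := fun a b x => (mul_assoc a x b).symm
      exact h a b.unop x
    · have h : ∀ a b x : ℍ[ℝ], a * (x * b) = (a * x) * b := fun a b x => (mul_assoc a x b).symm
      exact h a b.unop x
    · have h : ∀ (a : ℝ) (b x : ℂ), a • (x * b) = (a • x) * b :=
        fun a b x => (smul_mul_assoc a x b).symm
      exact h a b.unop x
    · have h : ∀ (a : ℂ) (b : ℝ) (x : ℂ), a * (x * algebraMap ℝ ℂ b) = (a * x) * algebraMap ℝ ℂ b :=
        fun a b x => (mul_assoc a x _).symm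
      exact h a b.unop x
    · have h : ∀ (a : ℝ) (b x : ℍ[ℝ]), a • (x * b) = (a • x) * b :=
        fun a b x => (smul_mul_assoc a x b).symm
      exact h a b.unop x
    · have h : ∀ (a : ℍ[ℝ]) (b : ℝ) (x : ℍ[ℝ]),
          a * (x * algebraMap ℝ ℍ[ℝ] b) = (a * x) * algebraMap ℝ ℍ[ℝ] b :=
        fun a b x => (mul_assoc a x _).symm
      exact h a b.unop x
    · have h : ∀ (a : ℍ[ℝ]) (b : ℂ) (x : Fin 2 → ℂ), (quatMatrixHom a).mulVec (MulOpposite.op b • x)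
          = MulOpposite.op b • (quatMatrixHom a).mulVec x :=
        fun a b x => Matrix.mulVec_smul _ _ _
      exact h a b.unop x
    · have h : ∀ (a : ℂ) (b : ℍ[ℝ]) (x : Fin 2 → ℂ), a • Matrix.vecMul x (quatMatrixHom b)
          = Matrix.vecMul (a • x) (quatMatrixHom b) :=
        fun a b x => (Matrix.smul_vecMul _ _ _).symm
      exact h a b.unop x
    · have h : ∀ a b x : ℂ, a * (x * b) = (a * x) * b := fun a b x => (mul_assoc a x b).symm
      exact h a b.unop x
    · have h : ∀ a b x : ℂ, a * (x * starRingEnd ℂ b) = (a * x) * starRingEnd ℂ b :=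
        fun a b x => (mul_assoc a x _).symm
      exact h a b.unop x

end SimpleBimod

/-! ## The scalars which describe `Ψ`

For `z ∈ M ⊗_ℝ ℂ`, where `M` is one of the division rings or bimodules above, we write
`z = p ⊗ 1 + q ⊗ i` and store the pair `(p, q)`. -/

namespace DivRing

/-- Does the vertex `i` with `𝓜(i) = D` give two vertices `i`, `ī` of the complexified quiver? -/
def hasBar : DivRing → Bool
  | .R => false
  | .H => false
  | .C => true

/-- The isomorphism `𝐞_i (D ⊗ ℂ) 𝐞_i ≃ ⨁ ℂ e_x`, with `x` running over the vertices `i` (`false`) and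
`ī` (`true`), sends `𝐞_i (a ⊗ c) 𝐞_i` to `∑ c · coord a x · e_x`. -/
noncomputable def coord : (D : DivRing) → D.carrier → Bool → ℂ
  | .R, a, false => ((show ℝ from a : ℝ) : ℂ)
  | .R, _, true => 0
  | .H, a, false => quatMatrix a 0 0
  | .H, _, true => 0
  | .C, a, false => a
  | .C, a, true => (starRingEnd ℂ) a

/-- First component of the idempotent `𝐞_i`, which is `1 ⊗ 1` for `ℝ` and `ℂ`, and
`(1 ⊗ 1 - 𝐣 ⊗ i) / 2` for `ℍ`. -/
noncomputable def idemRe : (D : DivRing) → D.carrier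
  | .R => (1 : ℝ)
  | .C => (1 : ℂ)
  | .H => (⟨1 / 2, 0, 0, 0⟩ : ℍ[ℝ])

/-- Second component of the idempotent `𝐞_i`. -/
noncomputable def idemIm : (D : DivRing) → D.carrier
  | .R => (0 : ℝ)
  | .C => (0 : ℂ)
  | .H => (⟨0, -1 / 2, 0, 0⟩ : ℍ[ℝ])

/-- First component of the preimage of the trivial path `e_i` (`false`) or `e_ī` (`true`). -/
noncomputable def preRe : (D : DivRing) → Bool → D.carrier
  | .R, _ => (1 : ℝ)
  | .C, _ => (⟨1 / 2, 0⟩ : ℂ)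
  | .H, _ => (⟨1 / 2, 0, 0, 0⟩ : ℍ[ℝ])

/-- Second component of the preimage of the trivial path `e_i` (`false`) or `e_ī` (`true`). -/
noncomputable def preIm : (D : DivRing) → Bool → D.carrier
  | .R, _ => (0 : ℝ)
  | .C, false => (⟨0, -1 / 2⟩ : ℂ)
  | .C, true => (⟨0, 1 / 2⟩ : ℂ)
  | .H, _ => (⟨0, -1 / 2, 0, 0⟩ : ℍ[ℝ])

/-- `preRe` and `preIm` describe the preimages of the trivial paths under `coord`. -/
theorem coord_pre (D : DivRing) (b b' : Bool) (hb : b = true → D.hasBar = true) :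
    D.coord (D.preRe b) b' + Complex.I * D.coord (D.preIm b) b' = if b = b' then 1 else 0 := by
  cases D <;> cases b <;> cases b' <;>
    simp [coord, preRe, preIm, hasBar, quatMatrix, Complex.ext_iff] at hb ⊢ <;> norm_num

theorem pre_mul_re (D : DivRing) (b b' : Bool) (hb : b = true → D.hasBar = true)
    (hb' : b' = true → D.hasBar = true) :
    D.preRe b * D.preRe b' - D.preIm b * D.preIm b' = if b = b' then D.preRe b else 0 := by
  cases D
  · have : b = b' := by cases b <;> cases b' <;> simp [hasBar] at hb hb' ⊢
    rw [if_pos this]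
    change (1 * 1 - 0 * 0 : ℝ) = 1
    norm_num
  · cases b <;> cases b' <;>
      simp only [reduceIte, Bool.false_eq_true, Bool.true_eq_false]
    · change (⟨1 / 2, 0⟩ : ℂ) * (⟨1 / 2, 0⟩ : ℂ) - (⟨0, -1 / 2⟩ : ℂ) * (⟨0, -1 / 2⟩ : ℂ) = (⟨1 / 2, 0⟩ : ℂ)
      apply Complex.ext <;> simp <;> norm_num
    · change (⟨1 / 2, 0⟩ : ℂ) * (⟨1 / 2, 0⟩ : ℂ) - (⟨0, -1 / 2⟩ : ℂ) * (⟨0, 1 / 2⟩ : ℂ) = (0 : ℂ)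
      apply Complex.ext <;> simp <;> norm_num
    · change (⟨1 / 2, 0⟩ : ℂ) * (⟨1 / 2, 0⟩ : ℂ) - (⟨0, 1 / 2⟩ : ℂ) * (⟨0, -1 / 2⟩ : ℂ) = (0 : ℂ)
      apply Complex.ext <;> simp <;> norm_num
    · change (⟨1 / 2, 0⟩ : ℂ) * (⟨1 / 2, 0⟩ : ℂ) - (⟨0, 1 / 2⟩ : ℂ) * (⟨0, 1 / 2⟩ : ℂ) = (⟨1 / 2, 0⟩ : ℂ)
      apply Complex.ext <;> simp <;> norm_num
  · have : b = b' := by cases b <;> cases b' <;> simp [hasBar] at hb hb' ⊢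
    rw [if_pos this]
    change (⟨1 / 2, 0, 0, 0⟩ : ℍ[ℝ]) * (⟨1 / 2, 0, 0, 0⟩ : ℍ[ℝ]) - (⟨0, -1 / 2, 0, 0⟩ : ℍ[ℝ]) * (⟨0, -1 / 2, 0, 0⟩ : ℍ[ℝ]) = (⟨1 / 2, 0, 0, 0⟩ : ℍ[ℝ])
    ext <;> simp <;> norm_num

theorem pre_mul_im (D : DivRing) (b b' : Bool) (hb : b = true → D.hasBar = true)
    (hb' : b' = true → D.hasBar = true) :
    D.preRe b * D.preIm b' + D.preIm b * D.preRe b' = if b = b' then D.preIm b else 0 := by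
  cases D
  · have : b = b' := by cases b <;> cases b' <;> simp [hasBar] at hb hb' ⊢
    rw [if_pos this]
    change (1 * 0 + 0 * 1 : ℝ) = 0
    norm_num
  · cases b <;> cases b' <;>
      simp only [reduceIte, Bool.false_eq_true, Bool.true_eq_false]
    · change (⟨1 / 2, 0⟩ : ℂ) * (⟨0, -1 / 2⟩ : ℂ) + (⟨0, -1 / 2⟩ : ℂ) * (⟨1 / 2, 0⟩ : ℂ) = (⟨0, -1 / 2⟩ : ℂ)
      apply Complex.ext <;> simp <;> norm_num
    · change (⟨1 / 2, 0⟩ : ℂ) * (⟨0, 1 / 2⟩ : ℂ) + (⟨0, -1 / 2⟩ : ℂ) * (⟨1 / 2, 0⟩ : ℂ) = (0 : ℂ)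
      apply Complex.ext <;> simp <;> norm_num
    · change (⟨1 / 2, 0⟩ : ℂ) * (⟨0, -1 / 2⟩ : ℂ) + (⟨0, 1 / 2⟩ : ℂ) * (⟨1 / 2, 0⟩ : ℂ) = (0 : ℂ)
      apply Complex.ext <;> simp <;> norm_num
    · change (⟨1 / 2, 0⟩ : ℂ) * (⟨0, 1 / 2⟩ : ℂ) + (⟨0, 1 / 2⟩ : ℂ) * (⟨1 / 2, 0⟩ : ℂ) = (⟨0, 1 / 2⟩ : ℂ)
      apply Complex.ext <;> simp <;> norm_num
  · have : b = b' := by cases b <;> cases b' <;> simp [hasBar] at hb hb' ⊢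
    rw [if_pos this]
    change (⟨1 / 2, 0, 0, 0⟩ : ℍ[ℝ]) * (⟨0, -1 / 2, 0, 0⟩ : ℍ[ℝ]) + (⟨0, -1 / 2, 0, 0⟩ : ℍ[ℝ]) * (⟨1 / 2, 0, 0, 0⟩ : ℍ[ℝ]) = (⟨0, -1 / 2, 0, 0⟩ : ℍ[ℝ])
    ext <;> simp <;> norm_num

theorem idemRe_eq (D : DivRing) :
    D.idemRe = D.preRe false + if D.hasBar then D.preRe true else 0 := by
  cases D
  · change (1 : ℝ) = 1 + 0
    norm_num
  · change (1 : ℂ) = (⟨1 / 2, 0⟩ : ℂ) + (⟨1 / 2, 0⟩ : ℂ)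
    apply Complex.ext <;> simp <;> norm_num
  · exact (add_zero (⟨1 / 2, 0, 0, 0⟩ : ℍ[ℝ])).symm

theorem idemIm_eq (D : DivRing) :
    D.idemIm = D.preIm false + if D.hasBar then D.preIm true else 0 := by
  cases D
  · change (0 : ℝ) = 0 + 0
    norm_num
  · change (0 : ℂ) = (⟨0, -1 / 2⟩ : ℂ) + (⟨0, 1 / 2⟩ : ℂ)
    apply Complex.ext <;> simp <;> norm_num
  · exact (add_zero (⟨0, -1 / 2, 0, 0⟩ : ℍ[ℝ])).symm

end DivRing

namespace SimpleBimod

variable {D D' : DivRing}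

/-- Does the arrow `α` with `𝓜(α) = S` give two arrows `α`, `ᾱ` of the complexified quiver? -/
def hasBar : {D D' : DivRing} → SimpleBimod D D' → Bool
  | _, _, .RR => false
  | _, _, .HH => false
  | _, _, .RC => true
  | _, _, .CR => true
  | _, _, .RH => true
  | _, _, .HR => true
  | _, _, .HC => true
  | _, _, .CH => true
  | _, _, .CC => true
  | _, _, .CCbar => true

/-- Is the starting vertex of `α` (`false`) or `ᾱ` (`true`) the conjugate vertex `ī`
(`true`) or the vertex `i` (`false`)? -/
def srcBar : {D D' : DivRing} → SimpleBimod D D' → Bool → Bool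
  | _, _, .RR, _ => false
  | _, _, .HH, _ => false
  | _, _, .RC, b => b
  | _, _, .CR, _ => false
  | _, _, .RH, _ => false
  | _, _, .HR, _ => false
  | _, _, .HC, b => b
  | _, _, .CH, _ => false
  | _, _, .CC, b => b
  | _, _, .CCbar, b => !b

/-- Is the terminal vertex of `α` (`false`) or `ᾱ` (`true`) the conjugate vertex `j̄`
(`true`) or the vertex `j` (`false`)? -/
def tgtBar : {D D' : DivRing} → SimpleBimod D D' → Bool → Bool
  | _, _, .RR, _ => false
  | _, _, .HH, _ => false
  | _, _, .RC, _ => false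
  | _, _, .CR, b => b
  | _, _, .RH, _ => false
  | _, _, .HR, _ => false
  | _, _, .HC, _ => false
  | _, _, .CH, b => b
  | _, _, .CC, b => b
  | _, _, .CCbar, b => b

theorem hasBar_of_srcBar (S : SimpleBimod D D') (b : Bool) : S.srcBar b = true →
    D'.hasBar = true := by
  cases S <;> simp [srcBar, DivRing.hasBar]

theorem hasBar_of_tgtBar (S : SimpleBimod D D') (b : Bool) : S.tgtBar b = true →
    D.hasBar = true := by
  cases S <;> simp [tgtBar, DivRing.hasBar]

/-- The isomorphism `𝐞_{t(α)} (S ⊗ ℂ) 𝐞_{s(α)} ≃ ⨁ ℂ γ`, with `γ` running over the arrows `α`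
(`false`) and `ᾱ` (`true`), sends `𝐞_{t(α)} (a ⊗ c) 𝐞_{s(α)}` to `∑ c · coord a γ · γ`. -/
noncomputable def coord : {D D' : DivRing} → (S : SimpleBimod D D') → S.carrier → Bool → ℂ
  | _, _, .RR, a, false => ((show ℝ from a : ℝ) : ℂ)
  | _, _, .RR, _, true => 0
  | _, _, .HH, a, false => quatMatrix a 0 0
  | _, _, .HH, _, true => 0
  | _, _, .RC, a, false => a
  | _, _, .RC, a, true => (starRingEnd ℂ) a
  | _, _, .CR, a, false => a
  | _, _, .CR, a, true => (starRingEnd ℂ) a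
  | _, _, .RH, a, false => quatMatrix a 0 0
  | _, _, .RH, a, true => quatMatrix a 1 0
  | _, _, .HR, a, false => quatMatrix a 0 0
  | _, _, .HR, a, true => quatMatrix a 0 1
  | _, _, .HC, x, false => (show Fin 2 → ℂ from x) 0
  | _, _, .HC, x, true => -(starRingEnd ℂ) ((show Fin 2 → ℂ from x) 1)
  | _, _, .CH, x, false => (show Fin 2 → ℂ from x) 0
  | _, _, .CH, x, true => -(starRingEnd ℂ) ((show Fin 2 → ℂ from x) 1)
  | _, _, .CC, a, false => a
  | _, _, .CC, a, true => (starRingEnd ℂ) a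
  | _, _, .CCbar, a, false => a
  | _, _, .CCbar, a, true => (starRingEnd ℂ) a

/-- First component of the preimage of the arrow `α` (`false`) or `ᾱ` (`true`). -/
noncomputable def preRe : {D D' : DivRing} → (S : SimpleBimod D D') → Bool → S.carrier
  | _, _, .RR, _ => (1 : ℝ)
  | _, _, .HH, _ => (⟨1 / 2, 0, 0, 0⟩ : ℍ[ℝ])
  | _, _, .RC, _ => (⟨1 / 2, 0⟩ : ℂ)
  | _, _, .CR, _ => (⟨1 / 2, 0⟩ : ℂ)
  | _, _, .RH, false => (⟨1 / 2, 0, 0, 0⟩ : ℍ[ℝ])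
  | _, _, .RH, true => (⟨0, 0, -1 / 2, 0⟩ : ℍ[ℝ])
  | _, _, .HR, false => (⟨1 / 2, 0, 0, 0⟩ : ℍ[ℝ])
  | _, _, .HR, true => (⟨0, 0, 1 / 2, 0⟩ : ℍ[ℝ])
  | _, _, .HC, false => (![⟨1 / 2, 0⟩, 0] : Fin 2 → ℂ)
  | _, _, .HC, true => (![0, ⟨-1 / 2, 0⟩] : Fin 2 → ℂ)
  | _, _, .CH, false => (![⟨1 / 2, 0⟩, 0] : Fin 2 → ℂ)
  | _, _, .CH, true => (![0, ⟨-1 / 2, 0⟩] : Fin 2 → ℂ)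
  | _, _, .CC, _ => (⟨1 / 2, 0⟩ : ℂ)
  | _, _, .CCbar, _ => (⟨1 / 2, 0⟩ : ℂ)

/-- Second component of the preimage of the arrow `α` (`false`) or `ᾱ` (`true`). -/
noncomputable def preIm : {D D' : DivRing} → (S : SimpleBimod D D') → Bool → S.carrier
  | _, _, .RR, _ => (0 : ℝ)
  | _, _, .HH, _ => (⟨0, -1 / 2, 0, 0⟩ : ℍ[ℝ])
  | _, _, .RC, false => (⟨0, -1 / 2⟩ : ℂ)
  | _, _, .RC, true => (⟨0, 1 / 2⟩ : ℂ)
  | _, _, .CR, false => (⟨0, -1 / 2⟩ : ℂ)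
  | _, _, .CR, true => (⟨0, 1 / 2⟩ : ℂ)
  | _, _, .RH, false => (⟨0, -1 / 2, 0, 0⟩ : ℍ[ℝ])
  | _, _, .RH, true => (⟨0, 0, 0, -1 / 2⟩ : ℍ[ℝ])
  | _, _, .HR, false => (⟨0, -1 / 2, 0, 0⟩ : ℍ[ℝ])
  | _, _, .HR, true => (⟨0, 0, 0, -1 / 2⟩ : ℍ[ℝ])
  | _, _, .HC, false => (![⟨0, -1 / 2⟩, 0] : Fin 2 → ℂ)
  | _, _, .HC, true => (![0, ⟨0, -1 / 2⟩] : Fin 2 → ℂ)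
  | _, _, .CH, false => (![⟨0, -1 / 2⟩, 0] : Fin 2 → ℂ)
  | _, _, .CH, true => (![0, ⟨0, -1 / 2⟩] : Fin 2 → ℂ)
  | _, _, .CC, false => (⟨0, -1 / 2⟩ : ℂ)
  | _, _, .CC, true => (⟨0, 1 / 2⟩ : ℂ)
  | _, _, .CCbar, false => (⟨0, -1 / 2⟩ : ℂ)
  | _, _, .CCbar, true => (⟨0, 1 / 2⟩ : ℂ)

/-- `preRe` and `preIm` describe the preimages of the arrows under `coord`. -/
theorem coord_pre (S : SimpleBimod D D') (b b' : Bool) (hb : b = true → S.hasBar = true) :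
    S.coord (S.preRe b) b' + Complex.I * S.coord (S.preIm b) b' = if b = b' then 1 else 0 := by
  cases S <;> cases b <;> cases b' <;>
    simp [coord, preRe, preIm, hasBar, quatMatrix, Complex.ext_iff] at hb ⊢ <;> norm_num

/-- Left multiplication by the preimage of the terminal vertex fixes the preimage of an arrow. -/
theorem pre_left (S : SimpleBimod D D') (b : Bool) (hb : b = true → S.hasBar = true) :
    D.preRe (S.tgtBar b) • S.preRe b - D.preIm (S.tgtBar b) • S.preIm b = S.preRe b ∧
    D.preRe (S.tgtBar b) • S.preIm b + D.preIm (S.tgtBar b) • S.preRe b = S.preIm b := by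
  cases S
  · have hb' : b = false := by cases b <;> simp [hasBar] at hb ⊢
    subst hb'
    change (1 : ℝ) * (1 : ℝ) - (0 : ℝ) * (0 : ℝ) = (1 : ℝ) ∧
        (1 : ℝ) * (0 : ℝ) + (0 : ℝ) * (1 : ℝ) = (0 : ℝ)
    norm_num
  · have hb' : b = false := by cases b <;> simp [hasBar] at hb ⊢
    subst hb'
    change (⟨1 / 2, 0, 0, 0⟩ : ℍ[ℝ]) * (⟨1 / 2, 0, 0, 0⟩ : ℍ[ℝ]) - (⟨0, -1 / 2, 0, 0⟩ : ℍ[ℝ]) * (⟨0, -1 / 2, 0, 0⟩ : ℍ[ℝ]) = (⟨1 / 2, 0, 0, 0⟩ : ℍ[ℝ]) ∧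
        (⟨1 / 2, 0, 0, 0⟩ : ℍ[ℝ]) * (⟨0, -1 / 2, 0, 0⟩ : ℍ[ℝ]) + (⟨0, -1 / 2, 0, 0⟩ : ℍ[ℝ]) * (⟨1 / 2, 0, 0, 0⟩ : ℍ[ℝ]) = (⟨0, -1 / 2, 0, 0⟩ : ℍ[ℝ])
    constructor <;> ext <;> simp <;> norm_num
  · cases b
    · change (1 : ℝ) • (⟨1 / 2, 0⟩ : ℂ) - (0 : ℝ) • (⟨0, -1 / 2⟩ : ℂ) = (⟨1 / 2, 0⟩ : ℂ) ∧
        (1 : ℝ) • (⟨0, -1 / 2⟩ : ℂ) + (0 : ℝ) • (⟨1 / 2, 0⟩ : ℂ) = (⟨0, -1 / 2⟩ : ℂ)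
      constructor <;> apply Complex.ext <;> simp <;> norm_num
    · change (1 : ℝ) • (⟨1 / 2, 0⟩ : ℂ) - (0 : ℝ) • (⟨0, 1 / 2⟩ : ℂ) = (⟨1 / 2, 0⟩ : ℂ) ∧
        (1 : ℝ) • (⟨0, 1 / 2⟩ : ℂ) + (0 : ℝ) • (⟨1 / 2, 0⟩ : ℂ) = (⟨0, 1 / 2⟩ : ℂ)
      constructor <;> apply Complex.ext <;> simp <;> norm_num
  · cases b
    · change (⟨1 / 2, 0⟩ : ℂ) * (⟨1 / 2, 0⟩ : ℂ) - (⟨0, -1 / 2⟩ : ℂ) * (⟨0, -1 / 2⟩ : ℂ) = (⟨1 / 2, 0⟩ : ℂ) ∧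
        (⟨1 / 2, 0⟩ : ℂ) * (⟨0, -1 / 2⟩ : ℂ) + (⟨0, -1 / 2⟩ : ℂ) * (⟨1 / 2, 0⟩ : ℂ) = (⟨0, -1 / 2⟩ : ℂ)
      constructor <;> apply Complex.ext <;> simp <;> norm_num
    · change (⟨1 / 2, 0⟩ : ℂ) * (⟨1 / 2, 0⟩ : ℂ) - (⟨0, 1 / 2⟩ : ℂ) * (⟨0, 1 / 2⟩ : ℂ) = (⟨1 / 2, 0⟩ : ℂ) ∧
        (⟨1 / 2, 0⟩ : ℂ) * (⟨0, 1 / 2⟩ : ℂ) + (⟨0, 1 / 2⟩ : ℂ) * (⟨1 / 2, 0⟩ : ℂ) = (⟨0, 1 / 2⟩ : ℂ)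
      constructor <;> apply Complex.ext <;> simp <;> norm_num
  · cases b
    · change (1 : ℝ) • (⟨1 / 2, 0, 0, 0⟩ : ℍ[ℝ]) - (0 : ℝ) • (⟨0, -1 / 2, 0, 0⟩ : ℍ[ℝ]) = (⟨1 / 2, 0, 0, 0⟩ : ℍ[ℝ]) ∧
        (1 : ℝ) • (⟨0, -1 / 2, 0, 0⟩ : ℍ[ℝ]) + (0 : ℝ) • (⟨1 / 2, 0, 0, 0⟩ : ℍ[ℝ]) = (⟨0, -1 / 2, 0, 0⟩ : ℍ[ℝ])
      constructor <;> ext <;> simp <;> norm_num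
    · change (1 : ℝ) • (⟨0, 0, -1 / 2, 0⟩ : ℍ[ℝ]) - (0 : ℝ) • (⟨0, 0, 0, -1 / 2⟩ : ℍ[ℝ]) = (⟨0, 0, -1 / 2, 0⟩ : ℍ[ℝ]) ∧
        (1 : ℝ) • (⟨0, 0, 0, -1 / 2⟩ : ℍ[ℝ]) + (0 : ℝ) • (⟨0, 0, -1 / 2, 0⟩ : ℍ[ℝ]) = (⟨0, 0, 0, -1 / 2⟩ : ℍ[ℝ])
      constructor <;> ext <;> simp <;> norm_num
  · cases b
    · change (⟨1 / 2, 0, 0, 0⟩ : ℍ[ℝ]) * (⟨1 / 2, 0, 0, 0⟩ : ℍ[ℝ]) - (⟨0, -1 / 2, 0, 0⟩ : ℍ[ℝ]) * (⟨0, -1 / 2, 0, 0⟩ : ℍ[ℝ]) = (⟨1 / 2, 0, 0, 0⟩ : ℍ[ℝ]) ∧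
        (⟨1 / 2, 0, 0, 0⟩ : ℍ[ℝ]) * (⟨0, -1 / 2, 0, 0⟩ : ℍ[ℝ]) + (⟨0, -1 / 2, 0, 0⟩ : ℍ[ℝ]) * (⟨1 / 2, 0, 0, 0⟩ : ℍ[ℝ]) = (⟨0, -1 / 2, 0, 0⟩ : ℍ[ℝ])
      constructor <;> ext <;> simp <;> norm_num
    · change (⟨1 / 2, 0, 0, 0⟩ : ℍ[ℝ]) * (⟨0, 0, 1 / 2, 0⟩ : ℍ[ℝ]) - (⟨0, -1 / 2, 0, 0⟩ : ℍ[ℝ]) * (⟨0, 0, 0, -1 / 2⟩ : ℍ[ℝ]) = (⟨0, 0, 1 / 2, 0⟩ : ℍ[ℝ]) ∧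
        (⟨1 / 2, 0, 0, 0⟩ : ℍ[ℝ]) * (⟨0, 0, 0, -1 / 2⟩ : ℍ[ℝ]) + (⟨0, -1 / 2, 0, 0⟩ : ℍ[ℝ]) * (⟨0, 0, 1 / 2, 0⟩ : ℍ[ℝ]) = (⟨0, 0, 0, -1 / 2⟩ : ℍ[ℝ])
      constructor <;> ext <;> simp <;> norm_num
  · cases b
    · change (quatMatrixHom (⟨1 / 2, 0, 0, 0⟩ : ℍ[ℝ])).mulVec (![⟨1 / 2, 0⟩, 0] : Fin 2 → ℂ) - (quatMatrixHom (⟨0, -1 / 2, 0, 0⟩ : ℍ[ℝ])).mulVec (![⟨0, -1 / 2⟩, 0] : Fin 2 → ℂ) = (![⟨1 / 2, 0⟩, 0] : Fin 2 → ℂ) ∧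
        (quatMatrixHom (⟨1 / 2, 0, 0, 0⟩ : ℍ[ℝ])).mulVec (![⟨0, -1 / 2⟩, 0] : Fin 2 → ℂ) + (quatMatrixHom (⟨0, -1 / 2, 0, 0⟩ : ℍ[ℝ])).mulVec (![⟨1 / 2, 0⟩, 0] : Fin 2 → ℂ) = (![⟨0, -1 / 2⟩, 0] : Fin 2 → ℂ)
      constructor <;> ext i <;> fin_cases i <;>
      simp [quatMatrixHom, quatMatrix, Matrix.mulVec, Matrix.vecMul, dotProduct, Complex.ext_iff] <;>
      norm_num
    · change (quatMatrixHom (⟨1 / 2, 0, 0, 0⟩ : ℍ[ℝ])).mulVec (![0, ⟨-1 / 2, 0⟩] : Fin 2 → ℂ) - (quatMatrixHom (⟨0, -1 / 2, 0, 0⟩ : ℍ[ℝ])).mulVec (![0, ⟨0, -1 / 2⟩] : Fin 2 → ℂ) = (![0, ⟨-1 / 2, 0⟩] : Fin 2 → ℂ) ∧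
        (quatMatrixHom (⟨1 / 2, 0, 0, 0⟩ : ℍ[ℝ])).mulVec (![0, ⟨0, -1 / 2⟩] : Fin 2 → ℂ) + (quatMatrixHom (⟨0, -1 / 2, 0, 0⟩ : ℍ[ℝ])).mulVec (![0, ⟨-1 / 2, 0⟩] : Fin 2 → ℂ) = (![0, ⟨0, -1 / 2⟩] : Fin 2 → ℂ)
      constructor <;> ext i <;> fin_cases i <;>
      simp [quatMatrixHom, quatMatrix, Matrix.mulVec, Matrix.vecMul, dotProduct, Complex.ext_iff] <;>
      norm_num
  · cases b
    · change (⟨1 / 2, 0⟩ : ℂ) • (![⟨1 / 2, 0⟩, 0] : Fin 2 → ℂ) - (⟨0, -1 / 2⟩ : ℂ) • (![⟨0, -1 / 2⟩, 0] : Fin 2 → ℂ) = (![⟨1 / 2, 0⟩, 0] : Fin 2 → ℂ) ∧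
        (⟨1 / 2, 0⟩ : ℂ) • (![⟨0, -1 / 2⟩, 0] : Fin 2 → ℂ) + (⟨0, -1 / 2⟩ : ℂ) • (![⟨1 / 2, 0⟩, 0] : Fin 2 → ℂ) = (![⟨0, -1 / 2⟩, 0] : Fin 2 → ℂ)
      constructor <;> ext i <;> fin_cases i <;>
      simp [quatMatrixHom, quatMatrix, Matrix.mulVec, Matrix.vecMul, dotProduct, Complex.ext_iff] <;>
      norm_num
    · change (⟨1 / 2, 0⟩ : ℂ) • (![0, ⟨-1 / 2, 0⟩] : Fin 2 → ℂ) - (⟨0, 1 / 2⟩ : ℂ) • (![0, ⟨0, -1 / 2⟩] : Fin 2 → ℂ) = (![0, ⟨-1 / 2, 0⟩] : Fin 2 → ℂ) ∧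
        (⟨1 / 2, 0⟩ : ℂ) • (![0, ⟨0, -1 / 2⟩] : Fin 2 → ℂ) + (⟨0, 1 / 2⟩ : ℂ) • (![0, ⟨-1 / 2, 0⟩] : Fin 2 → ℂ) = (![0, ⟨0, -1 / 2⟩] : Fin 2 → ℂ)
      constructor <;> ext i <;> fin_cases i <;>
      simp [quatMatrixHom, quatMatrix, Matrix.mulVec, Matrix.vecMul, dotProduct, Complex.ext_iff] <;>
      norm_num
  · cases b
    · change (⟨1 / 2, 0⟩ : ℂ) * (⟨1 / 2, 0⟩ : ℂ) - (⟨0, -1 / 2⟩ : ℂ) * (⟨0, -1 / 2⟩ : ℂ) = (⟨1 / 2, 0⟩ : ℂ) ∧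
        (⟨1 / 2, 0⟩ : ℂ) * (⟨0, -1 / 2⟩ : ℂ) + (⟨0, -1 / 2⟩ : ℂ) * (⟨1 / 2, 0⟩ : ℂ) = (⟨0, -1 / 2⟩ : ℂ)
      constructor <;> apply Complex.ext <;> simp <;> norm_num
    · change (⟨1 / 2, 0⟩ : ℂ) * (⟨1 / 2, 0⟩ : ℂ) - (⟨0, 1 / 2⟩ : ℂ) * (⟨0, 1 / 2⟩ : ℂ) = (⟨1 / 2, 0⟩ : ℂ) ∧
        (⟨1 / 2, 0⟩ : ℂ) * (⟨0, 1 / 2⟩ : ℂ) + (⟨0, 1 / 2⟩ : ℂ) * (⟨1 / 2, 0⟩ : ℂ) = (⟨0, 1 / 2⟩ : ℂ)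
      constructor <;> apply Complex.ext <;> simp <;> norm_num
  · cases b
    · change (⟨1 / 2, 0⟩ : ℂ) * (⟨1 / 2, 0⟩ : ℂ) - (⟨0, -1 / 2⟩ : ℂ) * (⟨0, -1 / 2⟩ : ℂ) = (⟨1 / 2, 0⟩ : ℂ) ∧
        (⟨1 / 2, 0⟩ : ℂ) * (⟨0, -1 / 2⟩ : ℂ) + (⟨0, -1 / 2⟩ : ℂ) * (⟨1 / 2, 0⟩ : ℂ) = (⟨0, -1 / 2⟩ : ℂ)
      constructor <;> apply Complex.ext <;> simp <;> norm_num
    · change (⟨1 / 2, 0⟩ : ℂ) * (⟨1 / 2, 0⟩ : ℂ) - (⟨0, 1 / 2⟩ : ℂ) * (⟨0, 1 / 2⟩ : ℂ) = (⟨1 / 2, 0⟩ : ℂ) ∧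
        (⟨1 / 2, 0⟩ : ℂ) * (⟨0, 1 / 2⟩ : ℂ) + (⟨0, 1 / 2⟩ : ℂ) * (⟨1 / 2, 0⟩ : ℂ) = (⟨0, 1 / 2⟩ : ℂ)
      constructor <;> apply Complex.ext <;> simp <;> norm_num

/-- Right multiplication by the preimage of the starting vertex fixes the preimage of an arrow. -/
theorem pre_right (S : SimpleBimod D D') (b : Bool) (hb : b = true → S.hasBar = true) :
    MulOpposite.op (D'.preRe (S.srcBar b)) • S.preRe b -
      MulOpposite.op (D'.preIm (S.srcBar b)) • S.preIm b = S.preRe b ∧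
    MulOpposite.op (D'.preIm (S.srcBar b)) • S.preRe b +
      MulOpposite.op (D'.preRe (S.srcBar b)) • S.preIm b = S.preIm b := by
  cases S
  · have hb' : b = false := by cases b <;> simp [hasBar] at hb ⊢
    subst hb'
    change (1 : ℝ) * (1 : ℝ) - (0 : ℝ) * (0 : ℝ) = (1 : ℝ) ∧
        (1 : ℝ) * (0 : ℝ) + (0 : ℝ) * (1 : ℝ) = (0 : ℝ)
    norm_num
  · have hb' : b = false := by cases b <;> simp [hasBar] at hb ⊢
    subst hb'
    change (⟨1 / 2, 0, 0, 0⟩ : ℍ[ℝ]) * (⟨1 / 2, 0, 0, 0⟩ : ℍ[ℝ]) - (⟨0, -1 / 2, 0, 0⟩ : ℍ[ℝ]) * (⟨0, -1 / 2, 0, 0⟩ : ℍ[ℝ]) = (⟨1 / 2, 0, 0, 0⟩ : ℍ[ℝ]) ∧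
        (⟨1 / 2, 0, 0, 0⟩ : ℍ[ℝ]) * (⟨0, -1 / 2, 0, 0⟩ : ℍ[ℝ]) + (⟨0, -1 / 2, 0, 0⟩ : ℍ[ℝ]) * (⟨1 / 2, 0, 0, 0⟩ : ℍ[ℝ]) = (⟨0, -1 / 2, 0, 0⟩ : ℍ[ℝ])
    constructor <;> ext <;> simp <;> norm_num
  · cases b
    · change (⟨1 / 2, 0⟩ : ℂ) * (⟨1 / 2, 0⟩ : ℂ) - (⟨0, -1 / 2⟩ : ℂ) * (⟨0, -1 / 2⟩ : ℂ) = (⟨1 / 2, 0⟩ : ℂ) ∧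
        (⟨1 / 2, 0⟩ : ℂ) * (⟨0, -1 / 2⟩ : ℂ) + (⟨0, -1 / 2⟩ : ℂ) * (⟨1 / 2, 0⟩ : ℂ) = (⟨0, -1 / 2⟩ : ℂ)
      constructor <;> apply Complex.ext <;> simp <;> norm_num
    · change (⟨1 / 2, 0⟩ : ℂ) * (⟨1 / 2, 0⟩ : ℂ) - (⟨0, 1 / 2⟩ : ℂ) * (⟨0, 1 / 2⟩ : ℂ) = (⟨1 / 2, 0⟩ : ℂ) ∧
        (⟨1 / 2, 0⟩ : ℂ) * (⟨0, 1 / 2⟩ : ℂ) + (⟨0, 1 / 2⟩ : ℂ) * (⟨1 / 2, 0⟩ : ℂ) = (⟨0, 1 / 2⟩ : ℂ)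
      constructor <;> apply Complex.ext <;> simp <;> norm_num
  · cases b
    · change (⟨1 / 2, 0⟩ : ℂ) * algebraMap ℝ ℂ (1 : ℝ) - (⟨0, -1 / 2⟩ : ℂ) * algebraMap ℝ ℂ (0 : ℝ) = (⟨1 / 2, 0⟩ : ℂ) ∧
        (⟨1 / 2, 0⟩ : ℂ) * algebraMap ℝ ℂ (0 : ℝ) + (⟨0, -1 / 2⟩ : ℂ) * algebraMap ℝ ℂ (1 : ℝ) = (⟨0, -1 / 2⟩ : ℂ)
      constructor <;> apply Complex.ext <;> simp <;> norm_num
    · change (⟨1 / 2, 0⟩ : ℂ) * algebraMap ℝ ℂ (1 : ℝ) - (⟨0, 1 / 2⟩ : ℂ) * algebraMap ℝ ℂ (0 : ℝ) = (⟨1 / 2, 0⟩ : ℂ) ∧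
        (⟨1 / 2, 0⟩ : ℂ) * algebraMap ℝ ℂ (0 : ℝ) + (⟨0, 1 / 2⟩ : ℂ) * algebraMap ℝ ℂ (1 : ℝ) = (⟨0, 1 / 2⟩ : ℂ)
      constructor <;> apply Complex.ext <;> simp <;> norm_num
  · cases b
    · change (⟨1 / 2, 0, 0, 0⟩ : ℍ[ℝ]) * (⟨1 / 2, 0, 0, 0⟩ : ℍ[ℝ]) - (⟨0, -1 / 2, 0, 0⟩ : ℍ[ℝ]) * (⟨0, -1 / 2, 0, 0⟩ : ℍ[ℝ]) = (⟨1 / 2, 0, 0, 0⟩ : ℍ[ℝ]) ∧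
        (⟨1 / 2, 0, 0, 0⟩ : ℍ[ℝ]) * (⟨0, -1 / 2, 0, 0⟩ : ℍ[ℝ]) + (⟨0, -1 / 2, 0, 0⟩ : ℍ[ℝ]) * (⟨1 / 2, 0, 0, 0⟩ : ℍ[ℝ]) = (⟨0, -1 / 2, 0, 0⟩ : ℍ[ℝ])
      constructor <;> ext <;> simp <;> norm_num
    · change (⟨0, 0, -1 / 2, 0⟩ : ℍ[ℝ]) * (⟨1 / 2, 0, 0, 0⟩ : ℍ[ℝ]) - (⟨0, 0, 0, -1 / 2⟩ : ℍ[ℝ]) * (⟨0, -1 / 2, 0, 0⟩ : ℍ[ℝ]) = (⟨0, 0, -1 / 2, 0⟩ : ℍ[ℝ]) ∧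
        (⟨0, 0, -1 / 2, 0⟩ : ℍ[ℝ]) * (⟨0, -1 / 2, 0, 0⟩ : ℍ[ℝ]) + (⟨0, 0, 0, -1 / 2⟩ : ℍ[ℝ]) * (⟨1 / 2, 0, 0, 0⟩ : ℍ[ℝ]) = (⟨0, 0, 0, -1 / 2⟩ : ℍ[ℝ])
      constructor <;> ext <;> simp <;> norm_num
  · cases b
    · have h : ∀ x y : ℍ[ℝ], x * algebraMap ℝ ℍ[ℝ] 1 - y * algebraMap ℝ ℍ[ℝ] 0 = x ∧
          x * algebraMap ℝ ℍ[ℝ] 0 + y * algebraMap ℝ ℍ[ℝ] 1 = y := by simp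
      exact h _ _
    · have h : ∀ x y : ℍ[ℝ], x * algebraMap ℝ ℍ[ℝ] 1 - y * algebraMap ℝ ℍ[ℝ] 0 = x ∧
          x * algebraMap ℝ ℍ[ℝ] 0 + y * algebraMap ℝ ℍ[ℝ] 1 = y := by simp
      exact h _ _
  · cases b
    · change MulOpposite.op (⟨1 / 2, 0⟩ : ℂ) • (![⟨1 / 2, 0⟩, 0] : Fin 2 → ℂ) - MulOpposite.op (⟨0, -1 / 2⟩ : ℂ) • (![⟨0, -1 / 2⟩, 0] : Fin 2 → ℂ) = (![⟨1 / 2, 0⟩, 0] : Fin 2 → ℂ) ∧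
        MulOpposite.op (⟨0, -1 / 2⟩ : ℂ) • (![⟨1 / 2, 0⟩, 0] : Fin 2 → ℂ) + MulOpposite.op (⟨1 / 2, 0⟩ : ℂ) • (![⟨0, -1 / 2⟩, 0] : Fin 2 → ℂ) = (![⟨0, -1 / 2⟩, 0] : Fin 2 → ℂ)
      constructor <;> ext i <;> fin_cases i <;>
      simp [quatMatrixHom, quatMatrix, Matrix.mulVec, Matrix.vecMul, dotProduct, Complex.ext_iff] <;>
      norm_num
    · change MulOpposite.op (⟨1 / 2, 0⟩ : ℂ) • (![0, ⟨-1 / 2, 0⟩] : Fin 2 → ℂ) - MulOpposite.op (⟨0, 1 / 2⟩ : ℂ) • (![0, ⟨0, -1 / 2⟩] : Fin 2 → ℂ) = (![0, ⟨-1 / 2, 0⟩] : Fin 2 → ℂ) ∧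
        MulOpposite.op (⟨0, 1 / 2⟩ : ℂ) • (![0, ⟨-1 / 2, 0⟩] : Fin 2 → ℂ) + MulOpposite.op (⟨1 / 2, 0⟩ : ℂ) • (![0, ⟨0, -1 / 2⟩] : Fin 2 → ℂ) = (![0, ⟨0, -1 / 2⟩] : Fin 2 → ℂ)
      constructor <;> ext i <;> fin_cases i <;>
      simp [quatMatrixHom, quatMatrix, Matrix.mulVec, Matrix.vecMul, dotProduct, Complex.ext_iff] <;>
      norm_num
  · cases b
    · change Matrix.vecMul (![⟨1 / 2, 0⟩, 0] : Fin 2 → ℂ) (quatMatrixHom (⟨1 / 2, 0, 0, 0⟩ : ℍ[ℝ])) - Matrix.vecMul (![⟨0, -1 / 2⟩, 0] : Fin 2 → ℂ) (quatMatrixHom (⟨0, -1 / 2, 0, 0⟩ : ℍ[ℝ])) = (![⟨1 / 2, 0⟩, 0] : Fin 2 → ℂ) ∧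
        Matrix.vecMul (![⟨1 / 2, 0⟩, 0] : Fin 2 → ℂ) (quatMatrixHom (⟨0, -1 / 2, 0, 0⟩ : ℍ[ℝ])) + Matrix.vecMul (![⟨0, -1 / 2⟩, 0] : Fin 2 → ℂ) (quatMatrixHom (⟨1 / 2, 0, 0, 0⟩ : ℍ[ℝ])) = (![⟨0, -1 / 2⟩, 0] : Fin 2 → ℂ)
      constructor <;> ext i <;> fin_cases i <;>
      simp [quatMatrixHom, quatMatrix, Matrix.mulVec, Matrix.vecMul, dotProduct, Complex.ext_iff] <;>
      norm_num
    · change Matrix.vecMul (![0, ⟨-1 / 2, 0⟩] : Fin 2 → ℂ) (quatMatrixHom (⟨1 / 2, 0, 0, 0⟩ : ℍ[ℝ])) - Matrix.vecMul (![0, ⟨0, -1 / 2⟩] : Fin 2 → ℂ) (quatMatrixHom (⟨0, -1 / 2, 0, 0⟩ : ℍ[ℝ])) = (![0, ⟨-1 / 2, 0⟩] : Fin 2 → ℂ) ∧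
        Matrix.vecMul (![0, ⟨-1 / 2, 0⟩] : Fin 2 → ℂ) (quatMatrixHom (⟨0, -1 / 2, 0, 0⟩ : ℍ[ℝ])) + Matrix.vecMul (![0, ⟨0, -1 / 2⟩] : Fin 2 → ℂ) (quatMatrixHom (⟨1 / 2, 0, 0, 0⟩ : ℍ[ℝ])) = (![0, ⟨0, -1 / 2⟩] : Fin 2 → ℂ)
      constructor <;> ext i <;> fin_cases i <;>
      simp [quatMatrixHom, quatMatrix, Matrix.mulVec, Matrix.vecMul, dotProduct, Complex.ext_iff] <;>
      norm_num
  · cases b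
    · change (⟨1 / 2, 0⟩ : ℂ) * (⟨1 / 2, 0⟩ : ℂ) - (⟨0, -1 / 2⟩ : ℂ) * (⟨0, -1 / 2⟩ : ℂ) = (⟨1 / 2, 0⟩ : ℂ) ∧
        (⟨1 / 2, 0⟩ : ℂ) * (⟨0, -1 / 2⟩ : ℂ) + (⟨0, -1 / 2⟩ : ℂ) * (⟨1 / 2, 0⟩ : ℂ) = (⟨0, -1 / 2⟩ : ℂ)
      constructor <;> apply Complex.ext <;> simp <;> norm_num
    · change (⟨1 / 2, 0⟩ : ℂ) * (⟨1 / 2, 0⟩ : ℂ) - (⟨0, 1 / 2⟩ : ℂ) * (⟨0, 1 / 2⟩ : ℂ) = (⟨1 / 2, 0⟩ : ℂ) ∧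
        (⟨1 / 2, 0⟩ : ℂ) * (⟨0, 1 / 2⟩ : ℂ) + (⟨0, 1 / 2⟩ : ℂ) * (⟨1 / 2, 0⟩ : ℂ) = (⟨0, 1 / 2⟩ : ℂ)
      constructor <;> apply Complex.ext <;> simp <;> norm_num
  · cases b
    · change (⟨1 / 2, 0⟩ : ℂ) * starRingEnd ℂ (⟨1 / 2, 0⟩ : ℂ) - (⟨0, -1 / 2⟩ : ℂ) * starRingEnd ℂ (⟨0, 1 / 2⟩ : ℂ) = (⟨1 / 2, 0⟩ : ℂ) ∧
        (⟨1 / 2, 0⟩ : ℂ) * starRingEnd ℂ (⟨0, 1 / 2⟩ : ℂ) + (⟨0, -1 / 2⟩ : ℂ) * starRingEnd ℂ (⟨1 / 2, 0⟩ : ℂ) = (⟨0, -1 / 2⟩ : ℂ)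
      constructor <;> apply Complex.ext <;> simp <;> norm_num
    · change (⟨1 / 2, 0⟩ : ℂ) * starRingEnd ℂ (⟨1 / 2, 0⟩ : ℂ) - (⟨0, 1 / 2⟩ : ℂ) * starRingEnd ℂ (⟨0, -1 / 2⟩ : ℂ) = (⟨1 / 2, 0⟩ : ℂ) ∧
        (⟨1 / 2, 0⟩ : ℂ) * starRingEnd ℂ (⟨0, -1 / 2⟩ : ℂ) + (⟨0, 1 / 2⟩ : ℂ) * starRingEnd ℂ (⟨1 / 2, 0⟩ : ℂ) = (⟨0, 1 / 2⟩ : ℂ)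
      constructor <;> apply Complex.ext <;> simp <;> norm_num

end SimpleBimod

/-! ## Modulated quivers, their tensor algebras and complexified quivers -/

/-- A modulated quiver over `ℝ` with set of vertices `V` and set of arrows `E`. -/
structure ModulatedQuiver (V E : Type*) extends ArrowQuiver V E where
  /-- the division ring `𝓜(i)` -/
  D : V → DivRing
  /-- the simple `𝓜(t(α))`-`𝓜(s(α))`-bimodule `𝓜(α)` -/
  M : (α : E) → SimpleBimod (D (t α)) (D (s α))

namespace ModulatedQuiver

variable {V E : Type*} (Q : ModulatedQuiver V E)

/-- The ring `∏ 𝓜(i)`. -/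
abbrev VertexRing : Type _ := (i : V) → (Q.D i).carrier

/-- The bimodule `⨁ 𝓜(α)` over `∏ 𝓜(i)`. -/
def ArrowBimod : Type _ := (α : E) → (Q.M α).carrier

noncomputable instance : AddCommGroup Q.ArrowBimod :=
  inferInstanceAs (AddCommGroup ((α : E) → (Q.M α).carrier))

/-- The inclusion of the summand `𝓜(α)`. -/
noncomputable def single [DecidableEq E] (α : E) : (Q.M α).carrier →+ Q.ArrowBimod :=
  AddMonoidHom.single (fun α => (Q.M α).carrier) α

noncomputable instance : Module Q.VertexRing Q.ArrowBimod where
  smul a x := fun α => a (Q.t α) • x α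
  one_smul x := funext fun α => one_smul (Q.D (Q.t α)).carrier (x α)
  mul_smul a b x := funext fun α => mul_smul (a (Q.t α)) (b (Q.t α)) (x α)
  smul_zero a := funext fun α => smul_zero (a (Q.t α))
  smul_add a x y := funext fun α => smul_add (a (Q.t α)) (x α) (y α)
  add_smul a b x := funext fun α => add_smul (a (Q.t α)) (b (Q.t α)) (x α)
  zero_smul x := funext fun α => zero_smul (Q.D (Q.t α)).carrier (x α)

noncomputable instance : Module Q.VertexRingᵐᵒᵖ Q.ArrowBimod where
  smul a x := fun α => MulOpposite.op (a.unop (Q.s α)) • x α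
  one_smul x := funext fun α => one_smul (Q.D (Q.s α)).carrierᵐᵒᵖ (x α)
  mul_smul a b x := funext fun α =>
    mul_smul (MulOpposite.op (a.unop (Q.s α))) (MulOpposite.op (b.unop (Q.s α))) (x α)
  smul_zero a := funext fun α => smul_zero (MulOpposite.op (a.unop (Q.s α)))
  smul_add a x y := funext fun α => smul_add (MulOpposite.op (a.unop (Q.s α))) (x α) (y α)
  add_smul a b x := funext fun α =>
    add_smul (MulOpposite.op (a.unop (Q.s α))) (MulOpposite.op (b.unop (Q.s α))) (x α)
  zero_smul x := funext fun α => zero_smul (Q.D (Q.s α)).carrierᵐᵒᵖ (x α)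

/-- The tensor algebra `T(Q, 𝓜)`. -/
abbrev TensorAlg : Type _ := BimodTensor ℝ Q.VertexRing Q.ArrowBimod

/-- The vertices of the complexified quiver: `(i, false)` is `i`, and `(i, true)` is `ī`, which exists
if and only if `𝓜(i) = ℂ`. -/
abbrev CVertex : Type _ := {x : V × Bool // x.2 = true → (Q.D x.1).hasBar = true}

/-- The arrows of the complexified quiver: `(α, false)` is `α`, and `(α, true)` is `ᾱ`. -/
abbrev CArrow : Type _ := {a : E × Bool // a.2 = true → (Q.M a.1).hasBar = true}

/-- The complexified quiver `Γ`. -/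
def complexified : ArrowQuiver Q.CVertex Q.CArrow where
  s a := ⟨(Q.s a.1.1, (Q.M a.1.1).srcBar a.1.2), (Q.M a.1.1).hasBar_of_srcBar a.1.2⟩
  t a := ⟨(Q.t a.1.1, (Q.M a.1.1).tgtBar a.1.2), (Q.M a.1.1).hasBar_of_tgtBar a.1.2⟩

/-- The arrow `α` of `Γ` given by the arrow `α` of `Q`. -/
def fiber (α : E) : Q.CArrow := ⟨(α, false), by simp⟩

variable [DecidableEq V] [DecidableEq E]

/-- An element of `𝓜(i)`, as an element of `T(Q, 𝓜)`. -/
noncomputable def vert (i : V) (a : (Q.D i).carrier) : Q.TensorAlg :=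
  BimodTensor.coef ℝ Q.VertexRing Q.ArrowBimod (Pi.single i a)

/-- An element of `𝓜(α)`, as an element of `T(Q, 𝓜)`. -/
noncomputable def arr (α : E) (x : (Q.M α).carrier) : Q.TensorAlg :=
  BimodTensor.vec ℝ Q.VertexRing Q.ArrowBimod (Q.single α x)

section lemmas

theorem vert_add (i : V) (a b : (Q.D i).carrier) : Q.vert i (a + b) = Q.vert i a + Q.vert i b := by
  simp [vert, Pi.single_add]

theorem vert_sub (i : V) (a b : (Q.D i).carrier) : Q.vert i (a - b) = Q.vert i a - Q.vert i b := by
  simp [vert, Pi.single_sub]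

theorem vert_zero (i : V) : Q.vert i 0 = 0 := by
  simp [vert]

theorem vert_mul (i : V) (a b : (Q.D i).carrier) : Q.vert i a * Q.vert i b = Q.vert i (a * b) := by
  rw [vert, vert, vert, ← map_mul, ← Pi.single_mul]

theorem vert_mul_of_ne {i j : V} (h : i ≠ j) (a : (Q.D i).carrier) (b : (Q.D j).carrier) :
    Q.vert i a * Q.vert j b = 0 := by
  have h0 : (Pi.single i a : Q.VertexRing) * Pi.single j b = 0 := by
    ext k
    by_cases hk : k = i
    · subst hk; simp [Pi.single_eq_of_ne h]
    · simp [Pi.single_eq_of_ne hk]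
  rw [vert, vert, ← map_mul, h0, map_zero]

theorem arr_add (α : E) (x y : (Q.M α).carrier) : Q.arr α (x + y) = Q.arr α x + Q.arr α y := by
  rw [arr, arr, arr, map_add, map_add]

theorem arr_sub (α : E) (x y : (Q.M α).carrier) : Q.arr α (x - y) = Q.arr α x - Q.arr α y := by
  rw [arr, arr, arr, map_sub, map_sub]

theorem vert_mul_arr (α : E) (a : (Q.D (Q.t α)).carrier) (x : (Q.M α).carrier) :
    Q.vert (Q.t α) a * Q.arr α x = Q.arr α (a • x) := by
  have h : (Pi.single (Q.t α) a : Q.VertexRing) • Q.single α x = Q.single α (a • x) := by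
    funext β
    change (Pi.single (Q.t α) a : Q.VertexRing) (Q.t β) •
      (Pi.single (M := fun α => (Q.M α).carrier) α x : (α : E) → (Q.M α).carrier) β =
      (Pi.single (M := fun α => (Q.M α).carrier) α (a • x) : (α : E) → (Q.M α).carrier) β
    by_cases h : β = α
    · subst h; simp
    · rw [Pi.single_eq_of_ne h, Pi.single_eq_of_ne h, smul_zero]
  rw [arr, arr, vert, ← BimodTensor.vec_left, h]

theorem arr_mul_vert (α : E) (x : (Q.M α).carrier) (a : (Q.D (Q.s α)).carrier) :
    Q.arr α x * Q.vert (Q.s α) a = Q.arr α (MulOpposite.op a • x) := by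
  have h : MulOpposite.op (Pi.single (Q.s α) a : Q.VertexRing) • Q.single α x =
      Q.single α (MulOpposite.op a • x) := by
    funext β
    change MulOpposite.op ((Pi.single (Q.s α) a : Q.VertexRing) (Q.s β)) •
      (Pi.single (M := fun α => (Q.M α).carrier) α x : (α : E) → (Q.M α).carrier) β =
      (Pi.single (M := fun α => (Q.M α).carrier) α (MulOpposite.op a • x) :
        (α : E) → (Q.M α).carrier) β
    by_cases h : β = α
    · subst h; simp
    · rw [Pi.single_eq_of_ne h, Pi.single_eq_of_ne h, smul_zero]
  rw [arr, arr, vert, ← BimodTensor.vec_right, h]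

end lemmas

/-! ## The complexification of `T(Q, 𝓜)` and the isomorphism `Ψ` -/

/-- The complexification of `T(Q, 𝓜)`. -/
abbrev CTensorAlg : Type _ := ℂ ⊗[ℝ] Q.TensorAlg


/-- The element `p ⊗ 1 + q ⊗ i` of the complexification. -/
noncomputable def cx (p q : Q.TensorAlg) : Q.CTensorAlg :=
  (1 : ℂ) ⊗ₜ[ℝ] p + Complex.I ⊗ₜ[ℝ] q

theorem cx_mul (p q p' q' : Q.TensorAlg) :
    Q.cx p q * Q.cx p' q' = Q.cx (p * p' - q * q') (p * q' + q * p') := by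
  simp only [cx, add_mul, mul_add, Algebra.TensorProduct.tmul_mul_tmul, one_mul, mul_one,
    Complex.I_mul_I, TensorProduct.tmul_sub, TensorProduct.tmul_add, TensorProduct.neg_tmul]
  abel

theorem cx_add (p q p' q' : Q.TensorAlg) :
    Q.cx p q + Q.cx p' q' = Q.cx (p + p') (q + q') := by
  simp only [cx, TensorProduct.tmul_add]
  abel

theorem cx_zero : Q.cx 0 0 = 0 := by
  simp [cx]

/-- The full idempotent `𝐞 = (𝐞_i)` of `∏ 𝓜(i) ⊗ ℂ`. -/
noncomputable def fullIdem : Q.CTensorAlg :=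
  Q.cx (BimodTensor.coef ℝ Q.VertexRing Q.ArrowBimod fun i => (Q.D i).idemRe)
    (BimodTensor.coef ℝ Q.VertexRing Q.ArrowBimod fun i => (Q.D i).idemIm)

/-- The preimage under `Ψ` of the trivial path at the vertex `x` of `Γ`. -/
noncomputable def preVertex (x : Q.CVertex) : Q.CTensorAlg :=
  Q.cx (Q.vert x.1.1 ((Q.D x.1.1).preRe x.1.2)) (Q.vert x.1.1 ((Q.D x.1.1).preIm x.1.2))

/-- The preimage under `Ψ` of the arrow `a` of `Γ`. -/
noncomputable def preArrow (a : Q.CArrow) : Q.CTensorAlg :=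
  Q.cx (Q.arr a.1.1 ((Q.M a.1.1).preRe a.1.2)) (Q.arr a.1.1 ((Q.M a.1.1).preIm a.1.2))

theorem preVertex_mul_self (x : Q.CVertex) : Q.preVertex x * Q.preVertex x = Q.preVertex x := by
  rw [preVertex, cx_mul, vert_mul, vert_mul, vert_mul, vert_mul, ← vert_sub, ← vert_add,
    DivRing.pre_mul_re _ _ _ x.2 x.2, DivRing.pre_mul_im _ _ _ x.2 x.2, if_pos rfl, if_pos rfl]

theorem preVertex_mul_of_ne {x y : Q.CVertex} (h : x ≠ y) :
    Q.preVertex x * Q.preVertex y = 0 := by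
  obtain ⟨⟨i, b⟩, hx⟩ := x
  obtain ⟨⟨j, c⟩, hy⟩ := y
  rw [preVertex, preVertex, cx_mul]
  by_cases hij : i = j
  · subst hij
    have hbc : b ≠ c := by
      rintro rfl
      exact h rfl
    rw [vert_mul, vert_mul, vert_mul, vert_mul, ← vert_sub, ← vert_add,
      DivRing.pre_mul_re _ _ _ hx hy, DivRing.pre_mul_im _ _ _ hx hy, if_neg hbc, if_neg hbc,
      vert_zero, cx_zero]
  · rw [vert_mul_of_ne _ hij, vert_mul_of_ne _ hij, vert_mul_of_ne _ hij, vert_mul_of_ne _ hij,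
      sub_zero, add_zero, cx_zero]

theorem preVertex_mul_preArrow (a : Q.CArrow) :
    Q.preVertex (Q.complexified.t a) * Q.preArrow a = Q.preArrow a := by
  obtain ⟨h₁, h₂⟩ := (Q.M a.1.1).pre_left a.1.2 a.2
  change Q.cx (Q.vert (Q.t a.1.1) ((Q.D (Q.t a.1.1)).preRe ((Q.M a.1.1).tgtBar a.1.2)))
    (Q.vert (Q.t a.1.1) ((Q.D (Q.t a.1.1)).preIm ((Q.M a.1.1).tgtBar a.1.2))) * Q.preArrow a = _
  rw [preArrow, cx_mul, vert_mul_arr, vert_mul_arr, vert_mul_arr, vert_mul_arr, ← arr_sub,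
    ← arr_add, h₁, h₂]

theorem preArrow_mul_preVertex (a : Q.CArrow) :
    Q.preArrow a * Q.preVertex (Q.complexified.s a) = Q.preArrow a := by
  obtain ⟨h₁, h₂⟩ := (Q.M a.1.1).pre_right a.1.2 a.2
  change Q.preArrow a * Q.cx (Q.vert (Q.s a.1.1) ((Q.D (Q.s a.1.1)).preRe ((Q.M a.1.1).srcBar a.1.2)))
    (Q.vert (Q.s a.1.1) ((Q.D (Q.s a.1.1)).preIm ((Q.M a.1.1).srcBar a.1.2))) = _
  rw [preArrow, cx_mul, arr_mul_vert, arr_mul_vert, arr_mul_vert, arr_mul_vert, ← arr_sub,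
    ← arr_add, h₁, h₂]

variable [Fintype V]

theorem coef_eq_sum_vert (a : Q.VertexRing) :
    BimodTensor.coef ℝ Q.VertexRing Q.ArrowBimod a = ∑ i, Q.vert i (a i) := by
  simp only [vert]
  rw [← map_sum, Finset.univ_sum_single]

theorem sum_cvertex {B : Type*} [AddCommMonoid B] (F : V → Bool → B) :
    ∑ x : Q.CVertex, F x.1.1 x.1.2 =
      ∑ i, (F i false + if (Q.D i).hasBar then F i true else 0) := by
  rw [← Finset.sum_subtype (Finset.univ.filter fun x : V × Bool =>
    x.2 = true → (Q.D x.1).hasBar = true) (by simp) (fun x : V × Bool => F x.1 x.2),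
    Finset.sum_filter, Fintype.sum_prod_type]
  refine Finset.sum_congr rfl fun i _ => ?_
  rw [Fintype.sum_bool, add_comm]
  simp

theorem sum_preVertex : ∑ x, Q.preVertex x = Q.fullIdem := by
  have hsum : ∀ (F G : V → Bool → Q.TensorAlg), ∑ x : Q.CVertex, Q.cx (F x.1.1 x.1.2) (G x.1.1 x.1.2)
      = Q.cx (∑ x : Q.CVertex, F x.1.1 x.1.2) (∑ x : Q.CVertex, G x.1.1 x.1.2) := by
    intro F G
    simp only [cx, Finset.sum_add_distrib, TensorProduct.tmul_sum]
  have h := hsum (fun i b => Q.vert i ((Q.D i).preRe b)) (fun i b => Q.vert i ((Q.D i).preIm b))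
  refine h.trans ?_
  rw [Q.sum_cvertex (fun i b => Q.vert i ((Q.D i).preRe b)),
    Q.sum_cvertex (fun i b => Q.vert i ((Q.D i).preIm b)), fullIdem, coef_eq_sum_vert, coef_eq_sum_vert]
  congr 1 <;> refine Finset.sum_congr rfl fun i _ => ?_
  · rw [DivRing.idemRe_eq, vert_add]
    split_ifs <;> simp [vert_zero]
  · rw [DivRing.idemIm_eq, vert_add]
    split_ifs <;> simp [vert_zero]

theorem fullIdem_mul_preVertex (x : Q.CVertex) : Q.fullIdem * Q.preVertex x = Q.preVertex x := by
  rw [← sum_preVertex, Finset.sum_mul, Finset.sum_eq_single x, preVertex_mul_self]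
  · intro y _ hy
    exact Q.preVertex_mul_of_ne hy
  · simp

theorem preVertex_mul_fullIdem (x : Q.CVertex) : Q.preVertex x * Q.fullIdem = Q.preVertex x := by
  rw [← sum_preVertex, Finset.mul_sum, Finset.sum_eq_single x, preVertex_mul_self]
  · intro y _ hy
    exact Q.preVertex_mul_of_ne hy.symm
  · simp

theorem fullIdem_idem : IsIdempotentElem Q.fullIdem := by
  unfold IsIdempotentElem
  nth_rewrite 2 [← sum_preVertex]
  rw [Finset.mul_sum, ← sum_preVertex]
  refine Finset.sum_congr rfl fun x _ => ?_
  rw [sum_preVertex, fullIdem_mul_preVertex]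

/-- The ring `𝐞 (T(Q, 𝓜) ⊗ ℂ) 𝐞`. -/
abbrev Corner : Type _ := Q.fullIdem_idem.Corner

theorem smul_fullIdem_mem (c : ℂ) : c • Q.fullIdem ∈ Subsemigroup.corner Q.fullIdem :=
  (Subsemigroup.mem_corner_iff Q.fullIdem_idem).mpr
    ⟨by rw [mul_smul_comm, Q.fullIdem_idem.eq], by rw [smul_mul_assoc, Q.fullIdem_idem.eq]⟩

theorem fullIdem_mul_corner (x : Q.Corner) : Q.fullIdem * x.1 = x.1 :=
  ((Subsemigroup.mem_corner_iff Q.fullIdem_idem).mp x.2).1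

theorem corner_mul_fullIdem (x : Q.Corner) : x.1 * Q.fullIdem = x.1 :=
  ((Subsemigroup.mem_corner_iff Q.fullIdem_idem).mp x.2).2

/-- The structure of a `ℂ`-algebra on `𝐞 (T(Q, 𝓜) ⊗ ℂ) 𝐞`. -/
noncomputable instance : Algebra ℂ Q.Corner :=
  RingHom.toAlgebra'
    { toFun := fun c => ⟨c • Q.fullIdem, Q.smul_fullIdem_mem c⟩
      map_one' := Subtype.ext (one_smul ℂ Q.fullIdem)
      map_mul' := fun c d => Subtype.ext (by
        change (c * d) • Q.fullIdem = (c • Q.fullIdem) * (d • Q.fullIdem)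
        rw [smul_mul_smul_comm, Q.fullIdem_idem.eq])
      map_zero' := Subtype.ext (zero_smul ℂ Q.fullIdem)
      map_add' := fun c d => Subtype.ext (add_smul c d Q.fullIdem) }
    (fun c x => Subtype.ext (by
      change (c • Q.fullIdem) * x.1 = x.1 * (c • Q.fullIdem)
      rw [smul_mul_assoc, mul_smul_comm, fullIdem_mul_corner, corner_mul_fullIdem]))

/-- The inverse of `Ψ` on the vertices of `Γ`. -/
noncomputable def psiInvVertex : (Q.CVertex → ℂ) →ₐ[ℂ] Q.Corner where
  toFun f := ⟨∑ x, f x • Q.preVertex x, (Subsemigroup.mem_corner_iff Q.fullIdem_idem).mpr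
    ⟨by simp_rw [Finset.mul_sum, mul_smul_comm, fullIdem_mul_preVertex],
      by simp_rw [Finset.sum_mul, smul_mul_assoc, preVertex_mul_fullIdem]⟩⟩
  map_one' := Subtype.ext (by
    change ∑ x, (1 : ℂ) • Q.preVertex x = Q.fullIdem
    simp_rw [one_smul, sum_preVertex])
  map_mul' f g := Subtype.ext (by
    change ∑ x, (f x * g x) • Q.preVertex x =
      (∑ x, f x • Q.preVertex x) * ∑ x, g x • Q.preVertex x
    rw [Finset.sum_mul]
    refine Finset.sum_congr rfl fun x _ => ?_
    rw [Finset.mul_sum, Finset.sum_eq_single x, smul_mul_smul_comm, preVertex_mul_self]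
    · intro y _ hy
      rw [smul_mul_smul_comm, Q.preVertex_mul_of_ne hy.symm, smul_zero]
    · simp)
  map_zero' := Subtype.ext (by
    change ∑ x, (0 : ℂ) • Q.preVertex x = 0
    simp)
  map_add' f g := Subtype.ext (by
    change ∑ x, (f x + g x) • Q.preVertex x =
      (∑ x, f x • Q.preVertex x) + ∑ x, g x • Q.preVertex x
    simp_rw [add_smul, Finset.sum_add_distrib])
  commutes' c := Subtype.ext (by
    change ∑ x, c • Q.preVertex x = c • Q.fullIdem
    rw [← Finset.smul_sum, sum_preVertex])

theorem fullIdem_mul_preArrow (a : Q.CArrow) : Q.fullIdem * Q.preArrow a = Q.preArrow a := by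
  rw [← preVertex_mul_preArrow, ← mul_assoc, fullIdem_mul_preVertex]

theorem preArrow_mul_fullIdem (a : Q.CArrow) : Q.preArrow a * Q.fullIdem = Q.preArrow a := by
  rw [← preArrow_mul_preVertex, mul_assoc, preVertex_mul_fullIdem]

variable [Fintype E]

/-- The inverse of `Ψ` on the arrows of `Γ`. -/
noncomputable def psiInvArrow : Q.complexified.ArrowSpan ℂ →+ Q.Corner where
  toFun f := ⟨∑ a, f a • Q.preArrow a, (Subsemigroup.mem_corner_iff Q.fullIdem_idem).mpr
    ⟨by simp_rw [Finset.mul_sum, mul_smul_comm, fullIdem_mul_preArrow],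
      by simp_rw [Finset.sum_mul, smul_mul_assoc, preArrow_mul_fullIdem]⟩⟩
  map_zero' := Subtype.ext (by
    change ∑ x, (0 : ℂ) • Q.preArrow x = 0
    simp)
  map_add' f g := Subtype.ext (by
    change ∑ x, (f x + g x) • Q.preArrow x =
      (∑ x, f x • Q.preArrow x) + ∑ x, g x • Q.preArrow x
    simp_rw [add_smul, Finset.sum_add_distrib])

/-- The inverse of the isomorphism `Ψ : 𝐞 (T(Q, 𝓜) ⊗ ℂ) 𝐞 → ℂΓ`: the homomorphism of `ℂ`-algebras
which sends the trivial paths and the arrows of `Γ` to their preimages under the isomorphisms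
`𝐞_i (𝓜(i) ⊗ ℂ) 𝐞_i ≃ ⨁ ℂ e_x` and `𝐞_{t(α)} (𝓜(α) ⊗ ℂ) 𝐞_{s(α)} ≃ ⨁ ℂ γ` described above. -/
noncomputable def psiInv : Q.complexified.PathAlgebra ℂ →ₐ[ℂ] Q.Corner :=
  BimodTensor.lift Q.psiInvVertex Q.psiInvArrow
    (fun f g => Subtype.ext (by
      change ∑ a, (f (Q.complexified.t a) * g a) • Q.preArrow a =
        (∑ x, f x • Q.preVertex x) * ∑ a, g a • Q.preArrow a
      rw [Finset.mul_sum]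
      refine Finset.sum_congr rfl fun a _ => ?_
      rw [Finset.sum_mul, Finset.sum_eq_single (Q.complexified.t a), smul_mul_smul_comm,
        preVertex_mul_preArrow]
      · intro y _ hy
        rw [smul_mul_smul_comm, ← preVertex_mul_preArrow, ← mul_assoc, Q.preVertex_mul_of_ne hy,
          zero_mul, smul_zero]
      · simp))
    (fun g f => Subtype.ext (by
      change ∑ a, (g a * f (Q.complexified.s a)) • Q.preArrow a =
        (∑ a, g a • Q.preArrow a) * ∑ x, f x • Q.preVertex x
      rw [Finset.sum_mul]
      refine Finset.sum_congr rfl fun a _ => ?_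
      rw [Finset.mul_sum, Finset.sum_eq_single (Q.complexified.s a), smul_mul_smul_comm,
        preArrow_mul_preVertex]
      · intro y _ hy
        rw [smul_mul_smul_comm, ← preArrow_mul_preVertex, mul_assoc,
          Q.preVertex_mul_of_ne hy.symm, mul_zero, smul_zero]
      · simp))

end ModulatedQuiver

/-! ## The complexified quiver presentation -/

namespace ModulatedQuiver

variable {V E : Type*} (Q : ModulatedQuiver V E) [DecidableEq V] [DecidableEq E]

/-- An ideal of `T(Q, 𝓜)`, as a real subspace. -/
def idealSpace (I : TwoSidedIdeal Q.TensorAlg) : Submodule ℝ Q.TensorAlg where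
  carrier := {x | x ∈ I}
  add_mem' hx hy := I.add_mem hx hy
  zero_mem' := I.zero_mem
  smul_mem' c x hx := by
    rw [Set.mem_ofPred_eq, ← one_mul x, ← smul_mul_assoc]
    exact I.mul_mem_left _ _ hx

/-- `I ⊗ ℂ`, as a subspace of `T(Q, 𝓜) ⊗ ℂ`. -/
noncomputable def idealC (I : TwoSidedIdeal Q.TensorAlg) : Submodule ℂ Q.CTensorAlg :=
  (Q.idealSpace I).baseChange ℂ

theorem mul_mem_idealC (I : TwoSidedIdeal Q.TensorAlg) (z : Q.CTensorAlg) {y : Q.CTensorAlg}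
    (hy : y ∈ Q.idealC I) : z * y ∈ Q.idealC I := by
  rw [idealC, Submodule.baseChange_eq_span] at hy ⊢
  induction hy using Submodule.span_induction with
  | zero => rw [mul_zero]; exact Submodule.zero_mem _
  | add y y' _ _ h h' => rw [mul_add]; exact Submodule.add_mem _ h h'
  | smul c y _ h => rw [mul_smul_comm]; exact Submodule.smul_mem _ _ h
  | mem y hy =>
    obtain ⟨x, hx, rfl⟩ := hy
    induction z using TensorProduct.induction_on with
    | zero => rw [zero_mul]; exact Submodule.zero_mem _
    | add z z' h h' => rw [add_mul]; exact Submodule.add_mem _ h h'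
    | tmul c t =>
      have h : (c ⊗ₜ[ℝ] t : Q.CTensorAlg) * ((1 : ℂ) ⊗ₜ[ℝ] x) = c • ((1 : ℂ) ⊗ₜ[ℝ] (t * x)) := by
        rw [Algebra.TensorProduct.tmul_mul_tmul, TensorProduct.smul_tmul', mul_one, smul_eq_mul,
          mul_one]
      exact h ▸ Submodule.smul_mem _ _ (Submodule.subset_span
        ⟨t * x, I.mul_mem_left _ _ hx, rfl⟩)

theorem idealC_mul_mem (I : TwoSidedIdeal Q.TensorAlg) (z : Q.CTensorAlg) {y : Q.CTensorAlg}
    (hy : y ∈ Q.idealC I) : y * z ∈ Q.idealC I := by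
  rw [idealC, Submodule.baseChange_eq_span] at hy ⊢
  induction hy using Submodule.span_induction with
  | zero => rw [zero_mul]; exact Submodule.zero_mem _
  | add y y' _ _ h h' => rw [add_mul]; exact Submodule.add_mem _ h h'
  | smul c y _ h => rw [smul_mul_assoc]; exact Submodule.smul_mem _ _ h
  | mem y hy =>
    obtain ⟨x, hx, rfl⟩ := hy
    induction z using TensorProduct.induction_on with
    | zero => rw [mul_zero]; exact Submodule.zero_mem _
    | add z z' h h' => rw [mul_add]; exact Submodule.add_mem _ h h'
    | tmul c t =>
      have h : ((1 : ℂ) ⊗ₜ[ℝ] x) * (c ⊗ₜ[ℝ] t : Q.CTensorAlg) = c • ((1 : ℂ) ⊗ₜ[ℝ] (x * t)) := by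
        rw [Algebra.TensorProduct.tmul_mul_tmul, TensorProduct.smul_tmul', one_mul, smul_eq_mul,
          mul_one]
      exact h ▸ Submodule.smul_mem _ _ (Submodule.subset_span
        ⟨x * t, I.mul_mem_right _ _ hx, rfl⟩)

variable [Fintype V] [Fintype E]

/-- The ideal `J = Ψ(𝐞 (I ⊗ ℂ) 𝐞)` of `ℂΓ`. -/
noncomputable def complexifiedIdeal (I : TwoSidedIdeal Q.TensorAlg) :
    TwoSidedIdeal (Q.complexified.PathAlgebra ℂ) :=
  TwoSidedIdeal.mk' {x | ∃ y ∈ Q.idealC I, (Q.psiInv x).1 = Q.fullIdem * y * Q.fullIdem}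
    ⟨0, Submodule.zero_mem _, by rw [map_zero, mul_zero, zero_mul]; rfl⟩
    (by
      rintro x x' ⟨y, hy, h⟩ ⟨y', hy', h'⟩
      refine ⟨y + y', Submodule.add_mem _ hy hy', ?_⟩
      rw [map_add, mul_add, add_mul, ← h, ← h']
      rfl)
    (by
      rintro x ⟨y, hy, h⟩
      refine ⟨-y, Submodule.neg_mem _ hy, ?_⟩
      rw [map_neg]
      change -(Q.psiInv x).1 = _
      have aux : ∀ (R : Type _) [Ring R] (e z : R), -(e * z * e) = e * -z * e := by
        intro R _ e z
        rw [mul_neg, neg_mul]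
      rw [h]
      exact aux Q.CTensorAlg _ _)
    (by
      rintro a x ⟨y, hy, h⟩
      refine ⟨(Q.psiInv a).1 * Q.fullIdem * y, Q.mul_mem_idealC I _ hy, ?_⟩
      rw [map_mul]
      change (Q.psiInv a).1 * (Q.psiInv x).1 = _
      rw [h]
      conv_lhs => rw [← Q.fullIdem_mul_corner (Q.psiInv a)]
      simp only [mul_assoc])
    (by
      rintro x a ⟨y, hy, h⟩
      refine ⟨y * (Q.fullIdem * (Q.psiInv a).1), Q.idealC_mul_mem I _ hy, ?_⟩
      rw [map_mul]
      change (Q.psiInv x).1 * (Q.psiInv a).1 = _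
      rw [h]
      conv_lhs => rw [← Q.corner_mul_fullIdem (Q.psiInv a)]
      simp only [mul_assoc])

theorem mem_complexifiedIdeal (I : TwoSidedIdeal Q.TensorAlg)
    (x : Q.complexified.PathAlgebra ℂ) :
    x ∈ Q.complexifiedIdeal I ↔
      ∃ y ∈ Q.idealC I, (Q.psiInv x).1 = Q.fullIdem * y * Q.fullIdem :=
  TwoSidedIdeal.mem_mk' _ _ _ _ _ _ _

end ModulatedQuiver

/-! ## Gentle vertices in `T(Q, 𝓜) / I` -/

/-- Names of some elements of the simple bimodules: `1`, `𝐢`, `𝐣`, `𝐤`, `𝐥` and the two standard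
vectors in the columns or rows of length two over `ℂ`. -/
inductive Symb
  | o
  | i
  | j
  | k
  | l
  | e₁
  | e₂

/-- The element of `S` with a given name. The value is `0` if the name makes no sense in `S`. -/
noncomputable def SimpleBimod.elt : {D D' : DivRing} → (S : SimpleBimod D D') → Symb → S.carrier
  | _, _, .RR, .o => (1 : ℝ)
  | _, _, .HH, .o => (1 : ℍ[ℝ])
  | _, _, .HH, .j => qj
  | _, _, .HH, .k => qk
  | _, _, .HH, .l => ql
  | _, _, .RC, .o => (1 : ℂ)
  | _, _, .RC, .i => Complex.I
  | _, _, .CR, .o => (1 : ℂ)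
  | _, _, .CR, .i => Complex.I
  | _, _, .RH, .o => (1 : ℍ[ℝ])
  | _, _, .RH, .j => qj
  | _, _, .RH, .k => qk
  | _, _, .RH, .l => ql
  | _, _, .HR, .o => (1 : ℍ[ℝ])
  | _, _, .HR, .j => qj
  | _, _, .HR, .k => qk
  | _, _, .HR, .l => ql
  | _, _, .HC, .e₁ => (![1, 0] : Fin 2 → ℂ)
  | _, _, .HC, .e₂ => (![0, 1] : Fin 2 → ℂ)
  | _, _, .CH, .e₁ => (![1, 0] : Fin 2 → ℂ)
  | _, _, .CH, .e₂ => (![0, 1] : Fin 2 → ℂ)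
  | _, _, .CC, .o => (1 : ℂ)
  | _, _, .CC, .i => Complex.I
  | _, _, .CCbar, .o => (1 : ℂ)
  | _, _, .CCbar, .i => Complex.I
  | _, _, S, _ => (0 : S.carrier)

namespace ModulatedQuiver

variable {V E : Type*} (Q : ModulatedQuiver V E) [DecidableEq V] [DecidableEq E]

/-- `𝓜(αβ) = 𝓜(α) ⊗ 𝓜(β)`, as a subspace of `T(Q, 𝓜)`. -/
noncomputable def pathSpace (α β : E) : Submodule ℝ Q.TensorAlg :=
  Submodule.span ℝ {z | ∃ x y, z = Q.arr α x * Q.arr β y}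

/-- The tensor `c_α ⊗ d_β` in `𝓜(αβ)`. -/
noncomputable def tens (c : Symb) (α : E) (d : Symb) (β : E) : Q.TensorAlg :=
  Q.arr α ((Q.M α).elt c) * Q.arr β ((Q.M β).elt d)

open Symb in
/-- The elements `r₀` (and `r₀^𝐢`) for arrows `β, β'` from `u` to `v` and `α, α'` from `v` to `w`,
where `v` has modulation `ℝ` or `ℍ`, depending on the modulations of `u`, `v`, `w`. -/
noncomputable def rel₀ (α α' β β' : E) : DivRing → DivRing → DivRing → Set Q.TensorAlg
  | .R, .R, .R => {Q.tens o α o β - Q.tens o α' o β', -Q.tens o α o β' - Q.tens o α' o β}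
  | .R, .R, .H => {Q.tens o α o β + Q.tens j α o β'}
  | .R, .R, .C => {Q.tens o α o β + Q.tens i α o β'}
  | .H, .H, .R => {Q.tens o α o β + Q.tens o α j β'}
  | .H, .H, .H => {Q.tens o α o β - Q.tens o α' o β' + Q.tens o α j β' + Q.tens o α' j β}
  | .H, .H, .C => {Q.tens e₁ α o β + Q.tens e₁ α j β'}
  | .H, .R, .R => {Q.tens o α o β + Q.tens o α' j β}
  | .C, .R, .R => {Q.tens o α o β + Q.tens o α' i β}
  | .R, .H, .H => {Q.tens o α o β + Q.tens o α' j β}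
  | .C, .H, .H => {Q.tens o α e₁ β + Q.tens j α' e₁ β}
  | .H, .R, .H => {Q.tens o α o β - Q.tens j α j β}
  | .H, .R, .C => {Q.tens o α o β - Q.tens i α j β}
  | .C, .R, .H => {Q.tens o α o β - Q.tens j α i β}
  | .C, .R, .C => {Q.tens o α o β - Q.tens i α i β}
  | .R, .H, .C => {Q.tens e₁ α o β}
  | .C, .H, .R => {Q.tens o α e₁ β}
  | .C, .H, .C => {Q.tens e₁ α e₁ β}
  | .R, .H, .R => {Q.tens o α o β, Q.tens o α j β}
  | _, .C, _ => ∅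

open Symb in
/-- The elements `r₁` (and `r₁^𝐢`). -/
noncomputable def rel₁ (α α' β β' : E) : DivRing → DivRing → DivRing → Set Q.TensorAlg
  | .R, .R, .R => {Q.tens o α o β + Q.tens o α' o β', Q.tens o α o β' - Q.tens o α' o β}
  | .R, .R, .H => {Q.tens o α o β - Q.tens j α o β'}
  | .R, .R, .C => {Q.tens o α o β - Q.tens i α o β'}
  | .H, .H, .R => {Q.tens o α k β - Q.tens o α l β'}
  | .H, .H, .H => {Q.tens o α k β + Q.tens o α' k β' - Q.tens o α l β' + Q.tens o α' l β}
  | .H, .H, .C => {Q.tens e₁ α k β - Q.tens e₁ α l β'}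
  | .H, .R, .R => {Q.tens o α o β - Q.tens o α' j β}
  | .C, .R, .R => {Q.tens o α o β - Q.tens o α' i β}
  | .R, .H, .H => {Q.tens o α k β + Q.tens o α' l β}
  | .C, .H, .H => {Q.tens k α e₁ β + Q.tens l α' e₁ β}
  | .H, .R, .H => {Q.tens o α o β + Q.tens j α j β}
  | .H, .R, .C => {Q.tens o α o β + Q.tens i α j β}
  | .C, .R, .H => {Q.tens o α o β + Q.tens j α i β}
  | .C, .R, .C => {Q.tens o α o β + Q.tens i α i β}
  | .R, .H, .C => {Q.tens e₁ α k β}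
  | .C, .H, .R => {-Q.tens k α e₁ β}
  | .C, .H, .C => {Q.tens e₁ α e₂ β}
  | .R, .H, .R => {Q.tens o α k β, Q.tens o α l β}
  | _, .C, _ => ∅

/-- The `𝓜(w)`-`𝓜(u)`-bimodule generated by a set `S`. -/
noncomputable def bimodSpan (w u : V) (S : Set Q.TensorAlg) : Submodule ℝ Q.TensorAlg :=
  Submodule.span ℝ {z | ∃ a, ∃ r ∈ S, ∃ b, z = Q.vert w a * r * Q.vert u b}

section gentle

variable [Fintype E] (I : TwoSidedIdeal Q.TensorAlg)

/-- Conditions (G1) and (G2) for a vertex `v` in `T(Q, 𝓜) / I`. -/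
structure OrdinaryCond (v : V) : Prop where
  card_out : (Q.outArrows v).card ≤ 2
  card_in : (Q.inArrows v).card ≤ 2
  xor_in : ∀ α ∈ Q.outArrows v, ∀ β ∈ Q.inArrows v, ∀ γ ∈ Q.inArrows v, β ≠ γ →
    Xor (Q.pathSpace α β ≤ Q.idealSpace I) (Q.pathSpace α γ ≤ Q.idealSpace I)
  xor_out : ∀ α ∈ Q.inArrows v, ∀ β ∈ Q.outArrows v, ∀ γ ∈ Q.outArrows v, β ≠ γ →
    Xor (Q.pathSpace β α ≤ Q.idealSpace I) (Q.pathSpace γ α ≤ Q.idealSpace I)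

/-- `v` is ordinarily gentle (with `ℝ`, with `ℍ` or with `ℂ`) in `T(Q, 𝓜) / I`. -/
def IsOrdinarilyGentle (v : V) : Prop :=
  Q.OrdinaryCond I v ∧
    ((Q.D v = .R ∧ ∀ u ∈ Q.neighbors v, Q.D u = .R) ∨
      (Q.D v = .H ∧ ∀ u ∈ Q.neighbors v, Q.D u = .H) ∨
      (Q.D v = .C ∧ ∀ α ∈ Q.outArrows v, ∀ β ∈ Q.inArrows v, Q.D (Q.t α) ≠ .C → Q.D (Q.s β) ≠ .C →
        Q.idealSpace I ⊓ Q.pathSpace α β = Q.pathSpace α β ∨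
          Q.idealSpace I ⊓ Q.pathSpace α β = ⊥))

/-- The arrows starting at `v` form one of the right halves of the local quivers which occur for
specially gentle vertices, up to the condition on `𝓜(v)`. They are two parallel arrows `α`, `α'`
from `v` to `w` if `𝓜(w) = 𝓜(v)`, and they are a single arrow `α = α'` from `v` to `w` otherwise. -/
def IsOutHalf (v w : V) (α α' : E) : Prop :=
  Q.outArrows v = {α, α'} ∧ Q.t α = w ∧ Q.t α' = w ∧ (α ≠ α' ↔ Q.D w = Q.D v)

/-- The analogous condition on the arrows ending at `v`. -/
def IsInHalf (v u : V) (β β' : E) : Prop :=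
  Q.inArrows v = {β, β'} ∧ Q.s β = u ∧ Q.s β' = u ∧ (β ≠ β' ↔ Q.D u = Q.D v)

/-- The vertices `v`, `N_v` and the arrows `v⁻`, `v⁺` form one of the 18 local quivers, with the
labelling given by `u`, `w` and `α, α', β, β'` (where `α'` is `α^𝐢` if there are two arrows, and `α`
otherwise), and `I` includes `I_v^0` xor `I_v^1`. -/
structure SpecialCond (v u w : V) (α α' β β' : E) : Prop where
  ne_C : Q.D v ≠ .C
  isOutHalf : Q.IsOutHalf v w α α'
  isInHalf : Q.IsInHalf v u β β'
  loops : Q.neighbors v = {v} → α = β ∧ α' = β'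
  rel : Xor (Q.bimodSpan w u (Q.rel₀ α α' β β' (Q.D u) (Q.D v) (Q.D w)) ≤ Q.idealSpace I)
    (Q.bimodSpan w u (Q.rel₁ α α' β β' (Q.D u) (Q.D v) (Q.D w)) ≤ Q.idealSpace I)

/-- The vertices `v`, `N_v` and the arrows `v⁻`, `v⁺` form one of the degenerate local quivers. -/
def IsDegenerate (v : V) : Prop :=
  Q.D v ≠ .C ∧
    ((Q.inArrows v = ∅ ∧ Q.outArrows v = ∅) ∨
      (Q.inArrows v = ∅ ∧ ∃ w α α', Q.IsOutHalf v w α α') ∨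
      (Q.outArrows v = ∅ ∧ ∃ u β β', Q.IsInHalf v u β β'))

/-- `v` is specially gentle in `T(Q, 𝓜) / I`. -/
def IsSpeciallyGentle (v : V) : Prop :=
  (∃ u w α α' β β', Q.SpecialCond I v u w α α' β β') ∨ Q.IsDegenerate v

/-- `v` is gentle in `T(Q, 𝓜) / I`. -/
def IsGentle (v : V) : Prop :=
  Q.IsOrdinarilyGentle I v ∨ Q.IsSpeciallyGentle I v

variable [Fintype V]

/-- The automorphism `d` of `ℂΓ` sends the arrows of a pair of parallel arrows `γ ≠ γ'` with
`{γ, γ'} = {α, α'}` or `{γ, γ'} = {β, β'}` to `(γ + γ') / 2` and `(γ - γ') / 2𝐢`, and fixes all the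
trivial paths and all the other arrows of `Γ`. -/
structure DiagonalizesPairs (α α' β β' : E)
    (d : Q.complexified.PathAlgebra ℂ ≃ₐ[ℂ] Q.complexified.PathAlgebra ℂ) : Prop where
  triv : ∀ x, d (Q.complexified.triv ℂ x) = Q.complexified.triv ℂ x
  pair : ∀ γ γ', γ ≠ γ' → ((γ = α ∧ γ' = α') ∨ (γ = β ∧ γ' = β')) →
    d (Q.complexified.arrow ℂ (Q.fiber γ)) = (1 / 2 : ℂ) •
      (Q.complexified.arrow ℂ (Q.fiber γ) + Q.complexified.arrow ℂ (Q.fiber γ')) ∧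
    d (Q.complexified.arrow ℂ (Q.fiber γ')) = (1 / (2 * Complex.I) : ℂ) •
      (Q.complexified.arrow ℂ (Q.fiber γ) - Q.complexified.arrow ℂ (Q.fiber γ'))
  other : ∀ a : Q.CArrow, (α ≠ α' → a ≠ Q.fiber α ∧ a ≠ Q.fiber α') →
    (β ≠ β' → a ≠ Q.fiber β ∧ a ≠ Q.fiber β') →
    d (Q.complexified.arrow ℂ a) = Q.complexified.arrow ℂ a

/-- `d` is the automorphism `d_v` of `ℂΓ` attached to the gentle vertex `v`. It is the identity if `v`
is ordinarily gentle or if the local quiver at `v` is degenerate. In the 18 cases, it is the identity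
unless there are parallel arrows at `v`, and depends only on the labelling of these arrows. -/
def IsDiagonalization (v : V)
    (d : Q.complexified.PathAlgebra ℂ ≃ₐ[ℂ] Q.complexified.PathAlgebra ℂ) : Prop :=
  ((Q.IsOrdinarilyGentle I v ∨ Q.IsDegenerate v) ∧ d = AlgEquiv.refl) ∨
    ∃ u w α α' β β', Q.SpecialCond I v u w α α' β β' ∧ Q.DiagonalizesPairs α α' β β' d

/-- The ideal `d(J)` of `ℂΓ`, where `J` is the ideal of the complexified quiver presentation. -/
noncomputable def twistedIdeal
    (d : Q.complexified.PathAlgebra ℂ ≃ₐ[ℂ] Q.complexified.PathAlgebra ℂ) :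
    TwoSidedIdeal (Q.complexified.PathAlgebra ℂ) :=
  (Q.complexifiedIdeal I).comap d.symm

end gentle

end ModulatedQuiver

end ComplexifiedGentle

namespace ComplexifiedGentle.ModulatedQuiver

variable {V E : Type*} (Q : ModulatedQuiver V E) [DecidableEq V] [DecidableEq E]

/-! ## The complexification of an ideal -/

/-! Write elements of `T ⊗ ℂ` as `p ⊗ 1 + q ⊗ i`. Such an element lies in `I ⊗ ℂ` exactly when `p`
and `q` lie in `I` (`cx_mem_idealC`). Since `Ψ⁻¹` takes values in the corner of `𝐞`, an element of
`ℂΓ` lies in `J` exactly when its image under `Ψ⁻¹` lies in `I ⊗ ℂ` (`mem_complexifiedIdeal_iff`).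
So `ab ∈ J`, for arrows `a`, `b` of `Γ`, means that two explicit elements of `T` lie in `I`. For
`d(J)` one uses `Ψ⁻¹ ∘ d⁻¹` instead (`mul_mem_twistedIdeal`). The isomorphism of quotients is
formal, because `d` carries `J` onto `d(J)`.

If `v` is ordinarily gentle, then `d` is the identity, and for arrows `a`, `b` of `Γ` over `α`, `β`
which meet over `v` one has `ab ∈ J` if and only if `I` includes `𝓜(αβ)`. The two real conditions
put `p ⊗ q` into `I` for nonzero `p`, `q`, and also `p𝐢 ⊗ q` if `𝓜(v) = ℂ`. As the bimodules are
simple, this forces all of `𝓜(αβ)` into `I` (`pathSpace_le_of_forall`). At each vertex of `Γ` over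
`v` the arrows of `Γ` inject into those of `Q`, so (G1) and (G2) are inherited.

If `v` is specially gentle with two nonempty halves, each half gives two arrows of `Γ` at `v`. After
applying `Ψ⁻¹ ∘ d⁻¹` they have a uniform shape, up to nonzero complex factors and units of `𝓜(w)` or
`𝓜(u)`, none of which affects membership in `I ⊗ ℂ`.

For `𝓜(v) = ℝ` the outgoing arrows become `G ± G* ⊗ i` and the incoming ones `B ± B* ⊗ i`. Products
with equal signs have components `GB - G*B*` and `±(GB* + G*B)`, which generate `I_v^0`; products
with opposite signs have components `GB + G*B*` and `±(GB* - G*B)`, which generate `I_v^1`.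

For `𝓜(v) = ℍ` put `ε = (1 - 𝐣 ⊗ i)/2`. The arrows become `Xε`, `X𝐤ε` and `εY`, `ε𝐤Y`. The products
`XεY` and `X𝐤ε𝐤Y` are governed by `XY` and `X𝐣Y`, which generate `I_v^0`; the mixed products are
governed by `X𝐤Y` and `X𝐣𝐤Y`, which generate `I_v^1`.

The 18 cases of the table are these two patterns (`mem_and_mem_iff_of_R`, `mem_and_mem_iff_of_H`). A
single generator suffices where `𝓜(u)` or `𝓜(w)` contains `𝐢` or `𝐣`, since multiplication by that
unit produces the second one. That `I` includes exactly one of `I_v^0`, `I_v^1` is then exactly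
(G2), by `isGentleVertex_of_pairs`. -/

theorem smul_cx (c : ℂ) (p q : Q.TensorAlg) :
    c • Q.cx p q = Q.cx (c.re • p - c.im • q) (c.re • q + c.im • p) := by
  have h1 : c = c.re • (1 : ℂ) + c.im • Complex.I := by
    apply Complex.ext <;> simp
  have h2 : c * Complex.I = c.re • Complex.I - c.im • (1 : ℂ) := by
    apply Complex.ext <;> simp
  rw [cx, smul_add, TensorProduct.smul_tmul', TensorProduct.smul_tmul', smul_eq_mul, smul_eq_mul,
    mul_one, h2, TensorProduct.sub_tmul]
  nth_rewrite 1 [h1]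
  rw [TensorProduct.add_tmul, TensorProduct.smul_tmul, TensorProduct.smul_tmul,
    TensorProduct.smul_tmul, TensorProduct.smul_tmul, cx, TensorProduct.tmul_sub,
    TensorProduct.tmul_add]
  abel

theorem I_smul_cx (p q : Q.TensorAlg) : Complex.I • Q.cx p q = Q.cx (-q) p := by
  rw [smul_cx]; simp

theorem cx_sub (p q p' q' : Q.TensorAlg) :
    Q.cx p q - Q.cx p' q' = Q.cx (p - p') (q - q') := by
  rw [sub_eq_iff_eq_add, cx_add, sub_add_cancel, sub_add_cancel]

theorem cx_inj {p q p' q' : Q.TensorAlg} : Q.cx p q = Q.cx p' q' ↔ p = p' ∧ q = q' := by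
  refine ⟨fun h => ?_, fun ⟨h, h'⟩ => by rw [h, h']⟩
  -- The components are recovered by applying the real and imaginary part to the factor `ℂ`.
  have hre := congrArg (TensorProduct.lid ℝ _ ∘ Complex.reLm.rTensor Q.TensorAlg) h
  have him := congrArg (TensorProduct.lid ℝ _ ∘ Complex.imLm.rTensor Q.TensorAlg) h
  simp [cx] at hre him
  exact ⟨hre, him⟩

theorem cx_mem_idealC {I : TwoSidedIdeal Q.TensorAlg} {p q : Q.TensorAlg} :
    Q.cx p q ∈ Q.idealC I ↔ p ∈ I ∧ q ∈ I := by
  refine ⟨fun h => ?_, fun ⟨hp, hq⟩ => ?_⟩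
  -- The elements `p ⊗ 1 + q ⊗ i` with `p`, `q` in `I` form a complex subspace which contains all `1
  -- ⊗ x` with `x ∈ I`; uniqueness of the components then gives the claim.
  · have key : ∀ z ∈ Q.idealC I, ∃ p ∈ Q.idealSpace I, ∃ q ∈ Q.idealSpace I, z = Q.cx p q := by
      intro z hz
      rw [idealC, Submodule.baseChange_eq_span] at hz
      induction hz using Submodule.span_induction with
      | zero => exact ⟨0, Submodule.zero_mem _, 0, Submodule.zero_mem _, Q.cx_zero.symm⟩
      | mem z hz =>
        obtain ⟨x, hx, rfl⟩ := hz
        exact ⟨x, hx, 0, Submodule.zero_mem _, by simp [cx]⟩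
      | add z z' _ _ h h' =>
        obtain ⟨p, hp, q, hq, rfl⟩ := h
        obtain ⟨p', hp', q', hq', rfl⟩ := h'
        exact ⟨_, Submodule.add_mem _ hp hp', _, Submodule.add_mem _ hq hq', Q.cx_add _ _ _ _⟩
      | smul c z _ h =>
        obtain ⟨p, hp, q, hq, rfl⟩ := h
        exact ⟨_, Submodule.sub_mem _ (Submodule.smul_mem _ _ hp) (Submodule.smul_mem _ _ hq),
          _, Submodule.add_mem _ (Submodule.smul_mem _ _ hq) (Submodule.smul_mem _ _ hp),
          Q.smul_cx _ _ _⟩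
    obtain ⟨p', hp, q', hq, h'⟩ := key _ h
    obtain ⟨rfl, rfl⟩ := Q.cx_inj.mp h'
    exact ⟨hp, hq⟩
  · have h : ∀ (c : ℂ) (x : Q.TensorAlg), x ∈ I → c ⊗ₜ[ℝ] x ∈ Q.idealC I := fun c x hx =>
      Submodule.tmul_mem_baseChange_of_mem c (p := Q.idealSpace I) hx
    exact Submodule.add_mem _ (h _ _ hp) (h _ _ hq)

/-- Elements which are left multiples of each other generate the same left ideal. This allows the
preimage of an arrow to be replaced by a convenient multiple. -/
theorem mul_mem_idealC_congr_left {I : TwoSidedIdeal Q.TensorAlg} {z z' U U' : Q.CTensorAlg}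
    (h : z' = U * z) (h' : z = U' * z') (y : Q.CTensorAlg) :
    z * y ∈ Q.idealC I ↔ z' * y ∈ Q.idealC I := by
  constructor <;> intro hy
  · rw [h, mul_assoc]; exact Q.mul_mem_idealC I _ hy
  · rw [h', mul_assoc]; exact Q.mul_mem_idealC I _ hy

theorem mul_mem_idealC_congr_right {I : TwoSidedIdeal Q.TensorAlg} {z z' U U' : Q.CTensorAlg}
    (h : z' = z * U) (h' : z = z' * U') (y : Q.CTensorAlg) :
    y * z ∈ Q.idealC I ↔ y * z' ∈ Q.idealC I := by
  constructor <;> intro hy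
  · rw [h, ← mul_assoc]; exact Q.idealC_mul_mem I _ hy
  · rw [h', ← mul_assoc]; exact Q.idealC_mul_mem I _ hy

variable [Fintype V] [Fintype E]

/-! ## The inverse of `Ψ` with values in `T(Q, 𝓜) ⊗ ℂ` -/

/-- The inverse of `Ψ`, as a linear map to `T(Q, 𝓜) ⊗ ℂ`. -/
noncomputable def psiInvLin : Q.complexified.PathAlgebra ℂ →ₗ[ℂ] Q.CTensorAlg where
  toFun x := (Q.psiInv x).1
  map_add' x y := by rw [map_add]; rfl
  map_smul' c x := by
    rw [map_smul, Algebra.smul_def]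
    -- The unit of the corner is `𝐞`, so a scalar `c` acts on it as multiplication by `c𝐞`.
    change (c • Q.fullIdem) * (Q.psiInv x).1 = c • (Q.psiInv x).1
    rw [smul_mul_assoc, fullIdem_mul_corner]

theorem psiInvLin_mul (x y : Q.complexified.PathAlgebra ℂ) :
    Q.psiInvLin (x * y) = Q.psiInvLin x * Q.psiInvLin y := by
  change (Q.psiInv (x * y)).1 = _
  rw [map_mul]; rfl

theorem psiInvLin_arrow (a : Q.CArrow) :
    Q.psiInvLin (Q.complexified.arrow ℂ a) = Q.preArrow a := by
  change (Q.psiInv (Q.complexified.arrow ℂ a)).1 = _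
  refine (congrArg Subtype.val (BimodTensor.lift_vec _ Q.psiInvArrow _ _ _)).trans ?_
  change ∑ b, (Pi.single a 1 : Q.CArrow → ℂ) b • Q.preArrow b = _
  rw [Finset.sum_eq_single a]
  · simp
  · intro b _ hb; rw [Pi.single_eq_of_ne hb, zero_smul]
  · simp

/-- The element `Ψ⁻¹(x)` is fixed by `𝐞` on both sides, and `I ⊗ ℂ` is stable under multiplication,
so the two factors `𝐞` can be dropped. -/
theorem mem_complexifiedIdeal_iff (I : TwoSidedIdeal Q.TensorAlg)
    (x : Q.complexified.PathAlgebra ℂ) :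
    x ∈ Q.complexifiedIdeal I ↔ Q.psiInvLin x ∈ Q.idealC I := by
  rw [mem_complexifiedIdeal]
  change (∃ y ∈ Q.idealC I, Q.psiInvLin x = _) ↔ _
  constructor
  · rintro ⟨y, hy, h⟩
    rw [h]
    exact Q.idealC_mul_mem I _ (Q.mul_mem_idealC I _ hy)
  · intro h
    refine ⟨_, h, ?_⟩
    change (Q.psiInv x).1 = Q.fullIdem * (Q.psiInv x).1 * Q.fullIdem
    rw [fullIdem_mul_corner, corner_mul_fullIdem]

/-! ### The ideal `d(J)` and its quotient algebra -/

theorem mul_mem_twistedIdeal (I : TwoSidedIdeal Q.TensorAlg)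
    (d : Q.complexified.PathAlgebra ℂ ≃ₐ[ℂ] Q.complexified.PathAlgebra ℂ)
    (x y : Q.complexified.PathAlgebra ℂ) :
    x * y ∈ Q.twistedIdeal I d ↔ Q.psiInvLin (d.symm x) * Q.psiInvLin (d.symm y) ∈ Q.idealC I := by
  rw [twistedIdeal, TwoSidedIdeal.mem_comap, mem_complexifiedIdeal_iff, map_mul, psiInvLin_mul]

theorem twistedIdeal_refl (I : TwoSidedIdeal Q.TensorAlg) :
    Q.twistedIdeal I AlgEquiv.refl = Q.complexifiedIdeal I :=
  TwoSidedIdeal.ext fun _ => by rw [twistedIdeal, TwoSidedIdeal.mem_comap]; rfl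

theorem exists_quotient_equiv (I : TwoSidedIdeal Q.TensorAlg)
    (d : Q.complexified.PathAlgebra ℂ ≃ₐ[ℂ] Q.complexified.PathAlgebra ℂ) :
    ∃ φ : (Q.complexifiedIdeal I).ringCon.Quotient ≃ₐ[ℂ] (Q.twistedIdeal I d).ringCon.Quotient,
      ∀ x, φ ((Q.complexifiedIdeal I).ringCon.mkₐ ℂ x) =
        (Q.twistedIdeal I d).ringCon.mkₐ ℂ (d x) := by
  refine ⟨RingCon.congrₐ ℂ d ?_, fun x => RingCon.congrₐ_mk d _ x⟩
  -- It remains to see that the congruence of `J` is the pullback along `d` of that of `d(J)`.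
  refine RingCon.ext fun x y => ?_
  rw [TwoSidedIdeal.rel_iff]
  change _ ↔ (Q.twistedIdeal I d).ringCon (d x) (d y)
  rw [TwoSidedIdeal.rel_iff, twistedIdeal, TwoSidedIdeal.mem_comap, ← map_sub,
    AlgEquiv.symm_apply_apply]

end ComplexifiedGentle.ModulatedQuiver

namespace ComplexifiedGentle

/-! ## Generators of the simple bimodules -/

@[simp] theorem qj_re : qj.re = 0 := rfl
@[simp] theorem qj_imI : qj.imI = 1 := rfl
@[simp] theorem qj_imJ : qj.imJ = 0 := rfl
@[simp] theorem qj_imK : qj.imK = 0 := rfl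
@[simp] theorem qk_re : qk.re = 0 := rfl
@[simp] theorem qk_imI : qk.imI = 0 := rfl
@[simp] theorem qk_imJ : qk.imJ = 1 := rfl
@[simp] theorem qk_imK : qk.imK = 0 := rfl
@[simp] theorem ql_re : ql.re = 0 := rfl
@[simp] theorem ql_imI : ql.imI = 0 := rfl
@[simp] theorem ql_imJ : ql.imJ = 0 := rfl
@[simp] theorem ql_imK : ql.imK = 1 := rfl

theorem qj_mul_qj : qj * qj = -1 := by ext <;> simp
theorem qk_mul_qk : qk * qk = -1 := by ext <;> simp
theorem qj_mul_qk : qj * qk = ql := by ext <;> simp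
theorem qk_mul_qj : qk * qj = -ql := by ext <;> simp

namespace DivRing

/-- The element `𝐢` of `ℂ` or `𝐣` of `ℍ`. -/
noncomputable def iota : (D : DivRing) → D.carrier
  | .R => (0 : ℝ)
  | .C => Complex.I
  | .H => qj

/-- The element `𝐤` of `ℍ`. -/
noncomputable def kappa : (D : DivRing) → D.carrier
  | .R => (0 : ℝ)
  | .C => (0 : ℂ)
  | .H => qk

theorem iota_mul_iota {D : DivRing} (h : D ≠ .R) : D.iota * D.iota = -1 := by
  cases D
  · exact absurd rfl h
  · exact Complex.I_mul_I
  · exact qj_mul_qj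

theorem kappa_mul_kappa {D : DivRing} (h : D = .H) : D.kappa * D.kappa = -1 := by
  subst h
  exact qk_mul_qk

theorem kappa_mul_iota {D : DivRing} (h : D = .H) : D.kappa * D.iota = -(D.iota * D.kappa) := by
  subst h
  change qk * qj = -(qj * qk)
  rw [qk_mul_qj, qj_mul_qk]

end DivRing

namespace SimpleBimod

variable {D D' : DivRing}

/-- A generator of a simple bimodule: the element `1` or the first standard vector. -/
noncomputable def gen : {D D' : DivRing} → (S : SimpleBimod D D') → S.carrier
  | _, _, .HC => SimpleBimod.HC.elt .e₁
  | _, _, .CH => SimpleBimod.CH.elt .e₁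
  | _, _, S => S.elt .o

theorem pre_of_eq_R (S : SimpleBimod D D') (h : D = .R) (h' : D' = .R) (b : Bool) :
    S.preRe b = S.gen ∧ S.preIm b = 0 := by
  cases S <;> simp at h h'
  exact ⟨rfl, rfl⟩

/-- Doubling clears the denominator of `(1 - ι ⊗ i)/2`, where `ι` is `𝐢` or `𝐣`. Twice the preimage
of `α` is then `g - ιg ⊗ i`, with `g` the generator. The lemmas below are the analogues for `ᾱ`, for
the other side, and for `ℍ`. -/
theorem two_pre_false_of_right_R (S : SimpleBimod D D') (h : D ≠ .R) (h' : D' = .R) :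
    S.preRe false + S.preRe false = S.gen ∧
      S.preIm false + S.preIm false = -(D.iota • S.gen) := by
  cases S <;> simp at h h'
  · change (⟨1 / 2, 0⟩ + ⟨1 / 2, 0⟩ : ℂ) = 1 ∧
      (⟨0, -1 / 2⟩ + ⟨0, -1 / 2⟩ : ℂ) = -(Complex.I * 1)
    constructor <;> apply Complex.ext <;> simp <;> norm_num
  · change ((⟨1 / 2, 0, 0, 0⟩ : ℍ[ℝ]) + (⟨1 / 2, 0, 0, 0⟩ : ℍ[ℝ])) = 1 ∧
      ((⟨0, -1 / 2, 0, 0⟩ : ℍ[ℝ]) + (⟨0, -1 / 2, 0, 0⟩ : ℍ[ℝ])) = -(qj * (1 : ℍ[ℝ]))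
    constructor <;> ext <;> simp <;> norm_num

/-- Up to a unit `u`, the arrow `ᾱ` is the complex conjugate `g + ιg ⊗ i` of `α`. -/
theorem two_pre_true_of_right_R (S : SimpleBimod D D') (h : D ≠ .R) (h' : D' = .R) :
    ∃ u : D.carrier, u ≠ 0 ∧ S.preRe true + S.preRe true = u • S.gen ∧
      S.preIm true + S.preIm true = u • (D.iota • S.gen) := by
  cases S <;> simp at h h'
  · refine ⟨1, one_ne_zero, ?_⟩
    change (⟨1 / 2, 0⟩ + ⟨1 / 2, 0⟩ : ℂ) = 1 * 1 ∧
      (⟨0, 1 / 2⟩ + ⟨0, 1 / 2⟩ : ℂ) = 1 * (Complex.I * 1)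
    constructor <;> apply Complex.ext <;> simp <;> norm_num
  -- The unit is `𝐤`, because `𝐤(1 + 𝐣 ⊗ i) = 𝐤 - 𝐥 ⊗ i`.
  · refine ⟨qk, fun h0 : (qk : ℍ[ℝ]) = 0 => ?_, ?_⟩
    · simpa using congrArg (fun q : ℍ[ℝ] => q.imJ) h0
    change ((⟨0, 0, 1 / 2, 0⟩ : ℍ[ℝ]) + (⟨0, 0, 1 / 2, 0⟩ : ℍ[ℝ])) = qk * (1 : ℍ[ℝ]) ∧
      ((⟨0, 0, 0, -1 / 2⟩ : ℍ[ℝ]) + (⟨0, 0, 0, -1 / 2⟩ : ℍ[ℝ])) = qk * (qj * (1 : ℍ[ℝ]))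
    constructor <;> ext <;> simp <;> norm_num

theorem two_pre_false_of_left_R (S : SimpleBimod D D') (h : D = .R) (h' : D' ≠ .R) :
    S.preRe false + S.preRe false = S.gen ∧
      S.preIm false + S.preIm false = -(MulOpposite.op D'.iota • S.gen) := by
  cases S <;> simp at h h'
  · change (⟨1 / 2, 0⟩ + ⟨1 / 2, 0⟩ : ℂ) = 1 ∧
      (⟨0, -1 / 2⟩ + ⟨0, -1 / 2⟩ : ℂ) = -(1 * Complex.I)
    constructor <;> apply Complex.ext <;> simp <;> norm_num
  · change ((⟨1 / 2, 0, 0, 0⟩ : ℍ[ℝ]) + (⟨1 / 2, 0, 0, 0⟩ : ℍ[ℝ])) = 1 ∧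
      ((⟨0, -1 / 2, 0, 0⟩ : ℍ[ℝ]) + (⟨0, -1 / 2, 0, 0⟩ : ℍ[ℝ])) = -((1 : ℍ[ℝ]) * qj)
    constructor <;> ext <;> simp <;> norm_num

theorem two_pre_true_of_left_R (S : SimpleBimod D D') (h : D = .R) (h' : D' ≠ .R) :
    ∃ u : D'.carrier, u ≠ 0 ∧ S.preRe true + S.preRe true = MulOpposite.op u • S.gen ∧
      S.preIm true + S.preIm true = MulOpposite.op u • (MulOpposite.op D'.iota • S.gen) := by
  cases S <;> simp at h h'
  · refine ⟨1, one_ne_zero, ?_⟩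
    change (⟨1 / 2, 0⟩ + ⟨1 / 2, 0⟩ : ℂ) = 1 * 1 ∧
      (⟨0, 1 / 2⟩ + ⟨0, 1 / 2⟩ : ℂ) = (1 * Complex.I) * 1
    constructor <;> apply Complex.ext <;> simp <;> norm_num
  -- On the right the unit is `-𝐤`, because `(1 + 𝐣 ⊗ i)(-𝐤) = -𝐤 - 𝐥 ⊗ i`.
  · refine ⟨-qk, fun h0 : (-qk : ℍ[ℝ]) = 0 => ?_, ?_⟩
    · simpa using congrArg (fun q : ℍ[ℝ] => q.imJ) h0
    change ((⟨0, 0, -1 / 2, 0⟩ : ℍ[ℝ]) + (⟨0, 0, -1 / 2, 0⟩ : ℍ[ℝ])) = (1 : ℍ[ℝ]) * -qk ∧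
      ((⟨0, 0, 0, -1 / 2⟩ : ℍ[ℝ]) + (⟨0, 0, 0, -1 / 2⟩ : ℍ[ℝ])) = ((1 : ℍ[ℝ]) * qj) * -qk
    constructor <;> ext <;> simp <;> norm_num

theorem two_pre_false_of_right_H (S : SimpleBimod D D') (h' : D' = .H) :
    S.preRe false + S.preRe false = S.gen ∧
      S.preIm false + S.preIm false = -(MulOpposite.op D'.iota • S.gen) := by
  cases S <;> simp at h'
  · change ((⟨1 / 2, 0, 0, 0⟩ : ℍ[ℝ]) + (⟨1 / 2, 0, 0, 0⟩ : ℍ[ℝ])) = 1 ∧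
      ((⟨0, -1 / 2, 0, 0⟩ : ℍ[ℝ]) + (⟨0, -1 / 2, 0, 0⟩ : ℍ[ℝ])) = -((1 : ℍ[ℝ]) * qj)
    constructor <;> ext <;> simp <;> norm_num
  · change ((⟨1 / 2, 0, 0, 0⟩ : ℍ[ℝ]) + (⟨1 / 2, 0, 0, 0⟩ : ℍ[ℝ])) = 1 ∧
      ((⟨0, -1 / 2, 0, 0⟩ : ℍ[ℝ]) + (⟨0, -1 / 2, 0, 0⟩ : ℍ[ℝ])) = -((1 : ℍ[ℝ]) * qj)
    constructor <;> ext <;> simp <;> norm_num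
  · change (![⟨1 / 2, 0⟩, 0] + ![⟨1 / 2, 0⟩, 0] : Fin 2 → ℂ) = ![1, 0] ∧
      (![⟨0, -1 / 2⟩, 0] + ![⟨0, -1 / 2⟩, 0] : Fin 2 → ℂ) =
        -(Matrix.vecMul ![1, 0] (quatMatrix qj))
    constructor <;> ext i <;> fin_cases i <;>
      simp [quatMatrix, Matrix.vecMul, dotProduct, Complex.ext_iff] <;> norm_num

/-- Here `ᾱ` corresponds to `-g𝐤(1 - 𝐣 ⊗ i)`: the idempotent at the `ℍ`-vertex stays on the right,
and the second arrow is obtained by inserting `𝐤`. -/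
theorem two_pre_true_of_right_H (S : SimpleBimod D D') (h : D ≠ .H) (h' : D' = .H) :
    S.preRe true + S.preRe true = -(MulOpposite.op D'.kappa • S.gen) ∧
      S.preIm true + S.preIm true =
        MulOpposite.op D'.iota • (MulOpposite.op D'.kappa • S.gen) := by
  cases S <;> simp at h h'
  · change ((⟨0, 0, -1 / 2, 0⟩ : ℍ[ℝ]) + (⟨0, 0, -1 / 2, 0⟩ : ℍ[ℝ])) = -((1 : ℍ[ℝ]) * qk) ∧
      ((⟨0, 0, 0, -1 / 2⟩ : ℍ[ℝ]) + (⟨0, 0, 0, -1 / 2⟩ : ℍ[ℝ])) = ((1 : ℍ[ℝ]) * qk) * qj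
    constructor <;> ext <;> simp <;> norm_num
  · change (![0, ⟨-1 / 2, 0⟩] + ![0, ⟨-1 / 2, 0⟩] : Fin 2 → ℂ) =
        -(Matrix.vecMul ![1, 0] (quatMatrix qk)) ∧
      (![0, ⟨0, -1 / 2⟩] + ![0, ⟨0, -1 / 2⟩] : Fin 2 → ℂ) =
        Matrix.vecMul (Matrix.vecMul ![1, 0] (quatMatrix qk)) (quatMatrix qj)
    constructor <;> ext i <;> fin_cases i <;>
      simp [quatMatrix, Matrix.vecMul, dotProduct, Complex.ext_iff] <;> norm_num

theorem two_pre_false_of_left_H (S : SimpleBimod D D') (h : D = .H) :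
    S.preRe false + S.preRe false = S.gen ∧
      S.preIm false + S.preIm false = -(D.iota • S.gen) := by
  cases S <;> simp at h
  · change ((⟨1 / 2, 0, 0, 0⟩ : ℍ[ℝ]) + (⟨1 / 2, 0, 0, 0⟩ : ℍ[ℝ])) = 1 ∧
      ((⟨0, -1 / 2, 0, 0⟩ : ℍ[ℝ]) + (⟨0, -1 / 2, 0, 0⟩ : ℍ[ℝ])) = -(qj * (1 : ℍ[ℝ]))
    constructor <;> ext <;> simp <;> norm_num
  · change ((⟨1 / 2, 0, 0, 0⟩ : ℍ[ℝ]) + (⟨1 / 2, 0, 0, 0⟩ : ℍ[ℝ])) = 1 ∧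
      ((⟨0, -1 / 2, 0, 0⟩ : ℍ[ℝ]) + (⟨0, -1 / 2, 0, 0⟩ : ℍ[ℝ])) = -(qj * (1 : ℍ[ℝ]))
    constructor <;> ext <;> simp <;> norm_num
  · change (![⟨1 / 2, 0⟩, 0] + ![⟨1 / 2, 0⟩, 0] : Fin 2 → ℂ) = ![1, 0] ∧
      (![⟨0, -1 / 2⟩, 0] + ![⟨0, -1 / 2⟩, 0] : Fin 2 → ℂ) =
        -(Matrix.mulVec (quatMatrix qj) ![1, 0])
    constructor <;> ext i <;> fin_cases i <;>
      simp [quatMatrix, Matrix.mulVec, dotProduct, Complex.ext_iff] <;> norm_num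

theorem two_pre_true_of_left_H (S : SimpleBimod D D') (h : D = .H) (h' : D' ≠ .H) :
    S.preRe true + S.preRe true = D.kappa • S.gen ∧
      S.preIm true + S.preIm true = -(D.iota • (D.kappa • S.gen)) := by
  cases S <;> simp at h h'
  · change ((⟨0, 0, 1 / 2, 0⟩ : ℍ[ℝ]) + (⟨0, 0, 1 / 2, 0⟩ : ℍ[ℝ])) = qk * (1 : ℍ[ℝ]) ∧
      ((⟨0, 0, 0, -1 / 2⟩ : ℍ[ℝ]) + (⟨0, 0, 0, -1 / 2⟩ : ℍ[ℝ])) = -(qj * (qk * (1 : ℍ[ℝ])))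
    constructor <;> ext <;> simp <;> norm_num
  · change (![0, ⟨-1 / 2, 0⟩] + ![0, ⟨-1 / 2, 0⟩] : Fin 2 → ℂ) =
        Matrix.mulVec (quatMatrix qk) ![1, 0] ∧
      (![0, ⟨0, -1 / 2⟩] + ![0, ⟨0, -1 / 2⟩] : Fin 2 → ℂ) =
        -Matrix.mulVec (quatMatrix qj) (Matrix.mulVec (quatMatrix qk) ![1, 0])
    constructor <;> ext i <;> fin_cases i <;>
      simp [quatMatrix, Matrix.mulVec, dotProduct, Complex.ext_iff] <;> norm_num

/-! ### Commutation of the generators with the units -/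

/-- For columns and rows this is because `𝐣` is the diagonal matrix with first entry `𝐢`, so it acts
on `ε₁` as `𝐢` does. -/
theorem iota_smul_gen (S : SimpleBimod D D') (h : D ≠ .R) (h' : D' ≠ .R)
    (hH : D = .H ∨ D' = .H) : D.iota • S.gen = MulOpposite.op D'.iota • S.gen := by
  cases S <;> simp at h h' hH
  · change qj * 1 = 1 * qj
    simp
  · change Matrix.mulVec (quatMatrix qj) ![1, 0] = MulOpposite.op Complex.I • (![1, 0] : Fin 2 → ℂ)
    ext i; fin_cases i <;>
      simp [quatMatrix, Matrix.mulVec, dotProduct, Complex.ext_iff]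
  · change Complex.I • (![1, 0] : Fin 2 → ℂ) = Matrix.vecMul ![1, 0] (quatMatrix qj)
    ext i; fin_cases i <;>
      simp [quatMatrix, Matrix.vecMul, dotProduct, Complex.ext_iff]

theorem kappa_smul_gen (S : SimpleBimod D D') (h : D = .H) (h' : D' = .H) :
    D.kappa • S.gen = MulOpposite.op D'.kappa • S.gen := by
  cases S <;> simp at h h'
  change qk * 1 = 1 * qk
  simp

/-! ### The named elements in terms of the generators -/

theorem elt_o (S : SimpleBimod D D') (h : (D = .R ∨ D' = .R) ∨ (D = .H ∧ D' = .H)) :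
    S.elt .o = S.gen := by
  cases S <;> simp at h <;> rfl

theorem elt_e₁ (S : SimpleBimod D D') (h : (D = .H ∧ D' = .C) ∨ (D = .C ∧ D' = .H)) :
    S.elt .e₁ = S.gen := by
  cases S <;> simp at h <;> rfl

theorem elt_i_left (S : SimpleBimod D D') (h : D = .C) (h' : D' = .R) :
    S.elt .i = D.iota • S.gen := by
  cases S <;> simp at h h'
  exact (mul_one Complex.I).symm

theorem elt_i_right (S : SimpleBimod D D') (h : D = .R) (h' : D' = .C) :
    S.elt .i = MulOpposite.op D'.iota • S.gen := by
  cases S <;> simp at h h'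
  exact (one_mul Complex.I).symm

theorem elt_j_left (S : SimpleBimod D D') (h : D = .H) (h' : D' ≠ .C) :
    S.elt .j = D.iota • S.gen := by
  cases S <;> simp at h h' <;> exact (mul_one qj).symm

theorem elt_k_left (S : SimpleBimod D D') (h : D = .H) (h' : D' ≠ .C) :
    S.elt .k = D.kappa • S.gen := by
  cases S <;> simp at h h' <;> exact (mul_one qk).symm

theorem elt_l_left (S : SimpleBimod D D') (h : D = .H) (h' : D' ≠ .C) :
    S.elt .l = D.iota • (D.kappa • S.gen) := by
  cases S <;> simp at h h' <;>
  · change ql = qj * (qk * 1)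
    rw [mul_one, qj_mul_qk]

theorem elt_j_right (S : SimpleBimod D D') (h : D ≠ .C) (h' : D' = .H) :
    S.elt .j = MulOpposite.op D'.iota • S.gen := by
  cases S <;> simp at h h' <;> exact (one_mul qj).symm

theorem elt_k_right (S : SimpleBimod D D') (h : D ≠ .C) (h' : D' = .H) :
    S.elt .k = MulOpposite.op D'.kappa • S.gen := by
  cases S <;> simp at h h' <;> exact (one_mul qk).symm

theorem elt_l_right (S : SimpleBimod D D') (h : D ≠ .C) (h' : D' = .H) :
    S.elt .l = MulOpposite.op D'.kappa • (MulOpposite.op D'.iota • S.gen) := by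
  cases S <;> simp at h h' <;>
  · change ql = (1 * qj) * qk
    rw [one_mul, qj_mul_qk]

theorem elt_e₂_left (S : SimpleBimod D D') (h : D = .H) (h' : D' = .C) :
    S.elt .e₂ = -(D.kappa • S.gen) := by
  cases S <;> simp at h h'
  change ![0, 1] = -Matrix.mulVec (quatMatrix qk) ![1, 0]
  ext i; fin_cases i <;>
    simp [quatMatrix, Matrix.mulVec, dotProduct, Complex.ext_iff]

/-! ### Simplicity -/

theorem preRe_ne_zero (S : SimpleBimod D D') (b : Bool) : S.preRe b ≠ 0 := by
  have hR : (1 : ℝ) ≠ 0 := one_ne_zero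
  have hC : (⟨1 / 2, 0⟩ : ℂ) ≠ 0 := fun h => by simpa using congrArg Complex.re h
  have hH : (⟨1 / 2, 0, 0, 0⟩ : ℍ[ℝ]) ≠ 0 := fun h => by
    simpa using congrArg (fun q : ℍ[ℝ] => q.re) h
  have hH1 : (⟨0, 0, -1 / 2, 0⟩ : ℍ[ℝ]) ≠ 0 := fun h => by
    simpa using congrArg (fun q : ℍ[ℝ] => q.imJ) h
  have hH2 : (⟨0, 0, 1 / 2, 0⟩ : ℍ[ℝ]) ≠ 0 := fun h => by
    simpa using congrArg (fun q : ℍ[ℝ] => q.imJ) h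
  have hF0 : (![⟨1 / 2, 0⟩, 0] : Fin 2 → ℂ) ≠ 0 := fun h => by
    simpa using congrArg Complex.re (congrFun h 0)
  have hF1 : (![0, ⟨-1 / 2, 0⟩] : Fin 2 → ℂ) ≠ 0 := fun h => by
    simpa using congrArg Complex.re (congrFun h 1)
  cases S <;> cases b <;> assumption

/-- One of the two actions already suffices, since every bimodule in the list is one-dimensional
over a division ring acting from one side. For columns and rows that ring is `ℍ`, and the bimodule
is the orbit of `ε₁`. -/
theorem exists_smul_eq (S : SimpleBimod D D') {p : S.carrier} (hp : p ≠ 0) (x : S.carrier) :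
    ∃ (a : D.carrier) (b : D'.carrier), x = a • (MulOpposite.op b • p) := by
  suffices h : (∃ a : D.carrier, x = a • p) ∨ ∃ b : D'.carrier, x = MulOpposite.op b • p by
    rcases h with ⟨a, h⟩ | ⟨b, h⟩
    · exact ⟨a, 1, by rw [MulOpposite.op_one, one_smul]; exact h⟩
    · exact ⟨1, b, by rw [one_smul]; exact h⟩
  have hl : ∀ {K : Type} [DivisionRing K] {p : K}, p ≠ 0 → ∀ x : K, ∃ a, x = a * p :=
    fun hp x => ⟨x * _⁻¹, (inv_mul_cancel_right₀ hp x).symm⟩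
  have hr : ∀ {K : Type} [DivisionRing K] {p : K}, p ≠ 0 → ∀ x : K, ∃ b, x = p * b :=
    fun hp x => ⟨_⁻¹ * x, (mul_inv_cancel_left₀ hp x).symm⟩
  cases S
  · exact Or.inl (hl (K := ℝ) hp x)
  · exact Or.inl (hl (K := ℍ[ℝ]) hp x)
  · exact Or.inr (hr (K := ℂ) hp x)
  · exact Or.inl (hl (K := ℂ) hp x)
  · exact Or.inr (hr (K := ℍ[ℝ]) hp x)
  · exact Or.inl (hl (K := ℍ[ℝ]) hp x)
  · left
    have col : ∀ y : HC.carrier, ∃ q : DivRing.H.carrier, y = q • HC.gen := by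
      intro (y : Fin 2 → ℂ)
      -- The quaternion is read off from the first column `(a, -b̄)` of its matrix, hence the sign
      -- at `(y 1).re`.
      refine ⟨(⟨(y 0).re, (y 0).im, -(y 1).re, (y 1).im⟩ : ℍ[ℝ]), ?_⟩
      change y = (quatMatrix _).mulVec ![1, 0]
      ext i; fin_cases i <;> simp [quatMatrix, Complex.ext_iff]
    obtain ⟨q, rfl⟩ := col p
    obtain ⟨r, rfl⟩ := col x
    have hq : q ≠ 0 := by rintro rfl; exact hp (zero_smul _ _)
    exact ⟨r * q⁻¹, by rw [← mul_smul, inv_mul_cancel_right₀ hq]⟩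
  · right
    have row : ∀ y : CH.carrier, ∃ q : DivRing.H.carrier, y = MulOpposite.op q • CH.gen := by
      intro (y : Fin 2 → ℂ)
      -- The quaternion is read off from the first row `(a, b)` of its matrix.
      refine ⟨(⟨(y 0).re, (y 0).im, (y 1).re, (y 1).im⟩ : ℍ[ℝ]), ?_⟩
      change y = Matrix.vecMul ![1, 0]
        (quatMatrix (⟨(y 0).re, (y 0).im, (y 1).re, (y 1).im⟩ : ℍ[ℝ]))
      ext i; fin_cases i <;> simp [quatMatrix, Complex.ext_iff]
    obtain ⟨q, rfl⟩ := row p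
    obtain ⟨r, rfl⟩ := row x
    have hq : q ≠ 0 := by rintro rfl; exact hp (zero_smul _ _)
    exact ⟨q⁻¹ * r, by rw [← mul_smul, ← MulOpposite.op_mul, mul_inv_cancel_left₀ hq]⟩
  · exact Or.inl (hl (K := ℂ) hp x)
  · exact Or.inl (hl (K := ℂ) hp x)

end SimpleBimod
/-! ## Ordinarily gentle vertices -/

namespace SimpleBimod

variable {D D' : DivRing}

/-- The preimage of an arrow is fixed by that of its starting vertex, which is `(1 - 𝐢 ⊗ i)/2` for
`i` and `(1 + 𝐢 ⊗ i)/2` for `ī`. So the sign depends only on the vertex of `Γ` and not on the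
bimodule, which is why two arrows that meet share it. -/
theorem preIm_eq_of_right_C (S : SimpleBimod D D') (h : D' = .C) (b : Bool) :
    S.preIm b = MulOpposite.op (if S.srcBar b then D'.iota else -D'.iota) • S.preRe b := by
  cases S <;> simp at h <;> cases b
  · change (⟨0, -1 / 2⟩ : ℂ) = ⟨1 / 2, 0⟩ * -Complex.I
    apply Complex.ext <;> simp <;> norm_num
  · change (⟨0, 1 / 2⟩ : ℂ) = ⟨1 / 2, 0⟩ * Complex.I
    apply Complex.ext <;> simp
  · change (![⟨0, -1 / 2⟩, 0] : Fin 2 → ℂ) = MulOpposite.op (-Complex.I) • ![⟨1 / 2, 0⟩, 0]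
    ext i; fin_cases i <;> simp [Complex.ext_iff]; norm_num
  · change (![0, ⟨0, -1 / 2⟩] : Fin 2 → ℂ) = MulOpposite.op Complex.I • ![0, ⟨-1 / 2, 0⟩]
    ext i; fin_cases i <;> simp [Complex.ext_iff]
  · change (⟨0, -1 / 2⟩ : ℂ) = ⟨1 / 2, 0⟩ * -Complex.I
    apply Complex.ext <;> simp <;> norm_num
  · change (⟨0, 1 / 2⟩ : ℂ) = ⟨1 / 2, 0⟩ * Complex.I
    apply Complex.ext <;> simp
  · change (⟨0, -1 / 2⟩ : ℂ) = ⟨1 / 2, 0⟩ * (starRingEnd ℂ) Complex.I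
    apply Complex.ext <;> simp <;> norm_num
  · change (⟨0, 1 / 2⟩ : ℂ) = ⟨1 / 2, 0⟩ * (starRingEnd ℂ) (-Complex.I)
    apply Complex.ext <;> simp

theorem preIm_eq_of_left_C (S : SimpleBimod D D') (h : D = .C) (b : Bool) :
    S.preIm b = (if S.tgtBar b then D.iota else -D.iota) • S.preRe b := by
  cases S <;> simp at h <;> cases b
  · change (⟨0, -1 / 2⟩ : ℂ) = -Complex.I * ⟨1 / 2, 0⟩
    apply Complex.ext <;> simp <;> norm_num
  · change (⟨0, 1 / 2⟩ : ℂ) = Complex.I * ⟨1 / 2, 0⟩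
    apply Complex.ext <;> simp
  · change (![⟨0, -1 / 2⟩, 0] : Fin 2 → ℂ) = (-Complex.I) • ![⟨1 / 2, 0⟩, 0]
    ext i; fin_cases i <;> simp [Complex.ext_iff]; norm_num
  · change (![0, ⟨0, -1 / 2⟩] : Fin 2 → ℂ) = Complex.I • ![0, ⟨-1 / 2, 0⟩]
    ext i; fin_cases i <;> simp [Complex.ext_iff]
  all_goals first
  | change (⟨0, -1 / 2⟩ : ℂ) = -Complex.I * ⟨1 / 2, 0⟩
    apply Complex.ext <;> simp <;> norm_num; done
  | change (⟨0, 1 / 2⟩ : ℂ) = Complex.I * ⟨1 / 2, 0⟩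
    apply Complex.ext <;> simp

theorem srcBar_injective (S : SimpleBimod D D') (h : D' = .C) : Function.Injective S.srcBar := by
  cases S <;> simp at h <;> intro b b' <;> simp [srcBar]

theorem tgtBar_injective (S : SimpleBimod D D') (h : D = .C) : Function.Injective S.tgtBar := by
  cases S <;> simp at h <;> intro b b' <;> simp [tgtBar]

theorem hasBar_eq_false (S : SimpleBimod D D') (h : D = D') (hC : D ≠ .C) :
    S.hasBar = false := by
  cases S <;> simp at h hC <;> rfl

/-- The element in question is the real number `1/2` in `ℍ`, which is central, so a scalar on the
right can be moved to the left. -/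
theorem op_smul_preRe_of_H (S : SimpleBimod D D') (h : D = .H) (h' : D' = .H)
    (c : D'.carrier) : ∃ c' : D.carrier,
      ∀ b, MulOpposite.op c • S.preRe b = c' • S.preRe b := by
  cases S <;> simp at h h'
  have key : ∀ q r : ℍ[ℝ], r.imI = 0 → r.imJ = 0 → r.imK = 0 → r * q = q * r := by
    intro q r hI hJ hK
    ext <;> simp [hI, hJ, hK] <;> ring
  exact ⟨c, fun _ => key c _ rfl rfl rfl⟩

end SimpleBimod

/-! ### Membership of products of arrows in `J` and inclusion of `𝓜(αβ)` in `I` -/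

namespace ModulatedQuiver

variable {V E : Type*} (Q : ModulatedQuiver V E) [DecidableEq V] [DecidableEq E]

theorem neg_mul_tensorAlg (x y : Q.TensorAlg) : -x * y = -(x * y) := neg_mul x y

theorem mul_neg_tensorAlg (x y : Q.TensorAlg) : x * -y = -(x * y) := mul_neg x y

theorem pathSpace_le_iff {I : TwoSidedIdeal Q.TensorAlg} {α β : E} :
    Q.pathSpace α β ≤ Q.idealSpace I ↔ ∀ x y, Q.arr α x * Q.arr β y ∈ I := by
  rw [pathSpace, Submodule.span_le]
  constructor
  · exact fun h x y => h ⟨x, y, rfl⟩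
  · rintro h _ ⟨x, y, rfl⟩
    exact h x y

theorem vert_real_smul (i : V) (r : ℝ) (a : (Q.D i).carrier) :
    Q.vert i (r • a) = r • Q.vert i a := by
  rw [vert, vert, ← map_smul, ← Pi.single_smul]

theorem vert_one_mul_arr (α : E) (x : (Q.M α).carrier) :
    Q.vert (Q.t α) 1 * Q.arr α x = Q.arr α x := by
  rw [vert_mul_arr, one_smul]

theorem arr_mul_vert_one (α : E) (x : (Q.M α).carrier) :
    Q.arr α x * Q.vert (Q.s α) 1 = Q.arr α x := by
  rw [arr_mul_vert, MulOpposite.op_one, one_smul]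

theorem vert_neg (i : V) (a : (Q.D i).carrier) : Q.vert i (-a) = -Q.vert i a := by
  rw [← zero_sub, vert_sub, vert_zero, zero_sub]

theorem arr_neg (α : E) (x : (Q.M α).carrier) : Q.arr α (-x) = -Q.arr α x := by
  rw [arr, arr, map_neg, map_neg]

theorem arr_zero (α : E) : Q.arr α 0 = 0 := by
  rw [arr, map_zero, map_zero]

/-- The tensors `p c ⊗ q`, for a fixed pair of nonzero elements, generate `𝓜(α) ⊗ 𝓜(β)`. -/
theorem pathSpace_le_of_forall {I : TwoSidedIdeal Q.TensorAlg} {α β : E} (hαβ : Q.s α = Q.t β)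
    {p : (Q.M α).carrier} {q : (Q.M β).carrier} (hp : p ≠ 0) (hq : q ≠ 0)
    (h : ∀ c, Q.arr α p * Q.vert (Q.s α) c * Q.arr β q ∈ I) :
    Q.pathSpace α β ≤ Q.idealSpace I := by
  rw [pathSpace_le_iff]
  intro x y
  obtain ⟨a, b, rfl⟩ := (Q.M α).exists_smul_eq hp x
  obtain ⟨a', b', rfl⟩ := (Q.M β).exists_smul_eq hq y
  rw [← vert_mul_arr, ← vert_mul_arr, ← arr_mul_vert, ← arr_mul_vert]
  -- The two inner scalars live at the same vertex and merge into one scalar `c`; the two outer ones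
  -- are absorbed by the ideal.
  have key : ∃ c, Q.vert (Q.s α) b * Q.vert (Q.t β) a' = Q.vert (Q.s α) c := by
    revert a'
    rw [← hαβ]
    exact fun a' => ⟨_, Q.vert_mul _ _ _⟩
  obtain ⟨c, hc⟩ := key
  have : Q.vert (Q.t α) a * (Q.arr α p * Q.vert (Q.s α) b) *
      (Q.vert (Q.t β) a' * (Q.arr β q * Q.vert (Q.s β) b')) =
      Q.vert (Q.t α) a * (Q.arr α p * Q.vert (Q.s α) c * Q.arr β q) * Q.vert (Q.s β) b' := by
    rw [← hc]; noncomm_ring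
  rw [this]
  exact I.mul_mem_right _ _ (I.mul_mem_left _ _ (h c))

theorem mem_of_add_self_mem {I : TwoSidedIdeal Q.TensorAlg} {x : Q.TensorAlg} (h : x + x ∈ I) :
    x ∈ I := by
  have h' : (2⁻¹ : ℝ) • (x + x) ∈ Q.idealSpace I := Submodule.smul_mem _ _ h
  rwa [← two_smul ℝ x, smul_smul, inv_mul_cancel₀ two_ne_zero, one_smul] at h'

theorem preArrow_mul_mem_of_pathSpace_le {I : TwoSidedIdeal Q.TensorAlg} {a b : Q.CArrow}
    (h : Q.pathSpace a.1.1 b.1.1 ≤ Q.idealSpace I) : Q.preArrow a * Q.preArrow b ∈ Q.idealC I := by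
  rw [pathSpace_le_iff] at h
  rw [preArrow, preArrow, cx_mul, cx_mem_idealC]
  exact ⟨I.sub_mem (h _ _) (h _ _), I.add_mem (h _ _) (h _ _)⟩

/-- The factors have the form `P(1 + κ ⊗ i)` and `(1 + κ ⊗ i)P'` with the same `κ = ±𝐢`, because the
arrows meet at one vertex of `Γ`. Their product is `2(PP' + PκP' ⊗ i)`, and `1`, `κ` span `ℂ` over
`ℝ`. -/
theorem pathSpace_le_of_preArrow_mul_mem_C {I : TwoSidedIdeal Q.TensorAlg} {a b : Q.CArrow}
    (hab : Q.complexified.s a = Q.complexified.t b) (hC : Q.D (Q.s a.1.1) = .C)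
    (h : Q.preArrow a * Q.preArrow b ∈ Q.idealC I) :
    Q.pathSpace a.1.1 b.1.1 ≤ Q.idealSpace I := by
  obtain ⟨⟨α, ba⟩, ha⟩ := a
  obtain ⟨⟨β, bb⟩, hb⟩ := b
  have hs : Q.s α = Q.t β := congrArg (fun x => x.1.1) hab
  have hbar : (Q.M α).srcBar ba = (Q.M β).tgtBar bb := congrArg (fun x => x.1.2) hab
  rw [preArrow, preArrow, cx_mul, cx_mem_idealC] at h
  simp only at h hC ⊢
  refine Q.pathSpace_le_of_forall hs ((Q.M α).preRe_ne_zero ba) ((Q.M β).preRe_ne_zero bb) ?_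
  -- Both imaginary parts are expressed by the real parts and `κ`; the equality `hbar` makes the two
  -- signs agree.
  rw [(Q.M α).preIm_eq_of_right_C hC, (Q.M β).preIm_eq_of_left_C (hs ▸ hC), ← hbar,
    ← arr_mul_vert, ← vert_mul_arr] at h
  generalize Q.arr α ((Q.M α).preRe ba) = P at h ⊢
  have hP' : Q.vert (Q.t β) 1 * Q.arr β ((Q.M β).preRe bb) = _ := Q.vert_one_mul_arr _ _
  generalize Q.arr β ((Q.M β).preRe bb) = P' at h hP' ⊢
  generalize (Q.M α).srcBar ba = c at h
  rw [← hs] at h hP'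
  generalize Q.s α = v at h hC hP' ⊢
  have hκ : (if c then (Q.D v).iota else -(Q.D v).iota) *
      (if c then (Q.D v).iota else -(Q.D v).iota) = -1 := by
    split_ifs
    · exact DivRing.iota_mul_iota (by simp [hC])
    · rw [neg_mul_neg]; exact DivRing.iota_mul_iota (by simp [hC])
  have hspan : ∀ z : (Q.D v).carrier, ∃ r s : ℝ,
      z = r • 1 + s • (if c then (Q.D v).iota else -(Q.D v).iota) := by
    rw [hC]
    intro (z : ℂ)
    cases c
    -- In this case `κ = -𝐢`, so the second coordinate changes its sign.
    · refine ⟨z.re, -z.im, ?_⟩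
      change z = z.re • (1 : ℂ) + (-z.im) • (-Complex.I)
      apply Complex.ext <;> simp
    · refine ⟨z.re, z.im, ?_⟩
      change z = z.re • (1 : ℂ) + z.im • Complex.I
      apply Complex.ext <;> simp
  generalize (if c then (Q.D v).iota else -(Q.D v).iota) = κ at h hκ hspan
  have h1 : P * P' ∈ I := by
    have h2 := h.1
    rw [← mul_assoc, mul_assoc P, vert_mul, hκ, vert_neg, mul_neg_tensorAlg, neg_mul_tensorAlg, mul_assoc, hP',
      sub_neg_eq_add] at h2
    exact Q.mem_of_add_self_mem h2
  have h2 : P * Q.vert v κ * P' ∈ I := by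
    have h2 := h.2
    rw [← mul_assoc] at h2
    exact Q.mem_of_add_self_mem h2
  intro z
  obtain ⟨r, s, rfl⟩ := hspan z
  rw [vert_add, vert_real_smul, vert_real_smul, mul_add, add_mul, mul_smul_comm, mul_smul_comm,
    smul_mul_assoc, smul_mul_assoc, mul_assoc, hP']
  exact (Q.idealSpace I).add_mem ((Q.idealSpace I).smul_mem _ h1) ((Q.idealSpace I).smul_mem _ h2)

/-- The left factor has no imaginary part, so the real component of the product is the single tensor
needed; scalars at the middle vertex are real. -/
theorem pathSpace_le_of_preArrow_mul_mem_R {I : TwoSidedIdeal Q.TensorAlg} {a b : Q.CArrow}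
    (hab : Q.s a.1.1 = Q.t b.1.1) (hs : Q.D (Q.s a.1.1) = .R) (ht : Q.D (Q.t a.1.1) = .R)
    (h : Q.preArrow a * Q.preArrow b ∈ Q.idealC I) :
    Q.pathSpace a.1.1 b.1.1 ≤ Q.idealSpace I := by
  obtain ⟨⟨α, ba⟩, ha⟩ := a
  obtain ⟨⟨β, bb⟩, hb⟩ := b
  rw [preArrow, preArrow, cx_mul, cx_mem_idealC] at h
  simp only at h hab hs ht ⊢
  rw [((Q.M α).pre_of_eq_R ht hs ba).2, arr_zero, zero_mul, sub_zero] at h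
  refine Q.pathSpace_le_of_forall hab ((Q.M α).preRe_ne_zero ba) ((Q.M β).preRe_ne_zero bb) ?_
  have hspan : ∀ z : (Q.D (Q.s α)).carrier, ∃ r : ℝ, z = r • 1 := by
    rw [hs]
    exact fun (z : ℝ) => ⟨z, (mul_one z).symm⟩
  intro z
  obtain ⟨r, rfl⟩ := hspan z
  rw [vert_real_smul, mul_smul_comm, smul_mul_assoc, arr_mul_vert_one]
  exact (Q.idealSpace I).smul_mem _ h.1

/-- With `G`, `G'` the generators, the real component of `G(1 - 𝐣 ⊗ i)(1 - 𝐣 ⊗ i)G'` is `2GG'`. A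
middle scalar can be moved across `G`, as `G` comes from `1 ∈ ℍ`. -/
theorem pathSpace_le_of_preArrow_mul_mem_H {I : TwoSidedIdeal Q.TensorAlg} {a b : Q.CArrow}
    (hab : Q.s a.1.1 = Q.t b.1.1) (hs : Q.D (Q.s a.1.1) = .H) (ht : Q.D (Q.t a.1.1) = .H)
    (hs' : Q.D (Q.s b.1.1) = .H) (h : Q.preArrow a * Q.preArrow b ∈ Q.idealC I) :
    Q.pathSpace a.1.1 b.1.1 ≤ Q.idealSpace I := by
  obtain ⟨⟨α, ba⟩, ha⟩ := a
  obtain ⟨⟨β, bb⟩, hb⟩ := b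
  simp only at h hab hs ht hs' ⊢
  have hba : ba = false := by
    by_contra hne
    have := (Q.M α).hasBar_eq_false (ht.trans hs.symm) (by simp [ht])
    simp_all
  have hbb : bb = false := by
    by_contra hne
    have := (Q.M β).hasBar_eq_false ((hab ▸ hs).trans hs'.symm) (by simp [← hab, hs])
    simp_all
  subst hba hbb
  -- Doubling both factors clears the denominators and makes the formulas in the generators
  -- applicable.
  have h4 : (Q.preArrow ⟨(α, false), ha⟩ + Q.preArrow ⟨(α, false), ha⟩) *
      (Q.preArrow ⟨(β, false), hb⟩ + Q.preArrow ⟨(β, false), hb⟩) ∈ Q.idealC I := by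
    simp only [add_mul, mul_add]
    exact Submodule.add_mem _ (Submodule.add_mem _ h h) (Submodule.add_mem _ h h)
  refine Q.pathSpace_le_of_forall hab ((Q.M α).preRe_ne_zero false)
    ((Q.M β).preRe_ne_zero false) ?_
  have hι : Q.vert (Q.t β) (Q.D (Q.t β)).iota = Q.vert (Q.s α) (Q.D (Q.s α)).iota :=
    congrArg (fun i => Q.vert i (Q.D i).iota) hab.symm
  simp only [preArrow, cx_add, cx_mul, cx_mem_idealC, ← arr_add] at h4
  rw [((Q.M α).two_pre_false_of_right_H hs).2, ((Q.M β).two_pre_false_of_left_H (hab ▸ hs)).2,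
    arr_neg, arr_neg, ← arr_mul_vert, ← vert_mul_arr, neg_mul_tensorAlg,
    mul_neg_tensorAlg, neg_neg, ← mul_assoc,
    ← ((Q.M α).two_pre_false_of_right_H hs).1, ← ((Q.M β).two_pre_false_of_left_H (hab ▸ hs)).1,
    hι, mul_assoc _ (Q.vert _ _) (Q.vert _ _), vert_mul,
    DivRing.iota_mul_iota (by simp [hs]), vert_neg, mul_neg_tensorAlg, neg_mul_tensorAlg,
    arr_mul_vert_one,
    sub_neg_eq_add] at h4
  have h1 := Q.mem_of_add_self_mem h4.1
  simp only [arr_add, add_mul, mul_add] at h1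
  have h2 := Q.mem_of_add_self_mem (Q.mem_of_add_self_mem h1)
  intro c
  -- The middle scalar becomes an outer one, which the ideal absorbs.
  obtain ⟨c', hc'⟩ := (Q.M α).op_smul_preRe_of_H ht hs c
  rw [arr_mul_vert, hc', ← vert_mul_arr, mul_assoc]
  exact I.mul_mem_left _ _ h2

variable [Fintype V] [Fintype E]

theorem arrow_mul_arrow_mem_iff {I : TwoSidedIdeal Q.TensorAlg} {a b : Q.CArrow} :
    Q.complexified.arrow ℂ a * Q.complexified.arrow ℂ b ∈ Q.complexifiedIdeal I ↔
      Q.preArrow a * Q.preArrow b ∈ Q.idealC I := by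
  rw [mem_complexifiedIdeal_iff, psiInvLin_mul, psiInvLin_arrow, psiInvLin_arrow]

theorem mem_outArrows_of_complexified {x : Q.CVertex} {a : Q.CArrow}
    (h : a ∈ Q.complexified.outArrows x) : a.1.1 ∈ Q.outArrows x.1.1 := by
  simp only [ArrowQuiver.outArrows, Finset.mem_filter, Finset.mem_univ, true_and] at h ⊢
  exact congrArg (fun x => x.1.1) h

theorem mem_inArrows_of_complexified {x : Q.CVertex} {a : Q.CArrow}
    (h : a ∈ Q.complexified.inArrows x) : a.1.1 ∈ Q.inArrows x.1.1 := by
  simp only [ArrowQuiver.inArrows, Finset.mem_filter, Finset.mem_univ, true_and] at h ⊢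
  exact congrArg (fun x => x.1.1) h

/-- If forgetting bars is injective on `x⁺` and on `x⁻`, and a product of arrows lies in `J` only
for the reason that `I` includes the whole of `𝓜(αβ)`, then (G1) and (G2) pass from `Q` to `Γ` word
for word. -/
theorem isGentleVertex_of_ordinaryCond {I : TwoSidedIdeal Q.TensorAlg} {x : Q.CVertex}
    (h : Q.OrdinaryCond I x.1.1)
    (hout : Set.InjOn (fun a : Q.CArrow => a.1.1) (Q.complexified.outArrows x))
    (hin : Set.InjOn (fun a : Q.CArrow => a.1.1) (Q.complexified.inArrows x))
    (hmem : ∀ a ∈ Q.complexified.outArrows x, ∀ b ∈ Q.complexified.inArrows x,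
      Q.preArrow a * Q.preArrow b ∈ Q.idealC I → Q.pathSpace a.1.1 b.1.1 ≤ Q.idealSpace I) :
    Q.complexified.IsGentleVertex (Q.complexifiedIdeal I) x := by
  have hiff : ∀ a ∈ Q.complexified.outArrows x, ∀ b ∈ Q.complexified.inArrows x,
      (Q.complexified.arrow ℂ a * Q.complexified.arrow ℂ b ∈ Q.complexifiedIdeal I ↔
        Q.pathSpace a.1.1 b.1.1 ≤ Q.idealSpace I) := fun a ha b hb =>
    Q.arrow_mul_arrow_mem_iff.trans ⟨hmem a ha b hb, Q.preArrow_mul_mem_of_pathSpace_le⟩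
  refine ⟨?_, ?_, ?_, ?_⟩
  · exact (Finset.card_le_card_of_injOn _ (fun a ha => Q.mem_outArrows_of_complexified ha)
      hout).trans h.card_out
  · exact (Finset.card_le_card_of_injOn _ (fun a ha => Q.mem_inArrows_of_complexified ha)
      hin).trans h.card_in
  · intro a ha b hb c hc hbc
    rw [hiff a ha b hb, hiff a ha c hc]
    exact h.xor_in _ (Q.mem_outArrows_of_complexified ha) _ (Q.mem_inArrows_of_complexified hb) _
      (Q.mem_inArrows_of_complexified hc) fun h' => hbc (hin hb hc h')
  · intro a ha b hb c hc hbc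
    rw [hiff b hb a ha, hiff c hc a ha]
    exact h.xor_out _ (Q.mem_inArrows_of_complexified ha) _ (Q.mem_outArrows_of_complexified hb) _
      (Q.mem_outArrows_of_complexified hc) fun h' => hbc (hout hb hc h')

theorem s_eq_of_mem_outArrows {v : V} {α : E} (h : α ∈ Q.outArrows v) : Q.s α = v := by
  simpa [ArrowQuiver.outArrows] using h

theorem t_eq_of_mem_inArrows {v : V} {α : E} (h : α ∈ Q.inArrows v) : Q.t α = v := by
  simpa [ArrowQuiver.inArrows] using h

theorem injOn_fst_of_hasBar {s : Set Q.CArrow} (h : ∀ a ∈ s, (Q.M a.1.1).hasBar = false) :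
    Set.InjOn (fun a : Q.CArrow => a.1.1) s := by
  have hf : ∀ a ∈ s, a.1.2 = false := fun a ha => by
    have := a.2
    rw [h a ha] at this
    simpa using this
  intro a ha b hb hab
  exact Subtype.ext (Prod.ext hab ((hf a ha).trans (hf b hb).symm))

theorem isGentleVertex_of_isOrdinarilyGentle {I : TwoSidedIdeal Q.TensorAlg} {x : Q.CVertex}
    (h : Q.IsOrdinarilyGentle I x.1.1) :
    Q.complexified.IsGentleVertex (Q.complexifiedIdeal I) x := by
  obtain ⟨hord, hD⟩ := h
  have hs : ∀ {a}, a ∈ Q.complexified.outArrows x → Q.s a.1.1 = x.1.1 := fun ha =>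
    Q.s_eq_of_mem_outArrows (Q.mem_outArrows_of_complexified ha)
  have ht : ∀ {a}, a ∈ Q.complexified.inArrows x → Q.t a.1.1 = x.1.1 := fun ha =>
    Q.t_eq_of_mem_inArrows (Q.mem_inArrows_of_complexified ha)
  -- If all modulations around `v` agree and are not `ℂ`, then every arrow at `v` gives just one
  -- arrow of `Γ`.
  have same : ∀ D : DivRing, D ≠ .C → Q.D x.1.1 = D → (∀ u ∈ Q.neighbors x.1.1, Q.D u = D) →
      (∀ a ∈ Q.complexified.outArrows x, Q.D (Q.t a.1.1) = D ∧ (Q.M a.1.1).hasBar = false) ∧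
      (∀ a ∈ Q.complexified.inArrows x, Q.D (Q.s a.1.1) = D ∧ (Q.M a.1.1).hasBar = false) := by
    intro D hC hx hN
    refine ⟨fun a ha => ?_, fun a ha => ?_⟩
    · have h1 : Q.D (Q.t a.1.1) = D := hN _ (Finset.mem_union_left _
        (Finset.mem_image_of_mem _ (Q.mem_outArrows_of_complexified ha)))
      exact ⟨h1, (Q.M a.1.1).hasBar_eq_false (h1.trans ((congrArg Q.D (hs ha)).trans hx).symm)
        (h1 ▸ hC)⟩
    · have h1 : Q.D (Q.s a.1.1) = D := hN _ (Finset.mem_union_right _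
        (Finset.mem_image_of_mem _ (Q.mem_inArrows_of_complexified ha)))
      have h2 := (congrArg Q.D (ht ha)).trans hx
      exact ⟨h1, (Q.M a.1.1).hasBar_eq_false (h2.trans h1.symm) (h2 ▸ hC)⟩
  rcases hD with ⟨hx, hN⟩ | ⟨hx, hN⟩ | ⟨hx, -⟩
  · obtain ⟨ho, hi⟩ := same .R (by simp) hx hN
    exact Q.isGentleVertex_of_ordinaryCond hord (Q.injOn_fst_of_hasBar fun a ha => (ho a ha).2)
      (Q.injOn_fst_of_hasBar fun a ha => (hi a ha).2) fun a ha b hb =>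
        Q.pathSpace_le_of_preArrow_mul_mem_R ((hs ha).trans (ht hb).symm)
          ((congrArg Q.D (hs ha)).trans hx) (ho a ha).1
  · obtain ⟨ho, hi⟩ := same .H (by simp) hx hN
    exact Q.isGentleVertex_of_ordinaryCond hord (Q.injOn_fst_of_hasBar fun a ha => (ho a ha).2)
      (Q.injOn_fst_of_hasBar fun a ha => (hi a ha).2) fun a ha b hb =>
        Q.pathSpace_le_of_preArrow_mul_mem_H ((hs ha).trans (ht hb).symm)
          ((congrArg Q.D (hs ha)).trans hx) (ho a ha).1 (hi b hb).1
  · have hS : ∀ {a}, a ∈ Q.complexified.outArrows x → Q.complexified.s a = x := fun ha => by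
      simpa [ArrowQuiver.outArrows] using ha
    have hT : ∀ {a}, a ∈ Q.complexified.inArrows x → Q.complexified.t a = x := fun ha => by
      simpa [ArrowQuiver.inArrows] using ha
    refine Q.isGentleVertex_of_ordinaryCond hord ?_ ?_ fun a ha b hb =>
      Q.pathSpace_le_of_preArrow_mul_mem_C ((hS ha).trans (hT hb).symm)
        ((congrArg Q.D (hs ha)).trans hx)
    -- The arrows `α` and `ᾱ` start at different vertices among `i`, `ī`, so only one of them starts
    -- at `x`.
    · rintro ⟨⟨α, ba⟩, hα⟩ ha ⟨⟨β, bb⟩, hβ⟩ hb (rfl : α = β)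
      have : ba = bb := (Q.M α).srcBar_injective ((congrArg Q.D (hs ha)).trans hx)
        (congrArg (fun x => x.1.2) ((hS ha).trans (hS hb).symm))
      subst this
      rfl
    · rintro ⟨⟨α, ba⟩, hα⟩ ha ⟨⟨β, bb⟩, hβ⟩ hb (rfl : α = β)
      have : ba = bb := (Q.M α).tgtBar_injective ((congrArg Q.D (ht ha)).trans hx)
        (congrArg (fun x => x.1.2) ((hT ha).trans (hT hb).symm))
      subst this
      rfl

end ModulatedQuiver
/-! ## Automorphisms of path algebras -/

namespace ArrowQuiver

variable {V E : Type*} (Γ : ArrowQuiver V E) [DecidableEq V] [DecidableEq E] [Fintype V]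
  [Fintype E] {k : Type*} [Field k]

theorem coef_eq_sum (f : V → k) :
    BimodTensor.coef k (V → k) (Γ.ArrowSpan k) f = ∑ x, f x • Γ.triv k x := by
  simp only [triv, ← map_smul, ← map_sum]
  congr 1
  ext x
  simp [Finset.sum_apply, Pi.single_apply]

theorem coef_mul_arrow (f : V → k) (a : E) :
    BimodTensor.coef k (V → k) (Γ.ArrowSpan k) f * Γ.arrow k a = f (Γ.t a) • Γ.arrow k a := by
  -- The product depends only on the value of the function at the terminal vertex. So `f` may be
  -- replaced by a constant function, which is a scalar of the algebra.
  have h : ∀ g : V → k, g (Γ.t a) = f (Γ.t a) →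
      BimodTensor.coef k (V → k) (Γ.ArrowSpan k) g * Γ.arrow k a =
      BimodTensor.vec k (V → k) (Γ.ArrowSpan k) (Pi.single a (f (Γ.t a)) : E → k) := by
    intro g hg
    refine (BimodTensor.vec_left _ _).symm.trans
      (congrArg (BimodTensor.vec k (V → k) (Γ.ArrowSpan k)) (funext fun b => ?_))
    change g (Γ.t b) * (Pi.single a 1 : E → k) b = (Pi.single a (f (Γ.t a)) : E → k) b
    by_cases hb : b = a
    · subst hb; simp [hg]
    · simp [Pi.single_eq_of_ne hb]
  rw [h f rfl, ← h (algebraMap k (V → k) (f (Γ.t a))) rfl, AlgHom.commutes, Algebra.smul_def]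

theorem arrow_mul_coef (f : V → k) (a : E) :
    Γ.arrow k a * BimodTensor.coef k (V → k) (Γ.ArrowSpan k) f = f (Γ.s a) • Γ.arrow k a := by
  have h : ∀ g : V → k, g (Γ.s a) = f (Γ.s a) →
      Γ.arrow k a * BimodTensor.coef k (V → k) (Γ.ArrowSpan k) g =
      BimodTensor.vec k (V → k) (Γ.ArrowSpan k) (Pi.single a (f (Γ.s a)) : E → k) := by
    intro g hg
    refine (BimodTensor.vec_right _ _).symm.trans
      (congrArg (BimodTensor.vec k (V → k) (Γ.ArrowSpan k)) (funext fun b => ?_))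
    change (Pi.single a 1 : E → k) b * g (Γ.s b) = (Pi.single a (f (Γ.s a)) : E → k) b
    by_cases hb : b = a
    · subst hb; simp [hg]
    · simp [Pi.single_eq_of_ne hb]
  rw [h f rfl, ← h (algebraMap k (V → k) (f (Γ.s a))) rfl, AlgHom.commutes, ← Algebra.commutes,
    Algebra.smul_def]

theorem vec_single (a : E) (c : k) :
    BimodTensor.vec k (V → k) (Γ.ArrowSpan k) (Pi.single a c : E → k) = c • Γ.arrow k a := by
  rw [← Γ.coef_mul_arrow (fun _ => c)]
  refine Eq.trans (congrArg (BimodTensor.vec k (V → k) (Γ.ArrowSpan k)) (funext fun b => ?_))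
    (BimodTensor.vec_left _ _)
  change (Pi.single a c : E → k) b = c * (Pi.single a 1 : E → k) b
  by_cases hb : b = a
  · subst hb; simp
  · simp [Pi.single_eq_of_ne hb]

theorem vec_eq_sum (f : Γ.ArrowSpan k) :
    BimodTensor.vec k (V → k) (Γ.ArrowSpan k) f = ∑ a, (show E → k from f) a • Γ.arrow k a := by
  simp only [← vec_single]
  exact (congrArg (BimodTensor.vec k (V → k) (Γ.ArrowSpan k))
    (Finset.univ_sum_single (show E → k from f)).symm).trans (map_sum _ _ _)

theorem algHom_ext {B : Type*} [Ring B] [Algebra k B] {f g : Γ.PathAlgebra k →ₐ[k] B}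
    (h₀ : ∀ x, f (Γ.triv k x) = g (Γ.triv k x)) (h₁ : ∀ a, f (Γ.arrow k a) = g (Γ.arrow k a)) :
    f = g := by
  refine RingQuot.ringQuot_ext' _ _ _ (FreeAlgebra.hom_ext (funext ?_))
  rintro (c | x)
  · change f (BimodTensor.coef k (V → k) (Γ.ArrowSpan k) c) =
      g (BimodTensor.coef k (V → k) (Γ.ArrowSpan k) c)
    simp only [coef_eq_sum, map_sum, map_smul, h₀]
  · change f (BimodTensor.vec k (V → k) (Γ.ArrowSpan k) x) =
      g (BimodTensor.vec k (V → k) (Γ.ArrowSpan k) x)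
    simp only [vec_eq_sum, map_sum, map_smul, h₁]

/-- The endomorphism of the path algebra which fixes the trivial paths and has given values at the
arrows. -/
theorem exists_algHom (φ : E → Γ.PathAlgebra k)
    (hl : ∀ (f : V → k) a, BimodTensor.coef k (V → k) (Γ.ArrowSpan k) f * φ a = f (Γ.t a) • φ a)
    (hr : ∀ (f : V → k) a, φ a * BimodTensor.coef k (V → k) (Γ.ArrowSpan k) f = f (Γ.s a) • φ a) :
    ∃ F : Γ.PathAlgebra k →ₐ[k] Γ.PathAlgebra k,
      (∀ x, F (Γ.triv k x) = Γ.triv k x) ∧ ∀ a, F (Γ.arrow k a) = φ a := by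
  let g : Γ.ArrowSpan k →+ Γ.PathAlgebra k :=
    { toFun := fun f => ∑ a, (show E → k from f) a • φ a
      map_zero' := by
        change ∑ a, (0 : k) • φ a = 0
        simp
      map_add' := fun x y => by
        change ∑ a, ((show E → k from x) a + (show E → k from y) a) • φ a = _
        simp only [add_smul, Finset.sum_add_distrib] }
  refine ⟨BimodTensor.lift (BimodTensor.coef k (V → k) (Γ.ArrowSpan k)) g ?_ ?_,
    fun x => BimodTensor.lift_coef _ _ _ _ _, fun a => ?_⟩
  · intro f x
    change ∑ a, (f (Γ.t a) * (show E → k from x) a) • φ a =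
      _ * ∑ a, (show E → k from x) a • φ a
    rw [Finset.mul_sum]
    refine Finset.sum_congr rfl fun a _ => ?_
    rw [mul_smul_comm, hl, smul_smul, mul_comm]
  · intro x f
    change ∑ a, ((show E → k from x) a * f (Γ.s a)) • φ a =
      (∑ a, (show E → k from x) a • φ a) * _
    rw [Finset.sum_mul]
    refine Finset.sum_congr rfl fun a _ => ?_
    rw [smul_mul_assoc, hr, smul_smul]
  · refine (BimodTensor.lift_vec _ _ _ _ _).trans ?_
    change ∑ b, (Pi.single a 1 : E → k) b • φ b = φ a
    rw [Finset.sum_eq_single a]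
    · simp
    · intro b _ hb; rw [Pi.single_eq_of_ne hb, zero_smul]
    · simp

/-- Two parallel arrows of a complex path algebra can be replaced by `(c + c') / 2` and
`(c - c') / 2𝐢`. -/
theorem exists_algEquiv_of_parallel {c c' : E} (hne : c ≠ c') (hs : Γ.s c = Γ.s c')
    (ht : Γ.t c = Γ.t c') :
    ∃ d : Γ.PathAlgebra ℂ ≃ₐ[ℂ] Γ.PathAlgebra ℂ,
      (∀ x, d (Γ.triv ℂ x) = Γ.triv ℂ x) ∧
      d (Γ.arrow ℂ c) = (1 / 2 : ℂ) • (Γ.arrow ℂ c + Γ.arrow ℂ c') ∧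
      d (Γ.arrow ℂ c') = (1 / (2 * Complex.I) : ℂ) • (Γ.arrow ℂ c - Γ.arrow ℂ c') ∧
      ∀ a, a ≠ c → a ≠ c' → d (Γ.arrow ℂ a) = Γ.arrow ℂ a := by
  -- Any `2 × 2` matrix of coefficients on the two arrows defines an endomorphism, because the
  -- arrows are parallel.
  have aux : ∀ w x y z : ℂ, ∃ F : Γ.PathAlgebra ℂ →ₐ[ℂ] Γ.PathAlgebra ℂ,
      (∀ x, F (Γ.triv ℂ x) = Γ.triv ℂ x) ∧
      F (Γ.arrow ℂ c) = w • Γ.arrow ℂ c + x • Γ.arrow ℂ c' ∧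
      F (Γ.arrow ℂ c') = y • Γ.arrow ℂ c + z • Γ.arrow ℂ c' ∧
      ∀ a, a ≠ c → a ≠ c' → F (Γ.arrow ℂ a) = Γ.arrow ℂ a := by
    intro w x y z
    obtain ⟨F, h₀, h₁⟩ := Γ.exists_algHom (k := ℂ) (fun a =>
      if a = c then w • Γ.arrow ℂ c + x • Γ.arrow ℂ c'
      else if a = c' then y • Γ.arrow ℂ c + z • Γ.arrow ℂ c' else Γ.arrow ℂ a)
      (by
        intro f a
        split_ifs with h h'
        · subst h
          rw [mul_add, mul_smul_comm, mul_smul_comm, coef_mul_arrow, coef_mul_arrow, ht, smul_add,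
            smul_comm w, smul_comm x]
        · subst h'
          rw [mul_add, mul_smul_comm, mul_smul_comm, coef_mul_arrow, coef_mul_arrow, ht, smul_add,
            smul_comm y, smul_comm z]
        · exact Γ.coef_mul_arrow f a)
      (by
        intro f a
        split_ifs with h h'
        · subst h
          rw [add_mul, smul_mul_assoc, smul_mul_assoc, arrow_mul_coef, arrow_mul_coef, hs, smul_add,
            smul_comm w, smul_comm x]
        · subst h'
          rw [add_mul, smul_mul_assoc, smul_mul_assoc, arrow_mul_coef, arrow_mul_coef, hs, smul_add,
            smul_comm y, smul_comm z]
        · exact Γ.arrow_mul_coef f a)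
    refine ⟨F, h₀, ?_, ?_, fun a ha ha' => ?_⟩
    · rw [h₁, if_pos rfl]
    · rw [h₁, if_neg hne.symm, if_pos rfl]
    · rw [h₁, if_neg ha, if_neg ha']
  -- The matrix of `F` is the required one; that of `G` is its inverse, with `c ↦ c + 𝐢c'` and `c' ↦
  -- c - 𝐢c'`.
  obtain ⟨F, hF, hFc, hFc', hFa⟩ := aux (1 / 2) (1 / 2) (1 / (2 * Complex.I)) (-(1 / (2 * Complex.I)))
  obtain ⟨G, hG, hGc, hGc', hGa⟩ := aux 1 Complex.I 1 (-Complex.I)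
  have hI : Complex.I ≠ 0 := Complex.I_ne_zero
  refine ⟨AlgEquiv.ofAlgHom F G (Γ.algHom_ext (fun x => ?_) fun a => ?_)
    (Γ.algHom_ext (fun x => ?_) fun a => ?_), hF, ?_, ?_, hFa⟩
  · simp [hF, hG]
  · by_cases h : a = c
    · subst h
      simp only [AlgHom.comp_apply, AlgHom.id_apply, hGc, map_add, map_smul, hFc, hFc']
      match_scalars <;> field_simp <;> norm_num
    by_cases h' : a = c'
    · subst h'
      simp only [AlgHom.comp_apply, AlgHom.id_apply, hGc', map_add, map_smul, hFc, hFc']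
      match_scalars <;> field_simp <;> norm_num
    simp [hFa a h h', hGa a h h']
  · simp [hF, hG]
  · by_cases h : a = c
    · subst h
      simp only [AlgHom.comp_apply, AlgHom.id_apply, hGc, map_add, map_smul, hFc, hGc']
      match_scalars <;> field_simp <;> norm_num
    by_cases h' : a = c'
    · subst h'
      simp only [AlgHom.comp_apply, AlgHom.id_apply, hGc', map_add, map_smul, hGc, hFc']
      match_scalars <;> field_simp <;> norm_num
    simp [hFa a h h', hGa a h h']
  · change F _ = _
    rw [hFc, smul_add]
  · change F _ = _
    rw [hFc']
    match_scalars <;> ring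

end ArrowQuiver

namespace SimpleBimod

theorem srcBar_eq_false {D D' : DivRing} (S : SimpleBimod D D') (h : D' ≠ .C) (b : Bool) :
    S.srcBar b = false := by
  cases S <;> simp at h <;> rfl

theorem tgtBar_eq_false {D D' : DivRing} (S : SimpleBimod D D') (h : D ≠ .C) (b : Bool) :
    S.tgtBar b = false := by
  cases S <;> simp at h <;> rfl

end SimpleBimod

/-! ### Existence of the automorphism `d_v` -/

namespace ModulatedQuiver

variable {V E : Type*} (Q : ModulatedQuiver V E) [DecidableEq V] [DecidableEq E] [Fintype V]
  [Fintype E]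

theorem fiber_injective : Function.Injective Q.fiber := fun _ _ h =>
  congrArg (fun a : Q.CArrow => a.1.1) h

theorem complexified_s_eq {α : E} {b : Bool} {hb : b = true → (Q.M α).hasBar = true} {x : Q.CVertex}
    (hs : Q.s α = x.1.1) (hC : Q.D x.1.1 ≠ .C) : Q.complexified.s ⟨(α, b), hb⟩ = x := by
  refine Subtype.ext (Prod.ext hs ?_)
  have hx : x.1.2 = false := by
    have := x.2
    cases hD : Q.D x.1.1 <;> simp_all [DivRing.hasBar]
  exact ((Q.M α).srcBar_eq_false (by rw [hs]; exact hC) b).trans hx.symm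

theorem complexified_t_eq {α : E} {b : Bool} {hb : b = true → (Q.M α).hasBar = true} {x : Q.CVertex}
    (ht : Q.t α = x.1.1) (hC : Q.D x.1.1 ≠ .C) : Q.complexified.t ⟨(α, b), hb⟩ = x := by
  refine Subtype.ext (Prod.ext ht ?_)
  have hx : x.1.2 = false := by
    have := x.2
    cases hD : Q.D x.1.1 <;> simp_all [DivRing.hasBar]
  exact ((Q.M α).tgtBar_eq_false (by rw [ht]; exact hC) b).trans hx.symm

theorem IsOutHalf.s_eq {Q : ModulatedQuiver V E} {v w : V} {α α' : E}
    (h : Q.IsOutHalf v w α α') : Q.s α = v ∧ Q.s α' = v :=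
  ⟨Q.s_eq_of_mem_outArrows (by rw [h.1]; simp), Q.s_eq_of_mem_outArrows (by rw [h.1]; simp)⟩

theorem IsInHalf.t_eq {Q : ModulatedQuiver V E} {v u : V} {β β' : E}
    (h : Q.IsInHalf v u β β') : Q.t β = v ∧ Q.t β' = v :=
  ⟨Q.t_eq_of_mem_inArrows (by rw [h.1]; simp), Q.t_eq_of_mem_inArrows (by rw [h.1]; simp)⟩

/-- The arrows of the two halves agree if they meet. -/
theorem SpecialCond.eq_of_eq {Q : ModulatedQuiver V E} {I : TwoSidedIdeal Q.TensorAlg} {v u w : V}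
    {α α' β β' : E} (h : Q.SpecialCond I v u w α α' β β') {γ : E} (hα : γ = α ∨ γ = α')
    (hβ : γ = β ∨ γ = β') : α = β ∧ α' = β' := by
  obtain ⟨-, ⟨ho, hw, hw', -⟩, ⟨hi, hu, hu', -⟩, hloop, -⟩ := h
  have hs : Q.s γ = v := Q.s_eq_of_mem_outArrows (by rw [ho]; simpa using hα)
  have ht : Q.t γ = v := Q.t_eq_of_mem_inArrows (by rw [hi]; simpa using hβ)
  -- An arrow in both halves is a loop at `v`. As each half has only one other end, `N_v = {v}`, and
  -- the convention on names applies.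
  have hwv : w = v := by rcases hα with rfl | rfl <;> simp_all
  have huv : u = v := by rcases hβ with rfl | rfl <;> simp_all
  refine hloop ?_
  rw [ArrowQuiver.neighbors, ho, hi]
  simp [Finset.image_insert, hw, hw', hu, hu', hwv, huv]

theorem SpecialCond.exists_diagonalizesPairs {Q : ModulatedQuiver V E}
    {I : TwoSidedIdeal Q.TensorAlg} {v u w : V} {α α' β β' : E}
    (h : Q.SpecialCond I v u w α α' β β') : ∃ d, Q.DiagonalizesPairs α α' β β' d := by
  have key : ∀ γ γ' : E, γ ≠ γ' → (γ = α ∧ γ' = α') ∨ (γ = β ∧ γ' = β') →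
      ∃ d : Q.complexified.PathAlgebra ℂ ≃ₐ[ℂ] Q.complexified.PathAlgebra ℂ,
      (∀ x, d (Q.complexified.triv ℂ x) = Q.complexified.triv ℂ x) ∧
      d (Q.complexified.arrow ℂ (Q.fiber γ)) = (1 / 2 : ℂ) •
        (Q.complexified.arrow ℂ (Q.fiber γ) + Q.complexified.arrow ℂ (Q.fiber γ')) ∧
      d (Q.complexified.arrow ℂ (Q.fiber γ')) = (1 / (2 * Complex.I) : ℂ) •
        (Q.complexified.arrow ℂ (Q.fiber γ) - Q.complexified.arrow ℂ (Q.fiber γ')) ∧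
      ∀ a, a ≠ Q.fiber γ → a ≠ Q.fiber γ' →
        d (Q.complexified.arrow ℂ a) = Q.complexified.arrow ℂ a := by
    intro γ γ' hne hγ
    have hC := h.ne_C
    -- Parallel arrows of a pair stay parallel in `Γ`: both ends have modulation `𝓜(v) ≠ ℂ`, so a
    -- single vertex of `Γ` lies over each of them.
    have hst : ∃ i j : V, (Q.s γ = i ∧ Q.s γ' = i) ∧ (Q.t γ = j ∧ Q.t γ' = j) ∧
        Q.D i ≠ .C ∧ Q.D j ≠ .C := by
      rcases hγ with ⟨rfl, rfl⟩ | ⟨rfl, rfl⟩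
      · exact ⟨v, w, h.isOutHalf.s_eq, h.isOutHalf.2.1.symm ▸ ⟨rfl, h.isOutHalf.2.2.1⟩, hC,
          (h.isOutHalf.2.2.2.mp hne).symm ▸ hC⟩
      · exact ⟨u, v, h.isInHalf.2.1.symm ▸ ⟨rfl, h.isInHalf.2.2.1⟩, h.isInHalf.t_eq,
          (h.isInHalf.2.2.2.mp hne).symm ▸ hC, hC⟩
    obtain ⟨i, j, ⟨hs, hs'⟩, ⟨ht, ht'⟩, hi, hj⟩ := hst
    refine Q.complexified.exists_algEquiv_of_parallel (Q.fiber_injective.ne hne) ?_ ?_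
    · exact (Q.complexified_s_eq (x := ⟨(i, false), by simp⟩) hs hi).trans
        (Q.complexified_s_eq (x := ⟨(i, false), by simp⟩) hs' hi).symm
    · exact (Q.complexified_t_eq (x := ⟨(j, false), by simp⟩) ht hj).trans
        (Q.complexified_t_eq (x := ⟨(j, false), by simp⟩) ht' hj).symm
  have hinj := Q.fiber_injective
  by_cases hα : α = α'
  · by_cases hβ : β = β'
    · refine ⟨AlgEquiv.refl, fun _ => rfl, ?_, fun _ _ _ => rfl⟩
      rintro γ γ' hne (⟨rfl, rfl⟩ | ⟨rfl, rfl⟩)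
      · exact absurd hα hne
      · exact absurd hβ hne
    · obtain ⟨d, h₀, h₁, h₂, h₃⟩ := key β β' hβ (Or.inr ⟨rfl, rfl⟩)
      refine ⟨d, h₀, ?_, fun a _ ha => h₃ a (ha hβ).1 (ha hβ).2⟩
      rintro γ γ' hne (⟨rfl, rfl⟩ | ⟨rfl, rfl⟩)
      · exact absurd hα hne
      · exact ⟨h₁, h₂⟩
  · obtain ⟨d, h₀, h₁, h₂, h₃⟩ := key α α' hα (Or.inl ⟨rfl, rfl⟩)
    -- The automorphism for `α`, `α'` is enough if there is no second pair or if both pairs coincide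
    -- with names. Otherwise the pairs are disjoint and the two automorphisms are composed.
    by_cases hβ : β = β' ∨ (α = β ∧ α' = β')
    · refine ⟨d, h₀, ?_, fun a ha _ => h₃ a (ha hα).1 (ha hα).2⟩
      rintro γ γ' hne (⟨rfl, rfl⟩ | ⟨rfl, rfl⟩)
      · exact ⟨h₁, h₂⟩
      · rcases hβ with hβ | ⟨rfl, rfl⟩
        · exact absurd hβ hne
        · exact ⟨h₁, h₂⟩
    · push Not at hβ
      have hdisj : ∀ γ, γ = α ∨ γ = α' → ¬(γ = β ∨ γ = β') := fun γ h1 h2 =>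
        hβ.2 (h.eq_of_eq h1 h2).1 (h.eq_of_eq h1 h2).2
      obtain ⟨d', h₀', h₁', h₂', h₃'⟩ := key β β' hβ.1 (Or.inr ⟨rfl, rfl⟩)
      have hfix : ∀ γ, γ = α ∨ γ = α' → d' (Q.complexified.arrow ℂ (Q.fiber γ)) =
          Q.complexified.arrow ℂ (Q.fiber γ) := fun γ hγ =>
        h₃' _ (hinj.ne fun h' => hdisj γ hγ (Or.inl h')) (hinj.ne fun h' => hdisj γ hγ (Or.inr h'))
      have hfix' : ∀ γ, γ = β ∨ γ = β' → d (Q.complexified.arrow ℂ (Q.fiber γ)) =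
          Q.complexified.arrow ℂ (Q.fiber γ) := fun γ hγ =>
        h₃ _ (hinj.ne fun h' => hdisj γ (Or.inl h') hγ) (hinj.ne fun h' => hdisj γ (Or.inr h') hγ)
      refine ⟨d.trans d', fun x => ?_, ?_, fun a ha ha' => ?_⟩
      · rw [AlgEquiv.trans_apply, h₀, h₀']
      · rintro γ γ' hne (⟨rfl, rfl⟩ | ⟨rfl, rfl⟩)
        · rw [AlgEquiv.trans_apply, AlgEquiv.trans_apply, h₁, h₂, map_smul, map_smul, map_add,
            map_sub, hfix _ (Or.inl rfl), hfix _ (Or.inr rfl)]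
          exact ⟨rfl, rfl⟩
        · rw [AlgEquiv.trans_apply, AlgEquiv.trans_apply, hfix' _ (Or.inl rfl),
            hfix' _ (Or.inr rfl)]
          exact ⟨h₁', h₂'⟩
      · rw [AlgEquiv.trans_apply, h₃ a (ha hα).1 (ha hα).2, h₃' a (ha' hβ.1).1 (ha' hβ.1).2]

/-! ### The inverse of the automorphism -/

variable {Q}

/-- Inverting `(γ + γ')/2` and `(γ - γ')/2𝐢` gives `γ + 𝐢γ'` and `γ - 𝐢γ'`. -/
theorem DiagonalizesPairs.psiInvLin_symm_pair {α α' β β' γ γ' : E}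
    {d : Q.complexified.PathAlgebra ℂ ≃ₐ[ℂ] Q.complexified.PathAlgebra ℂ}
    (hd : Q.DiagonalizesPairs α α' β β' d) (hne : γ ≠ γ')
    (hγ : (γ = α ∧ γ' = α') ∨ (γ = β ∧ γ' = β')) :
    Q.psiInvLin (d.symm (Q.complexified.arrow ℂ (Q.fiber γ))) =
      Q.preArrow (Q.fiber γ) + Complex.I • Q.preArrow (Q.fiber γ') ∧
    Q.psiInvLin (d.symm (Q.complexified.arrow ℂ (Q.fiber γ'))) =
      Q.preArrow (Q.fiber γ) - Complex.I • Q.preArrow (Q.fiber γ') := by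
  obtain ⟨h, h'⟩ := hd.pair γ γ' hne hγ
  have hI : Complex.I ≠ 0 := Complex.I_ne_zero
  have e : d.symm (Q.complexified.arrow ℂ (Q.fiber γ)) = Q.complexified.arrow ℂ (Q.fiber γ) +
      Complex.I • Q.complexified.arrow ℂ (Q.fiber γ') := by
    rw [AlgEquiv.symm_apply_eq, map_add, map_smul, h, h']
    match_scalars <;> field_simp <;> norm_num
  have e' : d.symm (Q.complexified.arrow ℂ (Q.fiber γ')) = Q.complexified.arrow ℂ (Q.fiber γ) -
      Complex.I • Q.complexified.arrow ℂ (Q.fiber γ') := by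
    rw [AlgEquiv.symm_apply_eq, map_sub, map_smul, h, h']
    match_scalars <;> field_simp <;> norm_num
  rw [e, e', map_add, map_sub, map_smul, psiInvLin_arrow, psiInvLin_arrow]
  exact ⟨rfl, rfl⟩

theorem DiagonalizesPairs.psiInvLin_symm_other {α α' β β' : E}
    {d : Q.complexified.PathAlgebra ℂ ≃ₐ[ℂ] Q.complexified.PathAlgebra ℂ}
    (hd : Q.DiagonalizesPairs α α' β β' d) {a : Q.CArrow}
    (ha : α ≠ α' → a.1.1 ≠ α ∧ a.1.1 ≠ α') (ha' : β ≠ β' → a.1.1 ≠ β ∧ a.1.1 ≠ β') :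
    Q.psiInvLin (d.symm (Q.complexified.arrow ℂ a)) = Q.preArrow a := by
  have hf : ∀ {γ}, a.1.1 ≠ γ → a ≠ Q.fiber γ := fun h h' => h (congrArg (fun a => a.1.1) h')
  have h := hd.other a (fun h => ⟨hf (ha h).1, hf (ha h).2⟩) fun h => ⟨hf (ha' h).1, hf (ha' h).2⟩
  rw [← psiInvLin_arrow]
  congr 1
  rw [AlgEquiv.symm_apply_eq, h]

end ModulatedQuiver
/-! ## Specially gentle vertices: reductions -/

namespace ArrowQuiver

/-- A change of one of the two arrows on either side swaps the diagonal products with the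
off-diagonal ones, hence `X` with `Y`. So (G2) reduces to the single alternative `X` xor `Y`. -/
theorem isGentleVertex_of_pairs {V E : Type*} (Γ : ArrowQuiver V E) [DecidableEq V] [DecidableEq E]
    [Fintype E] {k : Type*} [Field k] {J : TwoSidedIdeal (Γ.PathAlgebra k)} {x : V}
    {a₁ a₂ b₁ b₂ : E} (hout : Γ.outArrows x = {a₁, a₂}) (hin : Γ.inArrows x = {b₁, b₂})
    {X Y : Prop} (hXY : Xor X Y)
    (h₁₁ : Γ.arrow k a₁ * Γ.arrow k b₁ ∈ J ↔ X) (h₂₂ : Γ.arrow k a₂ * Γ.arrow k b₂ ∈ J ↔ X)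
    (h₁₂ : Γ.arrow k a₁ * Γ.arrow k b₂ ∈ J ↔ Y) (h₂₁ : Γ.arrow k a₂ * Γ.arrow k b₁ ∈ J ↔ Y) :
    Γ.IsGentleVertex J x := by
  have hYX : Xor Y X := (xor_comm X Y).mp hXY
  refine ⟨hout ▸ Finset.card_le_two, hin ▸ Finset.card_le_two, ?_, ?_⟩
  all_goals
    rw [hout, hin]
    intro a ha b hb c hc hbc
    simp only [Finset.mem_insert, Finset.mem_singleton] at ha hb hc
    rcases ha with rfl | rfl <;> rcases hb with rfl | rfl <;> rcases hc with rfl | rfl <;>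
      first
      | exact absurd rfl hbc
      | simpa only [h₁₁, h₁₂, h₂₁, h₂₂] using hXY
      | simpa only [h₁₁, h₁₂, h₂₁, h₂₂] using hYX

theorem isGentleVertex_of_isEmpty {V E : Type*} (Γ : ArrowQuiver V E) [DecidableEq V]
    [DecidableEq E] [Fintype E] {k : Type*} [Field k] {J : TwoSidedIdeal (Γ.PathAlgebra k)} {x : V}
    (hout : (Γ.outArrows x).card ≤ 2) (hin : (Γ.inArrows x).card ≤ 2)
    (h : Γ.outArrows x = ∅ ∨ Γ.inArrows x = ∅) : Γ.IsGentleVertex J x := by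
  refine ⟨hout, hin, ?_, ?_⟩ <;> intro a ha b hb <;> rcases h with h | h <;> simp_all

end ArrowQuiver

theorem SimpleBimod.hasBar_of_ne {D D' : DivRing} (S : SimpleBimod D D') (h : D ≠ D') :
    S.hasBar = true := by
  cases S <;> simp at h <;> rfl

/-! ### The two components of a product `(P + Q ⊗ i)(P' + Q' ⊗ i)` -/

section RingLemmas

variable {R : Type*} [Ring R] {I : TwoSidedIdeal R} {P Q P' Q' : R}

theorem neg_mem_twoSidedIdeal_iff {x : R} : -x ∈ I ↔ x ∈ I :=
  ⟨fun h => neg_neg x ▸ I.neg_mem h, I.neg_mem⟩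

theorem mem_and_mem_neg_neg :
    (P * P' - -Q * -Q' ∈ I ∧ P * -Q' + -Q * P' ∈ I) ↔
      (P * P' - Q * Q' ∈ I ∧ P * Q' + Q * P' ∈ I) := by
  rw [neg_mul_neg, ← neg_mem_twoSidedIdeal_iff (x := P * Q' + Q * P')]
  have : P * -Q' + -Q * P' = -(P * Q' + Q * P') := by noncomm_ring
  rw [this]

theorem mem_and_mem_right_neg :
    (P * P' - Q * -Q' ∈ I ∧ P * -Q' + Q * P' ∈ I) ↔
      (P * P' + Q * Q' ∈ I ∧ P * Q' - Q * P' ∈ I) := by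
  rw [← neg_mem_twoSidedIdeal_iff (x := P * Q' - Q * P')]
  have : P * -Q' + Q * P' = -(P * Q' - Q * P') := by noncomm_ring
  rw [this, mul_neg, sub_neg_eq_add]

theorem mem_and_mem_left_neg :
    (P * P' - -Q * Q' ∈ I ∧ P * Q' + -Q * P' ∈ I) ↔
      (P * P' + Q * Q' ∈ I ∧ P * Q' - Q * P' ∈ I) := by
  rw [neg_mul, neg_mul, sub_neg_eq_add, ← sub_eq_add_neg]

/-- Left multiplication by `J` turns the real component into the imaginary one up to sign, so the
first condition implies the second. -/
theorem mem_imp_of_left {J : R} (hQ : J * Q = P) (hP : J * P = -Q) :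
    (P * P' - Q * Q' ∈ I → P * Q' + Q * P' ∈ I) ∧
      (P * P' + Q * Q' ∈ I → P * Q' - Q * P' ∈ I) := by
  constructor <;> intro h
  · have e : P * Q' + Q * P' = -(J * (P * P' - Q * Q')) := by
      rw [mul_sub, ← mul_assoc, ← mul_assoc, hQ, hP]; noncomm_ring
    rw [e]; exact I.neg_mem (I.mul_mem_left _ _ h)
  · have e : P * Q' - Q * P' = J * (P * P' + Q * Q') := by
      rw [mul_add, ← mul_assoc, ← mul_assoc, hQ, hP]; noncomm_ring
    rw [e]; exact I.mul_mem_left _ _ h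

theorem mem_imp_of_right {J : R} (hQ : Q' * J = P') (hP : P' * J = -Q') :
    (P * P' - Q * Q' ∈ I → P * Q' + Q * P' ∈ I) ∧
      (P * P' + Q * Q' ∈ I → P * Q' - Q * P' ∈ I) := by
  constructor <;> intro h
  · have e : P * Q' + Q * P' = -((P * P' - Q * Q') * J) := by
      rw [sub_mul, mul_assoc, mul_assoc, hQ, hP]; noncomm_ring
    rw [e]; exact I.neg_mem (I.mul_mem_right _ _ h)
  · have e : P * Q' - Q * P' = -((P * P' + Q * Q') * J) := by
      rw [add_mul, mul_assoc, mul_assoc, hQ, hP]; noncomm_ring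
    rw [e]; exact I.neg_mem (I.mul_mem_right _ _ h)

theorem add_self_mem_iff_of_algebra [Algebra ℝ R] {x : R} : x + x ∈ I ↔ x ∈ I := by
  refine ⟨fun h => ?_, fun h => I.add_mem h h⟩
  have := I.mul_mem_left (algebraMap ℝ R 2⁻¹) _ h
  rwa [← Algebra.smul_def, ← two_smul ℝ x, smul_smul, inv_mul_cancel₀ two_ne_zero, one_smul] at this

/-- The element `1 - J ⊗ i` is twice an idempotent when `J² = -1`. So the product of `X(1 - J ⊗ i)`
and `(1 - J ⊗ i)Y` is `2X(1 - J ⊗ i)Y`. -/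
theorem mem_and_mem_of_quaternion [Algebra ℝ R] {X Y J : R} (h : X * (J * (J * Y)) = -(X * Y)) :
    (X * Y - -(X * J) * -(J * Y) ∈ I ∧ X * -(J * Y) + -(X * J) * Y ∈ I) ↔
      (X * Y ∈ I ∧ X * (J * Y) ∈ I) := by
  have e₁ : X * Y - -(X * J) * -(J * Y) = X * Y + X * Y := by
    rw [neg_mul_neg, mul_assoc, h, sub_neg_eq_add]
  have e₂ : X * -(J * Y) + -(X * J) * Y = -(X * (J * Y) + X * (J * Y)) := by noncomm_ring
  rw [e₁, e₂, neg_mem_twoSidedIdeal_iff, add_self_mem_iff_of_algebra, add_self_mem_iff_of_algebra]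

end RingLemmas

/-! ### Generators and units in `T(Q, 𝓜)` -/

namespace ModulatedQuiver

variable {V E : Type*} (Q : ModulatedQuiver V E) [DecidableEq V] [DecidableEq E]

/-- The scalar is given as a function of the division ring, so that it makes sense both at `v` and
at `t(β)` without a transport along `h`. -/
theorem vert_mul_arr_of_eq {v : V} {β : E} (h : Q.t β = v) (f : (D : DivRing) → D.carrier)
    (x : (Q.M β).carrier) :
    Q.vert v (f (Q.D v)) * Q.arr β x = Q.arr β (f (Q.D (Q.t β)) • x) := by
  subst h; exact Q.vert_mul_arr _ _ _

theorem arr_mul_vert_of_eq {v : V} {α : E} (h : Q.s α = v) (f : (D : DivRing) → D.carrier)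
    (x : (Q.M α).carrier) :
    Q.arr α x * Q.vert v (f (Q.D v)) = Q.arr α (MulOpposite.op (f (Q.D (Q.s α))) • x) := by
  subst h; exact Q.arr_mul_vert _ _ _

theorem smul_mul_mem_idealC_iff {I : TwoSidedIdeal Q.TensorAlg} {c : ℂ} (hc : c ≠ 0)
    (z y : Q.CTensorAlg) : (c • z) * y ∈ Q.idealC I ↔ z * y ∈ Q.idealC I := by
  rw [smul_mul_assoc]; exact (Q.idealC I).smul_mem_iff hc

theorem mul_smul_mem_idealC_iff {I : TwoSidedIdeal Q.TensorAlg} {c : ℂ} (hc : c ≠ 0)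
    (z y : Q.CTensorAlg) : y * (c • z) ∈ Q.idealC I ↔ y * z ∈ Q.idealC I := by
  rw [mul_smul_comm]; exact (Q.idealC I).smul_mem_iff hc

theorem two_smul_preArrow (a : Q.CArrow) : (2 : ℂ) • Q.preArrow a =
    Q.cx (Q.arr a.1.1 ((Q.M a.1.1).preRe a.1.2 + (Q.M a.1.1).preRe a.1.2))
      (Q.arr a.1.1 ((Q.M a.1.1).preIm a.1.2 + (Q.M a.1.1).preIm a.1.2)) := by
  rw [two_smul, preArrow, cx_add, arr_add, arr_add]

/-- The tensor algebra element given by the generator of `𝓜(α)`. -/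
noncomputable def genArr (α : E) : Q.TensorAlg := Q.arr α (Q.M α).gen

/-- The image of the unit `𝐢` or `𝐣` of `𝓜(i)`. -/
noncomputable def iotaAt (i : V) : Q.TensorAlg := Q.vert i (Q.D i).iota

/-- The image of the unit `𝐤` of `𝓜(i)`. -/
noncomputable def kappaAt (i : V) : Q.TensorAlg := Q.vert i (Q.D i).kappa

theorem iotaAt_mul_arr {v : V} {β : E} (h : Q.t β = v) (x : (Q.M β).carrier) :
    Q.iotaAt v * Q.arr β x = Q.arr β ((Q.D (Q.t β)).iota • x) :=
  Q.vert_mul_arr_of_eq h DivRing.iota x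

theorem kappaAt_mul_arr {v : V} {β : E} (h : Q.t β = v) (x : (Q.M β).carrier) :
    Q.kappaAt v * Q.arr β x = Q.arr β ((Q.D (Q.t β)).kappa • x) :=
  Q.vert_mul_arr_of_eq h DivRing.kappa x

theorem arr_mul_iotaAt {v : V} {α : E} (h : Q.s α = v) (x : (Q.M α).carrier) :
    Q.arr α x * Q.iotaAt v = Q.arr α (MulOpposite.op (Q.D (Q.s α)).iota • x) :=
  Q.arr_mul_vert_of_eq h DivRing.iota x

theorem arr_mul_kappaAt {v : V} {α : E} (h : Q.s α = v) (x : (Q.M α).carrier) :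
    Q.arr α x * Q.kappaAt v = Q.arr α (MulOpposite.op (Q.D (Q.s α)).kappa • x) :=
  Q.arr_mul_vert_of_eq h DivRing.kappa x

theorem iotaAt_iotaAt_mul_arr {v : V} {β : E} (h : Q.t β = v) (hv : Q.D v ≠ .R)
    (x : (Q.M β).carrier) : Q.iotaAt v * (Q.iotaAt v * Q.arr β x) = -Q.arr β x := by
  rw [Q.iotaAt_mul_arr h, Q.iotaAt_mul_arr h, smul_smul, DivRing.iota_mul_iota (h ▸ hv), neg_smul,
    one_smul, arr_neg]

theorem arr_mul_iotaAt_iotaAt {v : V} {α : E} (h : Q.s α = v) (hv : Q.D v ≠ .R)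
    (x : (Q.M α).carrier) : Q.arr α x * Q.iotaAt v * Q.iotaAt v = -Q.arr α x := by
  rw [Q.arr_mul_iotaAt h, Q.arr_mul_iotaAt h, smul_smul, ← MulOpposite.op_mul,
    DivRing.iota_mul_iota (h ▸ hv), MulOpposite.op_neg, MulOpposite.op_one, neg_smul, one_smul,
    arr_neg]

/-! ### Bimodules generated by tensors -/

variable [Fintype V] [Fintype E]

/-- The elements fixed by `1 ∈ 𝓜(w)` from the left and by `1 ∈ 𝓜(u)` from the right. -/
noncomputable def cornerSpace (w u : V) : Submodule ℝ Q.TensorAlg where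
  carrier := {r | Q.vert w 1 * r * Q.vert u 1 = r}
  add_mem' {x y} hx hy := by
    change Q.vert w 1 * (x + y) * Q.vert u 1 = x + y
    rw [mul_add, add_mul, hx, hy]
  zero_mem' := by
    change Q.vert w 1 * 0 * Q.vert u 1 = 0
    rw [mul_zero, zero_mul]
  smul_mem' c x hx := by
    change Q.vert w 1 * (c • x) * Q.vert u 1 = c • x
    rw [mul_smul_comm, smul_mul_assoc, hx]

theorem tens_mem_cornerSpace {w u : V} {α β : E} (hα : Q.t α = w) (hβ : Q.s β = u) (c d : Symb) :
    Q.tens c α d β ∈ Q.cornerSpace w u := by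
  subst hα hβ
  change Q.vert (Q.t α) 1 * (Q.arr α _ * Q.arr β _) * Q.vert (Q.s β) 1 = Q.arr α _ * Q.arr β _
  rw [← mul_assoc, vert_one_mul_arr, mul_assoc, arr_mul_vert_one]

/-- A two-sided ideal absorbs the scalars of `𝓜(w)` and `𝓜(u)`. Conversely, the scalars `1` recover
the elements of `S` themselves, as these are fixed by the local units. -/
theorem bimodSpan_le_iff {I : TwoSidedIdeal Q.TensorAlg} {w u : V} {S : Set Q.TensorAlg}
    (hS : S ⊆ Q.cornerSpace w u) :
    Q.bimodSpan w u S ≤ Q.idealSpace I ↔ ∀ r ∈ S, r ∈ I := by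
  rw [bimodSpan, Submodule.span_le]
  constructor
  · intro h r hr
    exact h ⟨1, r, hr, 1, (hS hr).symm⟩
  · rintro h _ ⟨a, r, hr, b, rfl⟩
    exact I.mul_mem_right _ _ (I.mul_mem_left _ _ (h r hr))

theorem rel₀_subset_cornerSpace {w u : V} {α α' β β' : E} (hα : Q.t α = w) (hα' : Q.t α' = w)
    (hβ : Q.s β = u) (hβ' : Q.s β' = u) (D₁ D₂ D₃ : DivRing) :
    Q.rel₀ α α' β β' D₁ D₂ D₃ ⊆ Q.cornerSpace w u := by
  have h₁ := Q.tens_mem_cornerSpace hα hβ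
  have h₂ := Q.tens_mem_cornerSpace hα hβ'
  have h₃ := Q.tens_mem_cornerSpace hα' hβ
  have h₄ := Q.tens_mem_cornerSpace hα' hβ'
  cases D₁ <;> cases D₂ <;> cases D₃ <;>
    simp only [rel₀, Set.insert_subset_iff, Set.singleton_subset_iff, Set.empty_subset,
      SetLike.mem_coe] <;>
    repeat' first
      | with_reducible apply And.intro
      | with_reducible exact h₁ _ _
      | with_reducible exact h₂ _ _
      | with_reducible exact h₃ _ _
      | with_reducible exact h₄ _ _
      | with_reducible apply Submodule.add_mem
      | with_reducible apply Submodule.sub_mem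
      | with_reducible apply Submodule.neg_mem

theorem rel₁_subset_cornerSpace {w u : V} {α α' β β' : E} (hα : Q.t α = w) (hα' : Q.t α' = w)
    (hβ : Q.s β = u) (hβ' : Q.s β' = u) (D₁ D₂ D₃ : DivRing) :
    Q.rel₁ α α' β β' D₁ D₂ D₃ ⊆ Q.cornerSpace w u := by
  have h₁ := Q.tens_mem_cornerSpace hα hβ
  have h₂ := Q.tens_mem_cornerSpace hα hβ'
  have h₃ := Q.tens_mem_cornerSpace hα' hβ
  have h₄ := Q.tens_mem_cornerSpace hα' hβ'
  cases D₁ <;> cases D₂ <;> cases D₃ <;>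
    simp only [rel₁, Set.insert_subset_iff, Set.singleton_subset_iff, Set.empty_subset,
      SetLike.mem_coe] <;>
    repeat' first
      | with_reducible apply And.intro
      | with_reducible exact h₁ _ _
      | with_reducible exact h₂ _ _
      | with_reducible exact h₃ _ _
      | with_reducible exact h₄ _ _
      | with_reducible apply Submodule.add_mem
      | with_reducible apply Submodule.sub_mem
      | with_reducible apply Submodule.neg_mem

/-! ### The arrows of the complexified quiver at a vertex of special form -/

variable {Q} {v w u : V} {α α' β β' : E} {x : Q.CVertex}

/-- Only one vertex of `Γ` lies over a vertex with modulation `ℝ` or `ℍ`, so it carries all the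
arrows over `v⁺`. -/
theorem mem_outArrows_complexified_iff (hC : Q.D x.1.1 ≠ .C) {a : Q.CArrow} :
    a ∈ Q.complexified.outArrows x ↔ a.1.1 ∈ Q.outArrows x.1.1 := by
  refine ⟨Q.mem_outArrows_of_complexified, fun h => ?_⟩
  have := Q.complexified_s_eq (hb := a.2) (Q.s_eq_of_mem_outArrows h) hC
  simpa [ArrowQuiver.outArrows] using this

theorem mem_inArrows_complexified_iff (hC : Q.D x.1.1 ≠ .C) {a : Q.CArrow} :
    a ∈ Q.complexified.inArrows x ↔ a.1.1 ∈ Q.inArrows x.1.1 := by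
  refine ⟨Q.mem_inArrows_of_complexified, fun h => ?_⟩
  have := Q.complexified_t_eq (hb := a.2) (Q.t_eq_of_mem_inArrows h) hC
  simpa [ArrowQuiver.inArrows] using this

theorem cArrow_eq_fiber_of_hasBar {a : Q.CArrow} {α : E} (ha : a.1.1 = α)
    (h : (Q.M α).hasBar = false) : a = Q.fiber α := by
  obtain ⟨⟨α, b⟩, hb⟩ := a
  obtain rfl : α = _ := ha
  cases b
  · rfl
  · exact absurd (hb rfl) (by simp [h])

/-- A bimodule between equal division rings other than `ℂ` gives one arrow of `Γ`, so the two arrows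
are those of the pair. -/
theorem IsOutHalf.outArrows_of_eq (h : Q.IsOutHalf x.1.1 w α α') (hC : Q.D x.1.1 ≠ .C)
    (hw : Q.D w = Q.D x.1.1) : Q.complexified.outArrows x = {Q.fiber α, Q.fiber α'} := by
  have hbar : ∀ γ, γ = α ∨ γ = α' → (Q.M γ).hasBar = false := by
    intro γ hγ
    have hs : Q.s γ = x.1.1 := by rcases hγ with rfl | rfl <;> simp [h.s_eq]
    have ht : Q.t γ = w := by rcases hγ with rfl | rfl <;> simp [h.2.1, h.2.2.1]
    exact (Q.M γ).hasBar_eq_false (by rw [hs, ht, hw]) (by rw [ht, hw]; exact hC)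
  ext a
  rw [mem_outArrows_complexified_iff hC, h.1]
  simp only [Finset.mem_insert, Finset.mem_singleton]
  constructor
  · rintro (ha | ha)
    · exact Or.inl (cArrow_eq_fiber_of_hasBar ha (hbar _ (Or.inl rfl)))
    · exact Or.inr (cArrow_eq_fiber_of_hasBar ha (hbar _ (Or.inr rfl)))
  · rintro (rfl | rfl)
    · exact Or.inl rfl
    · exact Or.inr rfl

theorem IsInHalf.inArrows_of_eq (h : Q.IsInHalf x.1.1 u β β') (hC : Q.D x.1.1 ≠ .C)
    (hu : Q.D u = Q.D x.1.1) : Q.complexified.inArrows x = {Q.fiber β, Q.fiber β'} := by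
  have hbar : ∀ γ, γ = β ∨ γ = β' → (Q.M γ).hasBar = false := by
    intro γ hγ
    have ht : Q.t γ = x.1.1 := by rcases hγ with rfl | rfl <;> simp [h.t_eq]
    have hs : Q.s γ = u := by rcases hγ with rfl | rfl <;> simp [h.2.1, h.2.2.1]
    exact (Q.M γ).hasBar_eq_false (by rw [hs, ht, hu]) (by rw [ht]; exact hC)
  ext a
  rw [mem_inArrows_complexified_iff hC, h.1]
  simp only [Finset.mem_insert, Finset.mem_singleton]
  constructor
  · rintro (ha | ha)
    · exact Or.inl (cArrow_eq_fiber_of_hasBar ha (hbar _ (Or.inl rfl)))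
    · exact Or.inr (cArrow_eq_fiber_of_hasBar ha (hbar _ (Or.inr rfl)))
  · rintro (rfl | rfl)
    · exact Or.inl rfl
    · exact Or.inr rfl

/-- Here the half is a single arrow, and distinct division rings at its ends always give a conjugate
arrow `ᾱ`. -/
theorem IsOutHalf.outArrows_of_ne (h : Q.IsOutHalf x.1.1 w α α') (hC : Q.D x.1.1 ≠ .C)
    (hw : Q.D w ≠ Q.D x.1.1) : ∃ hb : true = true → (Q.M α).hasBar = true,
      Q.complexified.outArrows x = {Q.fiber α, ⟨(α, true), hb⟩} := by
  have hα : α = α' := by by_contra hne; exact hw (h.2.2.2.mp hne)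
  have hbar := (Q.M α).hasBar_of_ne (by rw [h.2.1, h.s_eq.1]; exact hw)
  refine ⟨fun _ => hbar, ?_⟩
  ext ⟨⟨γ, b⟩, hb⟩
  rw [mem_outArrows_complexified_iff hC, h.1, ← hα]
  cases b <;> simp [fiber]

theorem IsInHalf.inArrows_of_ne (h : Q.IsInHalf x.1.1 u β β') (hC : Q.D x.1.1 ≠ .C)
    (hu : Q.D u ≠ Q.D x.1.1) : ∃ hb : true = true → (Q.M β).hasBar = true,
      Q.complexified.inArrows x = {Q.fiber β, ⟨(β, true), hb⟩} := by
  have hβ : β = β' := by by_contra hne; exact hu (h.2.2.2.mp hne)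
  have hbar := (Q.M β).hasBar_of_ne (by rw [h.2.1, h.t_eq.1]; exact hu.symm)
  refine ⟨fun _ => hbar, ?_⟩
  ext ⟨⟨γ, b⟩, hb⟩
  rw [mem_inArrows_complexified_iff hC, h.1, ← hβ]
  cases b <;> simp [fiber]

theorem IsOutHalf.card_outArrows_le (h : Q.IsOutHalf x.1.1 w α α') (hC : Q.D x.1.1 ≠ .C) :
    (Q.complexified.outArrows x).card ≤ 2 := by
  by_cases hw : Q.D w = Q.D x.1.1
  · rw [h.outArrows_of_eq hC hw]; exact Finset.card_le_two
  · obtain ⟨hb, h'⟩ := h.outArrows_of_ne hC hw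
    rw [h']; exact Finset.card_le_two

theorem IsInHalf.card_inArrows_le (h : Q.IsInHalf x.1.1 u β β') (hC : Q.D x.1.1 ≠ .C) :
    (Q.complexified.inArrows x).card ≤ 2 := by
  by_cases hu : Q.D u = Q.D x.1.1
  · rw [h.inArrows_of_eq hC hu]; exact Finset.card_le_two
  · obtain ⟨hb, h'⟩ := h.inArrows_of_ne hC hu
    rw [h']; exact Finset.card_le_two

/-- Condition (G2) is vacuous if one side is empty, so `J` plays no role and only arrows have to be
counted. -/
theorem isGentleVertex_of_isDegenerate {J : TwoSidedIdeal (Q.complexified.PathAlgebra ℂ)}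
    (h : Q.IsDegenerate x.1.1) : Q.complexified.IsGentleVertex J x := by
  obtain ⟨hC, h⟩ := h
  have ho : Q.outArrows x.1.1 = ∅ → Q.complexified.outArrows x = ∅ := fun h' =>
    Finset.eq_empty_of_forall_notMem fun a ha => by
      rw [mem_outArrows_complexified_iff hC, h'] at ha; simp at ha
  have hi : Q.inArrows x.1.1 = ∅ → Q.complexified.inArrows x = ∅ := fun h' =>
    Finset.eq_empty_of_forall_notMem fun a ha => by
      rw [mem_inArrows_complexified_iff hC, h'] at ha; simp at ha
  rcases h with ⟨h, h'⟩ | ⟨h, w, α, α', h'⟩ | ⟨h, u, β, β', h'⟩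
  · exact ArrowQuiver.isGentleVertex_of_isEmpty _ (by simp [ho h']) (by simp [hi h])
      (Or.inl (ho h'))
  · exact ArrowQuiver.isGentleVertex_of_isEmpty _ (h'.card_outArrows_le hC) (by simp [hi h])
      (Or.inr (hi h))
  · exact ArrowQuiver.isGentleVertex_of_isEmpty _ (by simp [ho h]) (h'.card_inArrows_le hC)
      (Or.inl (ho h))

end ModulatedQuiver
end ComplexifiedGentle

namespace ComplexifiedGentle.ModulatedQuiver

variable {V E : Type*} {Q : ModulatedQuiver V E} [DecidableEq V] [DecidableEq E] [Fintype V]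
  [Fintype E] {I : TwoSidedIdeal Q.TensorAlg} {u w : V} {α α' β β' : E} {x : Q.CVertex}
  {d : Q.complexified.PathAlgebra ℂ ≃ₐ[ℂ] Q.complexified.PathAlgebra ℂ}

/-! ## Specially gentle vertices: the arrows of the complexified quiver -/

/-- The arrow `α` is alone in its half. If it also belonged to the pair `β ≠ β'`, the naming
convention would give `β = α = α' = β'`. So `d` fixes the arrows over it. -/
theorem SpecialCond.psiInvLin_symm_out {v : V} (h : Q.SpecialCond I v u w α α' β β')
    (hd : Q.DiagonalizesPairs α α' β β' d) (hw : Q.D w ≠ Q.D v) (b : Bool)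
    (hb : b = true → (Q.M α).hasBar = true) :
    Q.psiInvLin (d.symm (Q.complexified.arrow ℂ ⟨(α, b), hb⟩)) = Q.preArrow ⟨(α, b), hb⟩ := by
  have hα : α = α' := by by_contra hne; exact hw (h.isOutHalf.2.2.2.mp hne)
  refine hd.psiInvLin_symm_other (fun hne => absurd hα hne) fun hne => ⟨?_, ?_⟩
  · rintro (rfl : α = β)
    have := h.eq_of_eq (Or.inl rfl) (Or.inl rfl)
    exact hne (hα.trans this.2)
  · rintro (rfl : α = β')
    have := h.eq_of_eq (Or.inl rfl) (Or.inr rfl)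
    exact hne this.1.symm

theorem SpecialCond.psiInvLin_symm_in {v : V} (h : Q.SpecialCond I v u w α α' β β')
    (hd : Q.DiagonalizesPairs α α' β β' d) (hu : Q.D u ≠ Q.D v) (b : Bool)
    (hb : b = true → (Q.M β).hasBar = true) :
    Q.psiInvLin (d.symm (Q.complexified.arrow ℂ ⟨(β, b), hb⟩)) = Q.preArrow ⟨(β, b), hb⟩ := by
  have hβ : β = β' := by by_contra hne; exact hu (h.isInHalf.2.2.2.mp hne)
  refine hd.psiInvLin_symm_other (fun hne => ⟨?_, ?_⟩) fun hne => absurd hβ hne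
  · rintro (rfl : β = α)
    have := h.eq_of_eq (Or.inl rfl) (Or.inl rfl)
    exact hne (hβ.trans this.2.symm)
  · rintro (rfl : β = α')
    have := h.eq_of_eq (Or.inr rfl) (Or.inl rfl)
    exact hne this.1

theorem cx_vert_mul {i : V} (a : (Q.D i).carrier) (p q : Q.TensorAlg) :
    Q.cx (Q.vert i a) 0 * Q.cx p q = Q.cx (Q.vert i a * p) (Q.vert i a * q) := by
  rw [cx_mul, zero_mul, zero_mul, sub_zero, add_zero]

theorem cx_mul_vert {i : V} (a : (Q.D i).carrier) (p q : Q.TensorAlg) :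
    Q.cx p q * Q.cx (Q.vert i a) 0 = Q.cx (p * Q.vert i a) (q * Q.vert i a) := by
  rw [cx_mul, mul_zero, mul_zero, sub_zero, zero_add]

/-- Invertible elements of `𝓜(i)` do not matter for membership in an ideal. -/
theorem cx_vert_mul_mem_iff {i : V} {a b : (Q.D i).carrier} (hab : b * a = 1) {p q : Q.TensorAlg}
    (hp : Q.vert i 1 * p = p) (hq : Q.vert i 1 * q = q) (y : Q.CTensorAlg) :
    Q.cx (Q.vert i a * p) (Q.vert i a * q) * y ∈ Q.idealC I ↔ Q.cx p q * y ∈ Q.idealC I := by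
  refine (Q.mul_mem_idealC_congr_left (Q.cx_vert_mul a p q).symm
    (U' := Q.cx (Q.vert i b) 0) ?_ y).symm
  rw [cx_vert_mul, ← mul_assoc, ← mul_assoc, vert_mul, hab, hp, hq]

theorem mul_cx_mul_vert_mem_iff {i : V} {a b : (Q.D i).carrier} (hab : a * b = 1)
    {p q : Q.TensorAlg} (hp : p * Q.vert i 1 = p) (hq : q * Q.vert i 1 = q) (y : Q.CTensorAlg) :
    y * Q.cx (p * Q.vert i a) (q * Q.vert i a) ∈ Q.idealC I ↔ y * Q.cx p q ∈ Q.idealC I := by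
  refine (Q.mul_mem_idealC_congr_right (Q.cx_mul_vert a p q).symm
    (U' := Q.cx (Q.vert i b) 0) ?_ y).symm
  rw [cx_mul_vert, mul_assoc, mul_assoc, vert_mul, hab, hp, hq]

/-! ### Vertices with modulation `ℝ` -/

variable (Q) in
/-- The imaginary part of the first arrow which starts at a vertex with modulation `ℝ`. -/
noncomputable def outIm (w : V) (α α' : E) : Q.TensorAlg :=
  if Q.D w = .R then Q.genArr α' else -(Q.iotaAt w * Q.genArr α)

variable (Q) in
/-- The imaginary part of the first arrow which ends at a vertex with modulation `ℝ`. -/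
noncomputable def inIm (u : V) (β β' : E) : Q.TensorAlg :=
  if Q.D u = .R then Q.genArr β' else -(Q.genArr β * Q.iotaAt u)

theorem preArrow_fiber_of_eq_R {γ : E} (ht : Q.D (Q.t γ) = .R) (hs : Q.D (Q.s γ) = .R) :
    Q.preArrow (Q.fiber γ) = Q.cx (Q.genArr γ) 0 := by
  obtain ⟨h₁, h₂⟩ := (Q.M γ).pre_of_eq_R ht hs false
  change Q.cx (Q.arr γ ((Q.M γ).preRe false)) (Q.arr γ ((Q.M γ).preIm false)) = _
  rw [h₁, h₂, arr_zero]
  rfl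

theorem cx_add_I_smul (p q p' q' : Q.TensorAlg) :
    Q.cx p q + Complex.I • Q.cx p' q' = Q.cx (p - q') (q + p') := by
  rw [I_smul_cx, cx_add, ← sub_eq_add_neg]

theorem cx_sub_I_smul (p q p' q' : Q.TensorAlg) :
    Q.cx p q - Complex.I • Q.cx p' q' = Q.cx (p + q') (q - p') := by
  rw [I_smul_cx, cx_sub, sub_neg_eq_add]

theorem vert_one_mul_vert_mul {i : V} (a : (Q.D i).carrier) (p : Q.TensorAlg) :
    Q.vert i 1 * (Q.vert i a * p) = Q.vert i a * p := by
  rw [← mul_assoc, vert_mul, one_mul]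

theorem vert_one_mul_genArr {i : V} {γ : E} (h : Q.t γ = i) :
    Q.vert i 1 * Q.genArr γ = Q.genArr γ := by
  subst h; exact Q.vert_one_mul_arr _ _

theorem genArr_mul_vert_one {i : V} {γ : E} (h : Q.s γ = i) :
    Q.genArr γ * Q.vert i 1 = Q.genArr γ := by
  subst h; exact Q.arr_mul_vert_one _ _

/-- The two arrows take the form `G ± G* ⊗ i` in all cases. For a pair the sum comes from `d⁻¹`; for
a single arrow it comes from the idempotent at `w`, so that `G* = -ιG`. -/
theorem SpecialCond.exists_outArrows_R (h : Q.SpecialCond I x.1.1 u w α α' β β')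
    (hd : Q.DiagonalizesPairs α α' β β' d) (hv : Q.D x.1.1 = .R) :
    ∃ a₁ a₂, Q.complexified.outArrows x = {a₁, a₂} ∧
      (∀ y, Q.psiInvLin (d.symm (Q.complexified.arrow ℂ a₁)) * y ∈ Q.idealC I ↔
        Q.cx (Q.genArr α) (Q.outIm w α α') * y ∈ Q.idealC I) ∧
      (∀ y, Q.psiInvLin (d.symm (Q.complexified.arrow ℂ a₂)) * y ∈ Q.idealC I ↔
        Q.cx (Q.genArr α) (-Q.outIm w α α') * y ∈ Q.idealC I) := by
  have ho := h.isOutHalf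
  have hs : Q.D (Q.s α) = .R := by rw [ho.s_eq.1, hv]
  by_cases hw : Q.D w = .R
  · have hne : α ≠ α' := ho.2.2.2.mpr (hw.trans hv.symm)
    obtain ⟨e₁, e₂⟩ := hd.psiInvLin_symm_pair hne (Or.inl ⟨rfl, rfl⟩)
    rw [preArrow_fiber_of_eq_R (by rw [ho.2.1, hw]) hs,
      preArrow_fiber_of_eq_R (by rw [ho.2.2.1, hw]) (by rw [ho.s_eq.2, hv])] at e₁ e₂
    refine ⟨_, _, ho.outArrows_of_eq h.ne_C (hw.trans hv.symm), fun y => ?_, fun y => ?_⟩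
    · rw [e₁, cx_add_I_smul, sub_zero, zero_add, outIm, if_pos hw]
    · rw [e₂, cx_sub_I_smul, add_zero, zero_sub, outIm, if_pos hw]
  · have hw' : Q.D w ≠ Q.D x.1.1 := by rw [hv]; exact hw
    have ht : Q.D (Q.t α) ≠ .R := by rw [ho.2.1]; exact hw
    obtain ⟨hb, hout⟩ := ho.outArrows_of_ne h.ne_C hw'
    refine ⟨_, _, hout, fun y => ?_, fun y => ?_⟩
    · rw [fiber, h.psiInvLin_symm_out hd hw', ← Q.smul_mul_mem_idealC_iff two_ne_zero,
        two_smul_preArrow, ((Q.M α).two_pre_false_of_right_R ht hs).1,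
        ((Q.M α).two_pre_false_of_right_R ht hs).2, outIm, if_neg hw, arr_neg,
        ← Q.iotaAt_mul_arr ho.2.1]
      rfl
    -- The conjugate arrow is a multiple by a unit `c` of `𝓜(w)`, which is cancelled.
    · obtain ⟨c, hc, e₁, e₂⟩ := (Q.M α).two_pre_true_of_right_R ht hs
      rw [h.psiInvLin_symm_out hd hw', ← Q.smul_mul_mem_idealC_iff two_ne_zero,
        two_smul_preArrow, e₁, e₂, ← vert_mul_arr, ← vert_mul_arr, outIm, if_neg hw, neg_neg,
        cx_vert_mul_mem_iff (inv_mul_cancel₀ hc) (Q.vert_one_mul_arr _ _)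
          (Q.vert_one_mul_arr _ _), ← Q.iotaAt_mul_arr ho.2.1]
      rfl

theorem SpecialCond.exists_inArrows_R (h : Q.SpecialCond I x.1.1 u w α α' β β')
    (hd : Q.DiagonalizesPairs α α' β β' d) (hv : Q.D x.1.1 = .R) :
    ∃ b₁ b₂, Q.complexified.inArrows x = {b₁, b₂} ∧
      (∀ y, y * Q.psiInvLin (d.symm (Q.complexified.arrow ℂ b₁)) ∈ Q.idealC I ↔
        y * Q.cx (Q.genArr β) (Q.inIm u β β') ∈ Q.idealC I) ∧
      (∀ y, y * Q.psiInvLin (d.symm (Q.complexified.arrow ℂ b₂)) ∈ Q.idealC I ↔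
        y * Q.cx (Q.genArr β) (-Q.inIm u β β') ∈ Q.idealC I) := by
  have hi := h.isInHalf
  have ht : Q.D (Q.t β) = .R := by rw [hi.t_eq.1, hv]
  by_cases hu : Q.D u = .R
  · have hne : β ≠ β' := hi.2.2.2.mpr (hu.trans hv.symm)
    obtain ⟨e₁, e₂⟩ := hd.psiInvLin_symm_pair hne (Or.inr ⟨rfl, rfl⟩)
    rw [preArrow_fiber_of_eq_R ht (by rw [hi.2.1, hu]),
      preArrow_fiber_of_eq_R (by rw [hi.t_eq.2, hv]) (by rw [hi.2.2.1, hu])] at e₁ e₂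
    refine ⟨_, _, hi.inArrows_of_eq h.ne_C (hu.trans hv.symm), fun y => ?_, fun y => ?_⟩
    · rw [e₁, cx_add_I_smul, sub_zero, zero_add, inIm, if_pos hu]
    · rw [e₂, cx_sub_I_smul, add_zero, zero_sub, inIm, if_pos hu]
  · have hu' : Q.D u ≠ Q.D x.1.1 := by rw [hv]; exact hu
    have hs : Q.D (Q.s β) ≠ .R := by rw [hi.2.1]; exact hu
    obtain ⟨hb, hin⟩ := hi.inArrows_of_ne h.ne_C hu'
    refine ⟨_, _, hin, fun y => ?_, fun y => ?_⟩
    · rw [fiber, h.psiInvLin_symm_in hd hu', ← Q.mul_smul_mem_idealC_iff two_ne_zero,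
        two_smul_preArrow, ((Q.M β).two_pre_false_of_left_R ht hs).1,
        ((Q.M β).two_pre_false_of_left_R ht hs).2, inIm, if_neg hu, arr_neg,
        ← Q.arr_mul_iotaAt hi.2.1]
      rfl
    · obtain ⟨c, hc, e₁, e₂⟩ := (Q.M β).two_pre_true_of_left_R ht hs
      rw [h.psiInvLin_symm_in hd hu', ← Q.mul_smul_mem_idealC_iff two_ne_zero,
        two_smul_preArrow, e₁, e₂, ← arr_mul_vert, ← arr_mul_vert, inIm, if_neg hu, neg_neg,
        mul_cx_mul_vert_mem_iff (mul_inv_cancel₀ hc) (Q.arr_mul_vert_one _ _)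
          (Q.arr_mul_vert_one _ _), ← Q.arr_mul_iotaAt hi.2.1]
      rfl

theorem neg_sub_mem_iff {a b : Q.TensorAlg} : -a - b ∈ I ↔ a + b ∈ I := by
  rw [← neg_mem_twoSidedIdeal_iff, neg_sub', neg_neg, sub_neg_eq_add]

/-- In terms of `G`, `G*`, `B`, `B*` the nine rows of the table with `𝓜(v) = ℝ` become one. Only
`ℝℝℝ` lists both relations; in the other rows a unit at `w` or `u` yields the second from the first.
-/
theorem mem_and_mem_iff_of_R (ho : Q.IsOutHalf x.1.1 w α α') (hi : Q.IsInHalf x.1.1 u β β')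
    (hv : Q.D x.1.1 = .R) :
    ((∀ r ∈ Q.rel₀ α α' β β' (Q.D u) (Q.D x.1.1) (Q.D w), r ∈ I) ↔
      Q.genArr α * Q.genArr β - Q.outIm w α α' * Q.inIm u β β' ∈ I ∧
        Q.genArr α * Q.inIm u β β' + Q.outIm w α α' * Q.genArr β ∈ I) ∧
    ((∀ r ∈ Q.rel₁ α α' β β' (Q.D u) (Q.D x.1.1) (Q.D w), r ∈ I) ↔
      Q.genArr α * Q.genArr β + Q.outIm w α α' * Q.inIm u β β' ∈ I ∧
        Q.genArr α * Q.inIm u β β' - Q.outIm w α α' * Q.genArr β ∈ I) := by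
  have hsα : Q.D (Q.s α) = .R := by rw [ho.s_eq.1, hv]
  have hsα' : Q.D (Q.s α') = .R := by rw [ho.s_eq.2, hv]
  have htβ : Q.D (Q.t β) = .R := by rw [hi.t_eq.1, hv]
  have htβ' : Q.D (Q.t β') = .R := by rw [hi.t_eq.2, hv]
  have oα : Q.arr α ((Q.M α).elt .o) = Q.genArr α :=
    congrArg _ ((Q.M α).elt_o (Or.inl (Or.inr hsα)))
  have oα' : Q.arr α' ((Q.M α').elt .o) = Q.genArr α' :=
    congrArg _ ((Q.M α').elt_o (Or.inl (Or.inr hsα')))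
  have oβ : Q.arr β ((Q.M β).elt .o) = Q.genArr β :=
    congrArg _ ((Q.M β).elt_o (Or.inl (Or.inl htβ)))
  have oβ' : Q.arr β' ((Q.M β').elt .o) = Q.genArr β' :=
    congrArg _ ((Q.M β').elt_o (Or.inl (Or.inl htβ')))
  have iα (hw : Q.D w = .C) : Q.arr α ((Q.M α).elt .i) = -Q.outIm w α α' := by
    rw [outIm, if_neg (by simp [hw]), neg_neg, genArr, Q.iotaAt_mul_arr ho.2.1,
      (Q.M α).elt_i_left (by rw [ho.2.1, hw]) hsα]
  have jα (hw : Q.D w = .H) : Q.arr α ((Q.M α).elt .j) = -Q.outIm w α α' := by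
    rw [outIm, if_neg (by simp [hw]), neg_neg, genArr, Q.iotaAt_mul_arr ho.2.1,
      (Q.M α).elt_j_left (by rw [ho.2.1, hw]) (by simp [hsα])]
  have iβ (hu : Q.D u = .C) : Q.arr β ((Q.M β).elt .i) = -Q.inIm u β β' := by
    rw [inIm, if_neg (by simp [hu]), neg_neg, genArr, Q.arr_mul_iotaAt hi.2.1,
      (Q.M β).elt_i_right htβ (by rw [hi.2.1, hu])]
  have jβ (hu : Q.D u = .H) : Q.arr β ((Q.M β).elt .j) = -Q.inIm u β β' := by
    rw [inIm, if_neg (by simp [hu]), neg_neg, genArr, Q.arr_mul_iotaAt hi.2.1,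
      (Q.M β).elt_j_right (by simp [htβ]) (by rw [hi.2.1, hu])]
  have pα (hw : Q.D w = .R) : Q.genArr α' = Q.outIm w α α' := by rw [outIm, if_pos hw]
  have pβ (hu : Q.D u = .R) : Q.genArr β' = Q.inIm u β β' := by rw [inIm, if_pos hu]
  -- Left multiplication by `ι` at `w` sends `G*` to `G` and `G` to `-G*`; `hr` is the mirror image
  -- at `u`.
  have hl (hw : Q.D w ≠ .R) : Q.iotaAt w * Q.outIm w α α' = Q.genArr α ∧
      Q.iotaAt w * Q.genArr α = -Q.outIm w α α' := by
    rw [outIm, if_neg hw, neg_neg, mul_neg_tensorAlg, genArr, Q.iotaAt_iotaAt_mul_arr ho.2.1 hw,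
      neg_neg]
    exact ⟨rfl, rfl⟩
  have hr (hu : Q.D u ≠ .R) : Q.inIm u β β' * Q.iotaAt u = Q.genArr β ∧
      Q.genArr β * Q.iotaAt u = -Q.inIm u β β' := by
    rw [inIm, if_neg hu, neg_neg, neg_mul_tensorAlg, genArr, Q.arr_mul_iotaAt_iotaAt hi.2.1 hu,
      neg_neg]
    exact ⟨rfl, rfl⟩
  have imp (hwu : Q.D w ≠ .R ∨ Q.D u ≠ .R) :
      (Q.genArr α * Q.genArr β - Q.outIm w α α' * Q.inIm u β β' ∈ I →
        Q.genArr α * Q.inIm u β β' + Q.outIm w α α' * Q.genArr β ∈ I) ∧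
      (Q.genArr α * Q.genArr β + Q.outIm w α α' * Q.inIm u β β' ∈ I →
        Q.genArr α * Q.inIm u β β' - Q.outIm w α α' * Q.genArr β ∈ I) := by
    rcases hwu with hw | hu
    · exact mem_imp_of_left (hl hw).1 (hl hw).2
    · exact mem_imp_of_right (hr hu).1 (hr hu).2
  rw [hv]
  cases hu : Q.D u <;> cases hw : Q.D w <;>
    simp only [rel₀, rel₁, tens, Set.mem_insert_iff, Set.mem_singleton_iff, forall_eq_or_imp,
      forall_eq, oα, oα', oβ, oβ', iα, jα, iβ, jβ, pα, pβ, hu, hw, neg_mul_tensorAlg,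
      mul_neg_tensorAlg, neg_neg, sub_neg_eq_add, ← sub_eq_add_neg]
  -- The second relation of `I_v^0` is the negative of the imaginary component.
  case R.R => exact ⟨and_congr_right fun _ => neg_sub_mem_iff, trivial⟩
  all_goals
    have imp' := imp (by simp [hu, hw])
    exact ⟨⟨fun h => ⟨h, imp'.1 h⟩, And.left⟩, ⟨fun h => ⟨h, imp'.2 h⟩, And.left⟩⟩

/-- A vertex of the complexified quiver is gentle if the products of the elements which represent the
arrows at it are governed by the relations of the special local quiver. -/
theorem SpecialCond.isGentleVertex_of_mul_mem_iff (h : Q.SpecialCond I x.1.1 u w α α' β β')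
    {a₁ a₂ b₁ b₂ : Q.CArrow} {A₁ A₂ B₁ B₂ : Q.CTensorAlg}
    (hout : Q.complexified.outArrows x = {a₁, a₂}) (hin : Q.complexified.inArrows x = {b₁, b₂})
    (ha₁ : ∀ y, Q.psiInvLin (d.symm (Q.complexified.arrow ℂ a₁)) * y ∈ Q.idealC I ↔
      A₁ * y ∈ Q.idealC I)
    (ha₂ : ∀ y, Q.psiInvLin (d.symm (Q.complexified.arrow ℂ a₂)) * y ∈ Q.idealC I ↔
      A₂ * y ∈ Q.idealC I)
    (hb₁ : ∀ y, y * Q.psiInvLin (d.symm (Q.complexified.arrow ℂ b₁)) ∈ Q.idealC I ↔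
      y * B₁ ∈ Q.idealC I)
    (hb₂ : ∀ y, y * Q.psiInvLin (d.symm (Q.complexified.arrow ℂ b₂)) ∈ Q.idealC I ↔
      y * B₂ ∈ Q.idealC I)
    (h₁₁ : A₁ * B₁ ∈ Q.idealC I ↔ ∀ r ∈ Q.rel₀ α α' β β' (Q.D u) (Q.D x.1.1) (Q.D w), r ∈ I)
    (h₂₂ : A₂ * B₂ ∈ Q.idealC I ↔ ∀ r ∈ Q.rel₀ α α' β β' (Q.D u) (Q.D x.1.1) (Q.D w), r ∈ I)
    (h₁₂ : A₁ * B₂ ∈ Q.idealC I ↔ ∀ r ∈ Q.rel₁ α α' β β' (Q.D u) (Q.D x.1.1) (Q.D w), r ∈ I)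
    (h₂₁ : A₂ * B₁ ∈ Q.idealC I ↔ ∀ r ∈ Q.rel₁ α α' β β' (Q.D u) (Q.D x.1.1) (Q.D w), r ∈ I) :
    Q.complexified.IsGentleVertex (Q.twistedIdeal I d) x := by
  have hrel := h.rel
  rw [Q.bimodSpan_le_iff (Q.rel₀_subset_cornerSpace h.isOutHalf.2.1 h.isOutHalf.2.2.1 h.isInHalf.2.1
      h.isInHalf.2.2.1 _ _ _), Q.bimodSpan_le_iff (Q.rel₁_subset_cornerSpace h.isOutHalf.2.1
      h.isOutHalf.2.2.1 h.isInHalf.2.1 h.isInHalf.2.2.1 _ _ _)] at hrel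
  refine Q.complexified.isGentleVertex_of_pairs hout hin hrel ?_ ?_ ?_ ?_
  · rw [mul_mem_twistedIdeal, ha₁, hb₁, h₁₁]
  · rw [mul_mem_twistedIdeal, ha₂, hb₂, h₂₂]
  · rw [mul_mem_twistedIdeal, ha₁, hb₂, h₁₂]
  · rw [mul_mem_twistedIdeal, ha₂, hb₁, h₂₁]

/-- Changing the sign of one of `G*`, `B*` exchanges the two systems of relations, while changing
both preserves each of them. -/
theorem SpecialCond.isGentleVertex_of_R (h : Q.SpecialCond I x.1.1 u w α α' β β')
    (hd : Q.DiagonalizesPairs α α' β β' d) (hv : Q.D x.1.1 = .R) :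
    Q.complexified.IsGentleVertex (Q.twistedIdeal I d) x := by
  obtain ⟨a₁, a₂, hout, ha₁, ha₂⟩ := h.exists_outArrows_R hd hv
  obtain ⟨b₁, b₂, hin, hb₁, hb₂⟩ := h.exists_inArrows_R hd hv
  obtain ⟨h₀, h₁⟩ := mem_and_mem_iff_of_R (I := I) h.isOutHalf h.isInHalf hv
  refine h.isGentleVertex_of_mul_mem_iff hout hin ha₁ ha₂ hb₁ hb₂ ?_ ?_ ?_ ?_
  · rw [cx_mul, cx_mem_idealC, h₀]
  · rw [cx_mul, cx_mem_idealC, h₀]; exact mem_and_mem_neg_neg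
  · rw [cx_mul, cx_mem_idealC, h₁]; exact mem_and_mem_right_neg
  · rw [cx_mul, cx_mem_idealC, h₁]; exact mem_and_mem_left_neg

end ComplexifiedGentle.ModulatedQuiver

namespace ComplexifiedGentle.ModulatedQuiver

/-! ### Identities for `J² = K² = -e` and `KJ = -JK`, where `e` is a local unit -/

section RingLemmas

variable {R : Type*} [Ring R] {I : TwoSidedIdeal R} {e J K G G' B B' X Y : R}

theorem mul_kappa_kappa_mul (hK : K * K = -e) (hY : e * Y = Y) : X * K * (K * Y) = -(X * Y) := by
  rw [mul_assoc, ← mul_assoc K, hK, neg_mul, hY, mul_neg]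

theorem mul_kappa_iota_kappa_mul (hK : K * K = -e) (hKJ : K * J = -(J * K)) (hY : e * Y = Y) :
    X * K * (J * (K * Y)) = X * (J * Y) := by
  rw [mul_assoc, ← mul_assoc K, hKJ, neg_mul, mul_assoc J, ← mul_assoc K, hK, neg_mul, hY, mul_neg,
    mul_neg, mul_neg, neg_neg]

theorem mul_kappa_iota_mul (hKJ : K * J = -(J * K)) :
    X * K * (J * Y) = -(X * (J * (K * Y))) := by
  rw [mul_assoc, ← mul_assoc K, hKJ, neg_mul, mul_neg, mul_assoc J]

theorem mul_add_iota_mul (hKJ : K * J = -(J * K)) :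
    G * (K * (B + J * B')) = G * (K * B) - G * (J * (K * B')) := by
  rw [mul_add, ← mul_assoc K J, hKJ, neg_mul, mul_assoc J, ← sub_eq_add_neg, mul_sub]

theorem add_mul_iota_mul : (G + G' * J) * Y = G * Y + G' * (J * Y) := by
  rw [add_mul, mul_assoc]

/-- The expansion of `XY` with `X = G + G'J` and `Y = B + JB'` is the generator of `I_v^0` in the
case `ℍℍℍ`; the next identity expands `XKY` for `I_v^1`. -/
theorem add_mul_iota_mul_add (hJ : J * J = -e) (hB : e * B' = B') :
    (G + G' * J) * (B + J * B') = G * B - G' * B' + G * (J * B') + G' * (J * B) := by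
  rw [add_mul_iota_mul, mul_add J, ← mul_assoc J J, hJ, neg_mul, hB]; noncomm_ring

theorem add_mul_iota_mul_kappa_add (hJ : J * J = -e) (hKJ : K * J = -(J * K))
    (hB : e * (K * B') = K * B') :
    (G + G' * J) * (K * (B + J * B')) =
      G * (K * B) + G' * (K * B') - G * (J * (K * B')) + G' * (J * (K * B)) := by
  have h : J * (J * (K * B')) = -(K * B') := by rw [← mul_assoc, hJ, neg_mul, hB]
  rw [add_mul_iota_mul, mul_add_iota_mul hKJ, mul_add_iota_mul hKJ, h]; noncomm_ring

theorem add_mul_iota_mul_iota (hJ : J * J = -e) (hG : G' * e = G') :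
    -((G + G' * J) * J) = -(G * J) + G' := by
  rw [add_mul, mul_assoc G', hJ, mul_neg, hG]; abel

theorem iota_mul_add_iota_mul (hJ : J * J = -e) (hB : e * B' = B') :
    -(J * (B + J * B')) = -(J * B) + B' := by
  rw [mul_add, ← mul_assoc J J, hJ, neg_mul, hB]; abel

/-- Here `L` is the unit `𝐤` at the other end of the arrows. Moving it through the generators and
past `J` changes a sign, and so turns the second arrow of a pair into the form `XK`. -/
theorem kappa_mul_sub_mul_iota {L : R} (hKJ : K * J = -(J * K)) (hG : L * G = G * K)
    (hG' : L * G' = G' * K) : L * (G + -(G' * J)) = (G + G' * J) * K := by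
  rw [mul_add, mul_neg, ← mul_assoc L, hG, hG', mul_assoc, hKJ]; noncomm_ring

theorem kappa_mul_neg_mul_iota_sub {L : R} (hJ : J * J = -e) (hKJ : K * J = -(J * K))
    (hG : L * G = G * K) (hG' : L * G' = G' * K) (he : G' * e = G') :
    L * (-(G * J) - G') = -((G + G' * J) * K * J) := by
  have h : G' * (J * K) * J = G' * K := by
    rw [mul_assoc, mul_assoc, hKJ, mul_neg, ← mul_assoc J J, hJ, neg_mul, neg_neg, ← mul_assoc, he]
  rw [mul_sub, mul_neg, ← mul_assoc, hG, hG', add_mul, mul_assoc G', add_mul, h]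
  abel

theorem sub_iota_mul_mul_kappa {L : R} (hKJ : K * J = -(J * K)) (hB : B * L = K * B)
    (hB' : B' * L = K * B') : (B + -(J * B')) * L = K * (B + J * B') := by
  rw [add_mul, neg_mul, mul_assoc, hB, hB', mul_add, ← mul_assoc K, hKJ]; noncomm_ring

theorem neg_iota_mul_sub_mul_kappa {L : R} (hJ : J * J = -e) (hKJ : K * J = -(J * K))
    (hB : B * L = K * B) (hB' : B' * L = K * B') (he : e * (K * B') = K * B') :
    (-(J * B) - B') * L = -(J * (K * (B + J * B'))) := by
  have h : J * (J * (K * B')) = -(K * B') := by rw [← mul_assoc, hJ, neg_mul, he]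
  rw [mul_add_iota_mul hKJ, h, sub_mul, neg_mul, mul_assoc, hB, hB']; noncomm_ring

theorem mem_iff_mem_and_mem_of_eq {a b c : R} (h : c = a) (imp : a ∈ I → b ∈ I) :
    c ∈ I ↔ a ∈ I ∧ b ∈ I :=
  h.symm ▸ ⟨fun h => ⟨h, imp h⟩, And.left⟩

end RingLemmas

variable {V E : Type*} {Q : ModulatedQuiver V E} [DecidableEq V] [DecidableEq E] [Fintype V]
  [Fintype E] {I : TwoSidedIdeal Q.TensorAlg} {u w : V} {α α' β β' : E} {x : Q.CVertex}
  {d : Q.complexified.PathAlgebra ℂ ≃ₐ[ℂ] Q.complexified.PathAlgebra ℂ}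

/-! ### Vertices with modulation `ℍ` -/

theorem iotaAt_mul_iotaAt {v : V} (hv : Q.D v ≠ .R) : Q.iotaAt v * Q.iotaAt v = -Q.vert v 1 := by
  rw [iotaAt, vert_mul, DivRing.iota_mul_iota hv, vert_neg]

theorem kappaAt_mul_kappaAt {v : V} (hv : Q.D v = .H) :
    Q.kappaAt v * Q.kappaAt v = -Q.vert v 1 := by
  rw [kappaAt, vert_mul, DivRing.kappa_mul_kappa hv, vert_neg]

theorem kappaAt_mul_iotaAt {v : V} (hv : Q.D v = .H) :
    Q.kappaAt v * Q.iotaAt v = -(Q.iotaAt v * Q.kappaAt v) := by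
  rw [kappaAt, iotaAt, vert_mul, DivRing.kappa_mul_iota hv, vert_neg, vert_mul]

theorem iotaAt_mul_genArr {v w : V} {γ : E} (ht : Q.t γ = w) (hs : Q.s γ = v) (hw : Q.D w ≠ .R)
    (hv : Q.D v ≠ .R) (h : Q.D w = .H ∨ Q.D v = .H) :
    Q.iotaAt w * Q.genArr γ = Q.genArr γ * Q.iotaAt v := by
  rw [genArr, Q.iotaAt_mul_arr ht, Q.arr_mul_iotaAt hs]
  subst ht hs
  rw [(Q.M γ).iota_smul_gen hw hv h]

theorem kappaAt_mul_genArr {v w : V} {γ : E} (ht : Q.t γ = w) (hs : Q.s γ = v) (hw : Q.D w = .H)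
    (hv : Q.D v = .H) : Q.kappaAt w * Q.genArr γ = Q.genArr γ * Q.kappaAt v := by
  rw [genArr, Q.kappaAt_mul_arr ht, Q.arr_mul_kappaAt hs]
  subst ht hs
  rw [(Q.M γ).kappa_smul_gen hw hv]

variable (Q) in
/-- The element `X` such that the arrows which start at a vertex `v` with modulation `ℍ` correspond to
`Xε` and `X𝐤ε`, where `ε = (1 - 𝐣 ⊗ 𝐢) / 2`. -/
noncomputable def outPart (v w : V) (α α' : E) : Q.TensorAlg :=
  if Q.D w = .H then Q.genArr α + Q.genArr α' * Q.iotaAt v else Q.genArr α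

variable (Q) in
/-- The element `Y` such that the arrows which end at a vertex `v` with modulation `ℍ` correspond to
`εY` and `ε𝐤Y`. -/
noncomputable def inPart (v u : V) (β β' : E) : Q.TensorAlg :=
  if Q.D u = .H then Q.genArr β + Q.iotaAt v * Q.genArr β' else Q.genArr β

theorem two_smul_preArrow_fiber_of_right_H {v : V} {γ : E} (hs : Q.s γ = v) (hv : Q.D v = .H) :
    (2 : ℂ) • Q.preArrow (Q.fiber γ) = Q.cx (Q.genArr γ) (-(Q.genArr γ * Q.iotaAt v)) := by
  rw [two_smul_preArrow, genArr, Q.arr_mul_iotaAt hs, ← arr_neg]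
  subst hs
  obtain ⟨e₁, e₂⟩ := (Q.M γ).two_pre_false_of_right_H hv
  change Q.cx (Q.arr γ ((Q.M γ).preRe false + (Q.M γ).preRe false))
    (Q.arr γ ((Q.M γ).preIm false + (Q.M γ).preIm false)) = _
  rw [e₁, e₂]

theorem two_smul_preArrow_fiber_of_left_H {v : V} {γ : E} (ht : Q.t γ = v) (hv : Q.D v = .H) :
    (2 : ℂ) • Q.preArrow (Q.fiber γ) = Q.cx (Q.genArr γ) (-(Q.iotaAt v * Q.genArr γ)) := by
  rw [two_smul_preArrow, genArr, Q.iotaAt_mul_arr ht, ← arr_neg]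
  subst ht
  obtain ⟨e₁, e₂⟩ := (Q.M γ).two_pre_false_of_left_H hv
  change Q.cx (Q.arr γ ((Q.M γ).preRe false + (Q.M γ).preRe false))
    (Q.arr γ ((Q.M γ).preIm false + (Q.M γ).preIm false)) = _
  rw [e₁, e₂]

/-- The factor `-2` compensates the minus sign in the preimage of `ᾱ`. -/
theorem neg_two_smul_preArrow_true_of_right_H {v : V} {γ : E}
    (hb : true = true → (Q.M γ).hasBar = true) (hs : Q.s γ = v) (hv : Q.D v = .H)
    (ht : Q.D (Q.t γ) ≠ .H) :
    (-2 : ℂ) • Q.preArrow ⟨(γ, true), hb⟩ = Q.cx (Q.genArr γ * Q.kappaAt v)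
      (-(Q.genArr γ * Q.kappaAt v * Q.iotaAt v)) := by
  rw [neg_smul, two_smul_preArrow, genArr, Q.arr_mul_kappaAt hs,
    Q.arr_mul_iotaAt hs, ← zero_sub, show (0 : Q.CTensorAlg) = Q.cx 0 0 by simp [cx], cx_sub,
    zero_sub, zero_sub, ← arr_neg, ← arr_neg, ← arr_neg]
  subst hs
  obtain ⟨e₁, e₂⟩ := (Q.M γ).two_pre_true_of_right_H ht hv
  rw [e₁, e₂, neg_neg]

theorem two_smul_preArrow_true_of_left_H {v : V} {γ : E} (hb : true = true → (Q.M γ).hasBar = true)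
    (ht : Q.t γ = v) (hv : Q.D v = .H) (hs : Q.D (Q.s γ) ≠ .H) :
    (2 : ℂ) • Q.preArrow ⟨(γ, true), hb⟩ = Q.cx (Q.kappaAt v * Q.genArr γ)
      (-(Q.iotaAt v * (Q.kappaAt v * Q.genArr γ))) := by
  rw [two_smul_preArrow, genArr, Q.kappaAt_mul_arr ht, Q.iotaAt_mul_arr ht, ← arr_neg]
  subst ht
  obtain ⟨e₁, e₂⟩ := (Q.M γ).two_pre_true_of_left_H hv hs
  rw [e₁, e₂]

/-- For a single arrow, `α` and `ᾱ` have the forms `Xε` and `X𝐤ε` up to a scalar. For a pair, `α +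
𝐢α'` gives `Xε` with `X = G + G'𝐣`, and `α - 𝐢α'` gives `X𝐤ε` after left multiplication by `𝐤` at
`w`. -/
theorem SpecialCond.exists_outArrows_H (h : Q.SpecialCond I x.1.1 u w α α' β β')
    (hd : Q.DiagonalizesPairs α α' β β' d) (hv : Q.D x.1.1 = .H) :
    ∃ a₁ a₂, Q.complexified.outArrows x = {a₁, a₂} ∧
      (∀ y, Q.psiInvLin (d.symm (Q.complexified.arrow ℂ a₁)) * y ∈ Q.idealC I ↔
        Q.cx (Q.outPart x.1.1 w α α') (-(Q.outPart x.1.1 w α α' * Q.iotaAt x.1.1)) * y ∈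
          Q.idealC I) ∧
      (∀ y, Q.psiInvLin (d.symm (Q.complexified.arrow ℂ a₂)) * y ∈ Q.idealC I ↔
        Q.cx (Q.outPart x.1.1 w α α' * Q.kappaAt x.1.1)
          (-(Q.outPart x.1.1 w α α' * Q.kappaAt x.1.1 * Q.iotaAt x.1.1)) * y ∈ Q.idealC I) := by
  have ho := h.isOutHalf
  have hJ := iotaAt_mul_iotaAt (Q := Q) (v := x.1.1) (by simp [hv])
  have hKJ := kappaAt_mul_iotaAt (Q := Q) hv
  by_cases hw : Q.D w = .H
  · have hne : α ≠ α' := ho.2.2.2.mpr (hw.trans hv.symm)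
    obtain ⟨e₁, e₂⟩ := hd.psiInvLin_symm_pair hne (Or.inl ⟨rfl, rfl⟩)
    have gα := vert_one_mul_genArr (Q := Q) ho.2.1
    have gα' := vert_one_mul_genArr (Q := Q) ho.2.2.1
    have kα := kappaAt_mul_genArr (Q := Q) ho.2.1 ho.s_eq.1 hw hv
    have kα' := kappaAt_mul_genArr (Q := Q) ho.2.2.1 ho.s_eq.2 hw hv
    refine ⟨_, _, ho.outArrows_of_eq h.ne_C (hw.trans hv.symm), fun y => ?_, fun y => ?_⟩
    · rw [← Q.smul_mul_mem_idealC_iff two_ne_zero, e₁, smul_add, smul_comm,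
        two_smul_preArrow_fiber_of_right_H ho.s_eq.1 hv,
        two_smul_preArrow_fiber_of_right_H ho.s_eq.2 hv, cx_add_I_smul, outPart, if_pos hw,
        add_mul_iota_mul_iota hJ (genArr_mul_vert_one ho.s_eq.2), sub_neg_eq_add]
    · rw [← Q.smul_mul_mem_idealC_iff two_ne_zero, e₂, smul_sub, smul_comm,
        two_smul_preArrow_fiber_of_right_H ho.s_eq.1 hv,
        two_smul_preArrow_fiber_of_right_H ho.s_eq.2 hv, cx_sub_I_smul, outPart, if_pos hw,
        -- The unit `𝐤` at `w`, with inverse `-𝐤`, is inserted on the left.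
        ← cx_vert_mul_mem_iff (a := (Q.D w).kappa) (b := -(Q.D w).kappa)
          (by rw [neg_mul, DivRing.kappa_mul_kappa hw, neg_neg])
          (by rw [mul_add, mul_neg_tensorAlg, ← mul_assoc, gα, gα'])
          (by rw [mul_sub, mul_neg_tensorAlg, ← mul_assoc, gα, gα']),
        ← kappaAt, kappa_mul_sub_mul_iota hKJ kα kα', kappa_mul_neg_mul_iota_sub hJ hKJ kα kα'
          (genArr_mul_vert_one ho.s_eq.2)]
  · have hw' : Q.D w ≠ Q.D x.1.1 := by rw [hv]; exact hw
    obtain ⟨hb, hout⟩ := ho.outArrows_of_ne h.ne_C hw'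
    refine ⟨_, _, hout, fun y => ?_, fun y => ?_⟩
    · rw [fiber, h.psiInvLin_symm_out hd hw', ← Q.smul_mul_mem_idealC_iff two_ne_zero, outPart,
        if_neg hw, ← two_smul_preArrow_fiber_of_right_H ho.s_eq.1 hv]
      rfl
    · rw [h.psiInvLin_symm_out hd hw', ← Q.smul_mul_mem_idealC_iff (neg_ne_zero.mpr two_ne_zero),
        outPart, if_neg hw,
        neg_two_smul_preArrow_true_of_right_H hb ho.s_eq.1 hv (by rw [ho.2.1]; exact hw)]

theorem SpecialCond.exists_inArrows_H (h : Q.SpecialCond I x.1.1 u w α α' β β')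
    (hd : Q.DiagonalizesPairs α α' β β' d) (hv : Q.D x.1.1 = .H) :
    ∃ b₁ b₂, Q.complexified.inArrows x = {b₁, b₂} ∧
      (∀ y, y * Q.psiInvLin (d.symm (Q.complexified.arrow ℂ b₁)) ∈ Q.idealC I ↔
        y * Q.cx (Q.inPart x.1.1 u β β') (-(Q.iotaAt x.1.1 * Q.inPart x.1.1 u β β')) ∈
          Q.idealC I) ∧
      (∀ y, y * Q.psiInvLin (d.symm (Q.complexified.arrow ℂ b₂)) ∈ Q.idealC I ↔
        y * Q.cx (Q.kappaAt x.1.1 * Q.inPart x.1.1 u β β')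
          (-(Q.iotaAt x.1.1 * (Q.kappaAt x.1.1 * Q.inPart x.1.1 u β β'))) ∈ Q.idealC I) := by
  have hi := h.isInHalf
  have hJ := iotaAt_mul_iotaAt (Q := Q) (v := x.1.1) (by simp [hv])
  have hKJ := kappaAt_mul_iotaAt (Q := Q) hv
  by_cases hu : Q.D u = .H
  · have hne : β ≠ β' := hi.2.2.2.mpr (hu.trans hv.symm)
    obtain ⟨e₁, e₂⟩ := hd.psiInvLin_symm_pair hne (Or.inr ⟨rfl, rfl⟩)
    have gβ := genArr_mul_vert_one (Q := Q) hi.2.1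
    have gβ' := genArr_mul_vert_one (Q := Q) hi.2.2.1
    have kβ := (kappaAt_mul_genArr (Q := Q) hi.t_eq.1 hi.2.1 hv hu).symm
    have kβ' := (kappaAt_mul_genArr (Q := Q) hi.t_eq.2 hi.2.2.1 hv hu).symm
    refine ⟨_, _, hi.inArrows_of_eq h.ne_C (hu.trans hv.symm), fun y => ?_, fun y => ?_⟩
    · rw [← Q.mul_smul_mem_idealC_iff two_ne_zero, e₁, smul_add, smul_comm,
        two_smul_preArrow_fiber_of_left_H hi.t_eq.1 hv,
        two_smul_preArrow_fiber_of_left_H hi.t_eq.2 hv, cx_add_I_smul, inPart, if_pos hu,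
        iota_mul_add_iota_mul hJ (vert_one_mul_genArr hi.t_eq.2), sub_neg_eq_add]
    · rw [← Q.mul_smul_mem_idealC_iff two_ne_zero, e₂, smul_sub, smul_comm,
        two_smul_preArrow_fiber_of_left_H hi.t_eq.1 hv,
        two_smul_preArrow_fiber_of_left_H hi.t_eq.2 hv, cx_sub_I_smul, inPart, if_pos hu,
        -- Now the unit `𝐤` at `u` is inserted on the right.
        ← mul_cx_mul_vert_mem_iff (a := (Q.D u).kappa) (b := -(Q.D u).kappa)
          (by rw [mul_neg, DivRing.kappa_mul_kappa hu, neg_neg])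
          (by rw [add_mul, neg_mul_tensorAlg, mul_assoc, gβ, gβ'])
          (by rw [sub_mul, neg_mul_tensorAlg, mul_assoc, gβ, gβ']),
        ← kappaAt, sub_iota_mul_mul_kappa hKJ kβ kβ', neg_iota_mul_sub_mul_kappa hJ hKJ kβ kβ'
          (by rw [kappaAt, vert_one_mul_vert_mul])]
  · have hu' : Q.D u ≠ Q.D x.1.1 := by rw [hv]; exact hu
    obtain ⟨hb, hin⟩ := hi.inArrows_of_ne h.ne_C hu'
    refine ⟨_, _, hin, fun y => ?_, fun y => ?_⟩
    · rw [fiber, h.psiInvLin_symm_in hd hu', ← Q.mul_smul_mem_idealC_iff two_ne_zero, inPart,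
        if_neg hu, ← two_smul_preArrow_fiber_of_left_H hi.t_eq.1 hv]
      rfl
    · rw [h.psiInvLin_symm_in hd hu', ← Q.mul_smul_mem_idealC_iff two_ne_zero, inPart,
        if_neg hu, two_smul_preArrow_true_of_left_H hb hi.t_eq.1 hv (by rw [hi.2.1]; exact hu)]

/-- The unit `𝐢` or `𝐣` at `w` passes through the generators to `𝐣` at `v`, and `𝐣` commutes with
itself in the second summand of `X`. -/
theorem iotaAt_mul_outPart {v : V} (ho : Q.IsOutHalf v w α α') (hw : Q.D w ≠ .R)
    (hv : Q.D v = .H) :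
    Q.iotaAt w * Q.outPart v w α α' = Q.outPart v w α α' * Q.iotaAt v := by
  have hv' : Q.D v ≠ .R := by simp [hv]
  rw [outPart]
  split_ifs
  · rw [mul_add, add_mul, ← mul_assoc, iotaAt_mul_genArr ho.2.1 ho.s_eq.1 hw hv' (Or.inr hv),
      iotaAt_mul_genArr ho.2.2.1 ho.s_eq.2 hw hv' (Or.inr hv)]
  · exact iotaAt_mul_genArr ho.2.1 ho.s_eq.1 hw hv' (Or.inr hv)

theorem inPart_mul_iotaAt {v : V} (hi : Q.IsInHalf v u β β') (hu : Q.D u ≠ .R)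
    (hv : Q.D v = .H) :
    Q.inPart v u β β' * Q.iotaAt u = Q.iotaAt v * Q.inPart v u β β' := by
  have hv' : Q.D v ≠ .R := by simp [hv]
  rw [inPart]
  split_ifs
  · rw [mul_add, add_mul, mul_assoc, iotaAt_mul_genArr hi.t_eq.1 hi.2.1 hv' hu (Or.inl hv),
      iotaAt_mul_genArr hi.t_eq.2 hi.2.2.1 hv' hu (Or.inl hv)]
  · exact (iotaAt_mul_genArr hi.t_eq.1 hi.2.1 hv' hu (Or.inl hv)).symm

/-- The nine rows of the table with `𝓜(v) = ℍ` are the expansions of `XY` for `I_v^0` and of `X𝐤Y`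
for `I_v^1`. Only `ℝℍℝ` also needs the products with an additional `𝐣`; elsewhere a unit at `w` or
`u` supplies it. -/
theorem mem_and_mem_iff_of_H (ho : Q.IsOutHalf x.1.1 w α α') (hi : Q.IsInHalf x.1.1 u β β')
    (hv : Q.D x.1.1 = .H) :
    ((∀ r ∈ Q.rel₀ α α' β β' (Q.D u) (Q.D x.1.1) (Q.D w), r ∈ I) ↔
      Q.outPart x.1.1 w α α' * Q.inPart x.1.1 u β β' ∈ I ∧
        Q.outPart x.1.1 w α α' * (Q.iotaAt x.1.1 * Q.inPart x.1.1 u β β') ∈ I) ∧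
    ((∀ r ∈ Q.rel₁ α α' β β' (Q.D u) (Q.D x.1.1) (Q.D w), r ∈ I) ↔
      Q.outPart x.1.1 w α α' * (Q.kappaAt x.1.1 * Q.inPart x.1.1 u β β') ∈ I ∧
        Q.outPart x.1.1 w α α' *
          (Q.iotaAt x.1.1 * (Q.kappaAt x.1.1 * Q.inPart x.1.1 u β β')) ∈ I) := by
  have hsα : Q.D (Q.s α) = .H := by rw [ho.s_eq.1, hv]
  have hsα' : Q.D (Q.s α') = .H := by rw [ho.s_eq.2, hv]
  have htβ : Q.D (Q.t β) = .H := by rw [hi.t_eq.1, hv]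
  have htβ' : Q.D (Q.t β') = .H := by rw [hi.t_eq.2, hv]
  have hJ := iotaAt_mul_iotaAt (Q := Q) (v := x.1.1) (by simp [hv])
  have hKJ := kappaAt_mul_iotaAt (Q := Q) hv
  have oα (hw : Q.D w ≠ .C) : Q.arr α ((Q.M α).elt .o) = Q.genArr α := by
    rw [← ho.2.1] at hw
    exact congrArg _ ((Q.M α).elt_o (by cases h : Q.D (Q.t α) <;> simp_all))
  have oα' (hw : Q.D w ≠ .C) : Q.arr α' ((Q.M α').elt .o) = Q.genArr α' := by
    rw [← ho.2.2.1] at hw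
    exact congrArg _ ((Q.M α').elt_o (by cases h : Q.D (Q.t α') <;> simp_all))
  have eα (hw : Q.D w = .C) : Q.arr α ((Q.M α).elt .e₁) = Q.genArr α :=
    congrArg _ ((Q.M α).elt_e₁ (Or.inr ⟨by rw [ho.2.1, hw], hsα⟩))
  have kα (hw : Q.D w ≠ .C) : Q.arr α ((Q.M α).elt .k) = Q.genArr α * Q.kappaAt x.1.1 := by
    rw [genArr, Q.arr_mul_kappaAt ho.s_eq.1, (Q.M α).elt_k_right (by rw [ho.2.1]; exact hw) hsα]
  have jα' (hw : Q.D w ≠ .C) : Q.arr α' ((Q.M α').elt .j) = Q.genArr α' * Q.iotaAt x.1.1 := by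
    rw [genArr, Q.arr_mul_iotaAt ho.s_eq.2, (Q.M α').elt_j_right (by rw [ho.2.2.1]; exact hw) hsα']
  have lα' (hw : Q.D w ≠ .C) : Q.arr α' ((Q.M α').elt .l) =
      Q.genArr α' * Q.iotaAt x.1.1 * Q.kappaAt x.1.1 := by
    rw [genArr, Q.arr_mul_iotaAt ho.s_eq.2, Q.arr_mul_kappaAt ho.s_eq.2,
      (Q.M α').elt_l_right (by rw [ho.2.2.1]; exact hw) hsα']
  have oβ (hu : Q.D u ≠ .C) : Q.arr β ((Q.M β).elt .o) = Q.genArr β := by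
    rw [← hi.2.1] at hu
    exact congrArg _ ((Q.M β).elt_o (by cases h : Q.D (Q.s β) <;> simp_all))
  have oβ' (hu : Q.D u ≠ .C) : Q.arr β' ((Q.M β').elt .o) = Q.genArr β' := by
    rw [← hi.2.2.1] at hu
    exact congrArg _ ((Q.M β').elt_o (by cases h : Q.D (Q.s β') <;> simp_all))
  have eβ (hu : Q.D u = .C) : Q.arr β ((Q.M β).elt .e₁) = Q.genArr β :=
    congrArg _ ((Q.M β).elt_e₁ (Or.inl ⟨htβ, by rw [hi.2.1, hu]⟩))
  have fβ (hu : Q.D u = .C) : Q.arr β ((Q.M β).elt .e₂) = -(Q.kappaAt x.1.1 * Q.genArr β) := by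
    rw [genArr, Q.kappaAt_mul_arr hi.t_eq.1, (Q.M β).elt_e₂_left htβ (by rw [hi.2.1, hu]), arr_neg]
  have hjkl {γ : E} (ht : Q.t γ = x.1.1) (hs : Q.s γ = u) (hu : Q.D u ≠ .C) :
      Q.arr γ ((Q.M γ).elt .j) = Q.iotaAt x.1.1 * Q.genArr γ ∧
      Q.arr γ ((Q.M γ).elt .k) = Q.kappaAt x.1.1 * Q.genArr γ ∧
      Q.arr γ ((Q.M γ).elt .l) = Q.iotaAt x.1.1 * (Q.kappaAt x.1.1 * Q.genArr γ) := by
    rw [genArr, Q.kappaAt_mul_arr ht, Q.iotaAt_mul_arr ht, Q.iotaAt_mul_arr ht]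
    subst hs
    rw [← ht] at hv
    rw [(Q.M γ).elt_j_left hv hu, (Q.M γ).elt_k_left hv hu, (Q.M γ).elt_l_left hv hu]
    exact ⟨rfl, rfl, rfl⟩
  have jβ := hjkl hi.t_eq.1 hi.2.1
  have jβ' := hjkl hi.t_eq.2 hi.2.2.1
  have xα (hw : Q.D w = .H) :
      Q.outPart x.1.1 w α α' = Q.genArr α + Q.genArr α' * Q.iotaAt x.1.1 := by
    rw [outPart, if_pos hw]
  have zα (hw : Q.D w ≠ .H) : Q.outPart x.1.1 w α α' = Q.genArr α := by rw [outPart, if_neg hw]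
  have yβ (hu : Q.D u = .H) :
      Q.inPart x.1.1 u β β' = Q.genArr β + Q.iotaAt x.1.1 * Q.genArr β' := by
    rw [inPart, if_pos hu]
  have zβ (hu : Q.D u ≠ .H) : Q.inPart x.1.1 u β β' = Q.genArr β := by rw [inPart, if_neg hu]
  have hβ' := vert_one_mul_genArr (Q := Q) hi.t_eq.2
  have hkβ' : Q.vert x.1.1 1 * (Q.kappaAt x.1.1 * Q.genArr β') = Q.kappaAt x.1.1 * Q.genArr β' :=
    vert_one_mul_vert_mul _ _
  have hl (hw : Q.D w ≠ .R) : Q.iotaAt w * Q.outPart x.1.1 w α α' =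
      Q.outPart x.1.1 w α α' * Q.iotaAt x.1.1 := iotaAt_mul_outPart ho hw hv
  have hr (hu : Q.D u ≠ .R) : Q.inPart x.1.1 u β β' * Q.iotaAt u =
      Q.iotaAt x.1.1 * Q.inPart x.1.1 u β β' := inPart_mul_iotaAt hi hu hv
  have imp (hwu : Q.D w ≠ .R ∨ Q.D u ≠ .R) :
      (Q.outPart x.1.1 w α α' * Q.inPart x.1.1 u β β' ∈ I →
        Q.outPart x.1.1 w α α' * (Q.iotaAt x.1.1 * Q.inPart x.1.1 u β β') ∈ I) ∧
      (Q.outPart x.1.1 w α α' * (Q.kappaAt x.1.1 * Q.inPart x.1.1 u β β') ∈ I →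
        Q.outPart x.1.1 w α α' *
          (Q.iotaAt x.1.1 * (Q.kappaAt x.1.1 * Q.inPart x.1.1 u β β')) ∈ I) := by
    rcases hwu with hw | hu
    · rw [← mul_assoc, ← hl hw, ← mul_assoc _ (Q.iotaAt _), ← hl hw, mul_assoc, mul_assoc]
      exact ⟨I.mul_mem_left _ _, I.mul_mem_left _ _⟩
    · constructor
      · rw [← hr hu, ← mul_assoc]
        exact I.mul_mem_right _ _
      -- Right multiplication by `ι` at `u` gives `X𝐤𝐣Y`, which is `-X𝐣𝐤Y`.
      · intro h'
        have := I.mul_mem_right _ (Q.iotaAt u) h'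
        rwa [mul_assoc, mul_assoc, hr hu, ← mul_assoc (Q.kappaAt _), hKJ, neg_mul_tensorAlg,
          mul_neg_tensorAlg, neg_mem_twoSidedIdeal_iff, mul_assoc] at this
  rw [hv]
  cases hu : Q.D u <;> cases hw : Q.D w <;>
    simp only [rel₀, rel₁, tens, Set.mem_insert_iff, Set.mem_singleton_iff, forall_eq_or_imp,
      forall_eq, oα, oα', eα, kα, jα', lα', oβ, oβ', eβ, fβ, jβ, jβ', hu, hw, ne_eq, reduceCtorEq,
      not_false_eq_true, mul_neg_tensorAlg, neg_mem_twoSidedIdeal_iff, mul_assoc]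
  case R.R => rw [zα (by simp [hw]), zβ (by simp [hu])]; exact ⟨Iff.rfl, Iff.rfl⟩
  all_goals refine ⟨mem_iff_mem_and_mem_of_eq ?_ (imp (by simp [hu, hw])).1,
    mem_iff_mem_and_mem_of_eq ?_ (imp (by simp [hu, hw])).2⟩
  case R.C.refine_1 => rw [zα (by simp [hw]), zβ (by simp [hu])]
  case R.C.refine_2 => rw [zα (by simp [hw]), zβ (by simp [hu])]
  case R.H.refine_1 => rw [xα hw, zβ (by simp [hu]), add_mul_iota_mul]
  case R.H.refine_2 => rw [xα hw, zβ (by simp [hu]), add_mul_iota_mul]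
  case C.R.refine_1 => rw [zα (by simp [hw]), zβ (by simp [hu])]
  case C.R.refine_2 => rw [zα (by simp [hw]), zβ (by simp [hu])]
  case C.C.refine_1 => rw [zα (by simp [hw]), zβ (by simp [hu])]
  case C.C.refine_2 => rw [zα (by simp [hw]), zβ (by simp [hu])]
  case C.H.refine_1 => rw [xα hw, zβ (by simp [hu]), add_mul_iota_mul]
  case C.H.refine_2 => rw [xα hw, zβ (by simp [hu]), add_mul_iota_mul]
  case H.R.refine_1 => rw [zα (by simp [hw]), yβ hu, mul_add]
  case H.R.refine_2 => rw [zα (by simp [hw]), yβ hu, mul_add_iota_mul hKJ]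
  case H.C.refine_1 => rw [zα (by simp [hw]), yβ hu, mul_add]
  case H.C.refine_2 => rw [zα (by simp [hw]), yβ hu, mul_add_iota_mul hKJ]
  case H.H.refine_1 => rw [xα hw, yβ hu, add_mul_iota_mul_add hJ hβ']
  case H.H.refine_2 => rw [xα hw, yβ hu, add_mul_iota_mul_kappa_add hJ hKJ hkβ']

theorem vert_one_mul_inPart (hi : Q.IsInHalf x.1.1 u β β') :
    Q.vert x.1.1 1 * Q.inPart x.1.1 u β β' = Q.inPart x.1.1 u β β' := by
  have h := vert_one_mul_genArr (Q := Q) hi.t_eq.1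
  rw [inPart]
  split_ifs
  · rw [mul_add, h, iotaAt, vert_one_mul_vert_mul]
  · exact h

theorem SpecialCond.isGentleVertex_of_H (h : Q.SpecialCond I x.1.1 u w α α' β β')
    (hd : Q.DiagonalizesPairs α α' β β' d) (hv : Q.D x.1.1 = .H) :
    Q.complexified.IsGentleVertex (Q.twistedIdeal I d) x := by
  obtain ⟨a₁, a₂, hout, ha₁, ha₂⟩ := h.exists_outArrows_H hd hv
  obtain ⟨b₁, b₂, hin, hb₁, hb₂⟩ := h.exists_inArrows_H hd hv
  obtain ⟨h₀, h₁⟩ := mem_and_mem_iff_of_H (I := I) h.isOutHalf h.isInHalf hv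
  have hJ := iotaAt_mul_iotaAt (Q := Q) (v := x.1.1) (by simp [hv])
  have hK := kappaAt_mul_kappaAt (Q := Q) hv
  have hKJ := kappaAt_mul_iotaAt (Q := Q) hv
  have hY := vert_one_mul_inPart h.isInHalf
  have hYJ : ∀ {X Y : Q.TensorAlg}, Q.vert x.1.1 1 * Y = Y →
      X * (Q.iotaAt x.1.1 * (Q.iotaAt x.1.1 * Y)) = -(X * Y) := fun {X Y} h => by
    rw [← mul_assoc (Q.iotaAt _), hJ, neg_mul_tensorAlg, h, mul_neg_tensorAlg]
  have hKY : Q.vert x.1.1 1 * (Q.kappaAt x.1.1 * Q.inPart x.1.1 u β β') =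
      Q.kappaAt x.1.1 * Q.inPart x.1.1 u β β' := vert_one_mul_vert_mul _ _
  refine h.isGentleVertex_of_mul_mem_iff hout hin ha₁ ha₂ hb₁ hb₂ ?_ ?_ ?_ ?_
  · rw [cx_mul, cx_mem_idealC, h₀]
    exact mem_and_mem_of_quaternion (hYJ hY)
  · rw [cx_mul, cx_mem_idealC, h₀]
    -- The second diagonal product reduces to the first by `𝐤𝐤 = -1` and `𝐤𝐣𝐤 = 𝐣`.
    refine (mem_and_mem_of_quaternion (hYJ hKY)).trans ?_
    rw [mul_kappa_kappa_mul hK hY, mul_kappa_iota_kappa_mul hK hKJ hY, neg_mem_twoSidedIdeal_iff]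
  · rw [cx_mul, cx_mem_idealC, h₁]
    exact mem_and_mem_of_quaternion (hYJ hKY)
  · rw [cx_mul, cx_mem_idealC, h₁]
    -- The second mixed product reduces to the first by `𝐤𝐣 = -𝐣𝐤`.
    refine (mem_and_mem_of_quaternion (hYJ hY)).trans ?_
    rw [mul_kappa_iota_mul hKJ, neg_mem_twoSidedIdeal_iff, mul_assoc]

end ComplexifiedGentle.ModulatedQuiver

/-! ### The proposition -/

theorem mainTheorem8 {V E : Type*} [Fintype V] [Fintype E] [DecidableEq V] [DecidableEq E]
    (Q : ComplexifiedGentle.ModulatedQuiver V E) (I : TwoSidedIdeal Q.TensorAlg) (v : V)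
    (hv : Q.IsGentle I v) :
    (∃ d, Q.IsDiagonalization I v d) ∧
      ∀ d, Q.IsDiagonalization I v d →
        (∃ φ : (Q.complexifiedIdeal I).ringCon.Quotient ≃ₐ[ℂ] (Q.twistedIdeal I d).ringCon.Quotient,
          ∀ x, φ ((Q.complexifiedIdeal I).ringCon.mkₐ ℂ x) =
            (Q.twistedIdeal I d).ringCon.mkₐ ℂ (d x)) ∧
        ∀ x : Q.CVertex, x.1.1 = v → Q.complexified.IsGentleVertex (Q.twistedIdeal I d) x := by
  refine ⟨?_, fun d hd => ⟨Q.exists_quotient_equiv I d, ?_⟩⟩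
  · rcases hv with h | ⟨u, w, α, α', β, β', h⟩ | h
    · exact ⟨.refl, Or.inl ⟨Or.inl h, rfl⟩⟩
    · obtain ⟨d, hd⟩ := h.exists_diagonalizesPairs
      exact ⟨d, Or.inr ⟨u, w, α, α', β, β', h, hd⟩⟩
    · exact ⟨.refl, Or.inl ⟨Or.inr h, rfl⟩⟩
  · rintro x rfl
    -- The cases are those which define `d`, not those of `hv`: a vertex may be gentle for several
    -- reasons, and `d` is attached to one of them.
    rcases hd with ⟨h | h, rfl⟩ | ⟨u, w, α, α', β, β', h, hd⟩
    · rw [ComplexifiedGentle.ModulatedQuiver.twistedIdeal_refl]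
      exact ComplexifiedGentle.ModulatedQuiver.isGentleVertex_of_isOrdinarilyGentle Q h
    · exact ComplexifiedGentle.ModulatedQuiver.isGentleVertex_of_isDegenerate h
    · cases hD : Q.D x.1.1
      · exact h.isGentleVertex_of_R hd hD
      · exact absurd hD h.ne_C
      · exact h.isGentleVertex_of_H hd hD
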